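/- **Proposition 4.5.** Let $k=\mathbb C[[h]]$, $q=e^{-h}$, $(q)_n=\prod_{i=1}^n(1-q^i)$. Let $A=U_h(b(2,\mathbb C))$ be the topological Hopf algebra over $k$ topologically generated by $H,D$ with $HD-DH=D$ and $$\Delta(H)=H\otimes 1+1\otimes H,\qquad \Delta(D)=1\otimes D+D\otimes e^{hH},\qquad \epsilon(H)=\epsilon(D)=0 ,$$ tensor products being completed. Let $A^\circ=\mathrm{Hom}_k(A,k)$ with the product dual to $\Delta$, let $\bar H,\bar D\in A^\circ$ be the forms with $\langle \bar H,H^mD^n\rangle=\delta_{m,1}\delta_{n,0}$ and $\langle \bar D,H^mD^n\rangle=(1-q)\,\delta_{m,0}\delta_{n,1}$, and let $A^*=U_h^*(b(2,\mathbb C))\subset A^\circ$ be the algebra topologically generated over $k$ by $\bar H$ and $\bar D$. Here an algebra "topologically generated over $k$" by a set consists of all $h$-adic sums $\sum_n h^n b_n$ with $b_n$ in the $k$-algebra generated by that set, and an algebra topologically generated by letters with relations is the quotient of the algebra $\mathbb C\langle\text{letters}\rangle[[h]]$ by the $h$-adic closure of the two-sided ideal generated by the relations. The Heisenberg double $\mathcal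 H_h(b(2,\mathbb C))$ is $\mathbb C((h))\otimes_k\mathcal H$, where $\mathcal H\subset\mathrm{End}_k(A^\circ)$ is the subalgebra topologically generated over $k$ by the operators $\pi_A(a)$, $(\pi_A(a)x)(b)=x(ba)$, for $a\in A$, and by the left multiplications $\pi_{A^*}(x)$ for $x\in A^*$. 1. $\mathcal H_h(b(2,\mathbb C))$ is isomorphic, as a topological $\mathbb C((h))$-algebra and with $\pi_A(H),\pi_A(D),\pi_{A^*}(\bar H),\pi_{A^*}(\bar D)$ corresponding to the generators (the isomorphism being already defined over $k$), to the $\mathbb C((h))$-algebra topologically generated over $\mathbb C[[h]]$ by $H,D,\bar H,\bar D$ with the relations $$\begin{aligned} HD-DH&=D, & \bar H\bar D-\bar D\bar H&=-h\bar D,\\ H\bar H-\bar HH&=1, & D\bar H&=\bar HD,\\ H\bar D-\bar DH&=-\bar D, & D\bar D-\bar DD&=(1-q)e^{hH}.\end{aligned}$$ 2. The elements $e_{m,n}=H^mD^n/(m!\,(q)_n)$ and $e^{m,n}=\bar H^m\bar D^n$ are dual to each other, and $(H^mD^n)_{m,n\ge0}$ is a topological basis of $A$, with dual basis $\bar H^m\bar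 D^n/(m!\,(q)_n)\in A^\circ$. 3. The canonical element $R_h=\sum_\gamma e_\gamma\otimes e^\gamma$ of the double ($(e_\gamma)$, $(e^\gamma)$ any dual topological bases of $A$ and $A^\circ$), viewed as an operator on $\mathbb C((h))\otimes_k\mathrm{Hom}_k(A\otimes A,k)$ (all sums being weakly and $h$-adically convergent), exists and equals $$R_h=e^{H\otimes\bar H}\,(D\otimes\bar D;q)_\infty^{-1},\qquad (x;q)_\infty=\sum_{n\ge0}\frac{q^{n(n-1)/2}(-x)^n}{(q)_n},$$ where $(D\otimes\bar D;q)_\infty$ is invertible. More generally, for $n\ge2$ and distinct $i,j\in\{1,\dots,n\}$, the same holds for $R_{ij}=\sum_\gamma (e_\gamma)_i(e^\gamma)_j$, acting on the tensor factors $i$ and $j$ of $\mathbb C((h))\otimes_k\mathrm{Hom}_k(A^{\otimes n},k)$: it exists and equals $e^{H_i\bar H_j}(D_i\bar D_j;q)_\infty^{-1}$. 4. For $n=3$ these operators satisfy the pentagon equation $R_{12}R_{13}R_{23}=R_{23}R_{12}$. -/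

import Mathlib

open scoped TensorProduct PowerSeries

noncomputable section

namespace HeisenbergDouble

/-! ### Formal series in `h` -/

/-- The base ring `ℂ[[h]]`; the variable `PowerSeries.X` plays the role of `h`. -/
abbrev Ch : Type := ℂ⟦X⟧

/-- The field `ℂ((h))`. -/
abbrev ChField : Type := LaurentSeries ℂ

/-- `M[[h]]`: formal series in the central variable `h` with coefficients in `M`.  If `M` and `N`
are complex vector spaces, the `h`-adically completed tensor product over `ℂ[[h]]` of `M[[h]]` and
`N[[h]]` is `(M ⊗ N)[[h]]`. -/
def HSer (M : Type) : Type := PowerSeries M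

namespace HSer

instance {M : Type} [Ring M] : Ring (HSer M) := inferInstanceAs (Ring (PowerSeries M))

instance {M : Type} [Ring M] [Algebra ℂ M] : Algebra ℂ (HSer M) :=
  inferInstanceAs (Algebra ℂ (PowerSeries M))

/-- The `n`-th coefficient of a series. -/
def coeff {M : Type} [Ring M] [Algebra ℂ M] (n : ℕ) : HSer M →ₗ[ℂ] M where
  toFun x := PowerSeries.coeff n (show PowerSeries M from x)
  map_add' x y := map_add (PowerSeries.coeff (R := M) n) x y
  map_smul' _ _ := rfl

/-- The series with given coefficients. -/
def mk {M : Type} (f : ℕ → M) : HSer M := PowerSeries.mk f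

/-- Constant series. -/
def const {M : Type} [Ring M] (m : M) : HSer M := (PowerSeries.C m : PowerSeries M)

theorem coeff_mk {M : Type} [Ring M] [Algebra ℂ M] (f : ℕ → M) (n : ℕ) :
    coeff n (mk f) = f n := PowerSeries.coeff_mk n f

theorem ext {M : Type} [Ring M] [Algebra ℂ M] {x y : HSer M}
    (H : ∀ n, coeff n x = coeff n y) : x = y := PowerSeries.ext H

theorem coeff_mul {M : Type} [Ring M] [Algebra ℂ M] (n : ℕ) (x y : HSer M) :
    coeff n (x * y) = ∑ p ∈ Finset.HasAntidiagonal.antidiagonal n, coeff p.1 x * coeff p.2 y :=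
  PowerSeries.coeff_mul (R := M) n x y

/-- `ℂ[[h]] → M[[h]]`. -/
def ofCh (M : Type) [Ring M] [Algebra ℂ M] : Ch →+* HSer M :=
  (PowerSeries.map (algebraMap ℂ M) : ℂ⟦X⟧ →+* M⟦X⟧)

theorem coeff_ofCh {M : Type} [Ring M] [Algebra ℂ M] (n : ℕ) (c : Ch) :
    coeff n (ofCh M c) = algebraMap ℂ M (PowerSeries.coeff n c) :=
  PowerSeries.coeff_map (algebraMap ℂ M) n c

instance {M : Type} [Ring M] [Algebra ℂ M] : Algebra Ch (HSer M) :=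
  (ofCh M).toAlgebra' (by
    intro c x
    refine ext fun n => ?_
    rw [coeff_mul, coeff_mul, ← Finset.sum_equiv (Equiv.prodComm ℕ ℕ)
      (t := Finset.HasAntidiagonal.antidiagonal n) (s := Finset.HasAntidiagonal.antidiagonal n)
      (f := fun p => coeff p.2 (ofCh M c) * coeff p.1 x)]
    · refine Finset.sum_congr rfl fun p _ => ?_
      rw [coeff_ofCh]
      exact Algebra.commutes _ _
    · intro p
      simp [add_comm]
    · intro p _
      rfl)

theorem coeff_smul {M : Type} [Ring M] [Algebra ℂ M] (n : ℕ) (c : Ch) (x : HSer M) :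
    coeff n (c • x) = ∑ p ∈ Finset.HasAntidiagonal.antidiagonal n, PowerSeries.coeff p.1 c • coeff p.2 x := by
  rw [Algebra.smul_def, coeff_mul]
  refine Finset.sum_congr rfl fun p _ => ?_
  rw [Algebra.smul_def]
  exact congrArg (· * coeff p.2 x) (coeff_ofCh p.1 c)

theorem smul_const {M : Type} [Ring M] [Algebra ℂ M] (c : ℂ) (m : M) :
    const (c • m) = (PowerSeries.C c : Ch) • const m := by
  refine ext fun n => ?_
  rw [coeff_smul, Finset.sum_eq_single (0, n)]
  · change PowerSeries.coeff n (PowerSeries.C (c • m))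
      = PowerSeries.coeff 0 (PowerSeries.C c) • PowerSeries.coeff n (PowerSeries.C m)
    rw [PowerSeries.coeff_C, PowerSeries.coeff_C, PowerSeries.coeff_C]
    split_ifs <;> simp_all
  · rintro ⟨a, b⟩ hab hne
    have ha : a ≠ 0 := by
      rintro rfl
      simp at hab
      exact hne (by simp [hab])
    simp [PowerSeries.coeff_C, ha]
  · simp

/-- A family `φ 0, φ 1, …` of complex linear maps acts as `φ 0 + h φ 1 + h² φ 2 + ⋯`; every
`ℂ[[h]]`-linear map from `M[[h]]` to `N[[h]]` is of this form. -/
def seriesMap {M N : Type} [Ring M] [Algebra ℂ M] [Ring N] [Algebra ℂ N]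
    (φ : ℕ → M →ₗ[ℂ] N) : HSer M →ₗ[Ch] HSer N where
  toFun t := mk fun n => ∑ p ∈ Finset.HasAntidiagonal.antidiagonal n, φ p.1 (coeff p.2 t)
  map_add' x y := by
    refine ext fun n => ?_
    simp [coeff_mk, Finset.sum_add_distrib]
  map_smul' c x := by
    refine ext fun n => ?_
    rw [RingHom.id_apply, coeff_smul, coeff_mk]
    simp only [coeff_mk, coeff_smul, map_sum, map_smul, Finset.smul_sum]
    rw [Finset.sum_sigma', Finset.sum_sigma']
    refine Finset.sum_nbij' (fun p => ⟨(p.2.1, p.1.1 + p.2.2), (p.1.1, p.2.2)⟩)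
      (fun p => ⟨(p.2.1, p.1.1 + p.2.2), (p.1.1, p.2.2)⟩) ?_ ?_ ?_ ?_ ?_
    · rintro ⟨⟨a, b⟩, ⟨c, d⟩⟩ H
      simp at H ⊢
      omega
    · rintro ⟨⟨a, b⟩, ⟨c, d⟩⟩ H
      simp at H ⊢
      omega
    · rintro ⟨⟨a, b⟩, ⟨c, d⟩⟩ H
      simp at H ⊢
      omega
    · rintro ⟨⟨a, b⟩, ⟨c, d⟩⟩ H
      simp at H ⊢
      omega
    · rintro ⟨⟨a, b⟩, ⟨c, d⟩⟩ _
      rfl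

/-- The coefficients of a `ℂ[[h]]`-linear map between spaces of series. -/
def mapCoeff {M N : Type} [Ring M] [Algebra ℂ M] [Ring N] [Algebra ℂ N]
    (T : HSer M →ₗ[Ch] HSer N) (j : ℕ) : M →ₗ[ℂ] N where
  toFun m := coeff j (T (const m))
  map_add' x y := by
    rw [← map_add, ← map_add]
    exact congrArg (fun z => coeff j (T z)) (map_add (PowerSeries.C (R := M)) x y)
  map_smul' c x := by
    rw [smul_const, map_smul, coeff_smul, RingHom.id_apply, Finset.sum_eq_single (0, j)]
    · simp
    · rintro ⟨a, b⟩ hab hne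
      have ha : a ≠ 0 := by
        rintro rfl
        simp at hab
        exact hne (by simp [hab])
      simp [PowerSeries.coeff_C, ha]
    · simp

/-- The coefficients of a `ℂ[[h]]`-linear form on `M[[h]]`. -/
def formCoeff {M : Type} [Ring M] [Algebra ℂ M]
    (x : Module.Dual Ch (HSer M)) (j : ℕ) : M →ₗ[ℂ] ℂ where
  toFun m := PowerSeries.coeff j (x (const m))
  map_add' y z := by
    rw [← map_add, ← map_add]
    exact congrArg (fun w => PowerSeries.coeff j (x w)) (map_add (PowerSeries.C (R := M)) y z)
  map_smul' c y := by
    rw [smul_const, map_smul, smul_eq_mul, PowerSeries.coeff_C_mul]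
    rfl

/-- The `ℂ[[h]]`-linear extension of a complex linear form on `M`. -/
def formExt {M : Type} [Ring M] [Algebra ℂ M] (f : M →ₗ[ℂ] ℂ) : Module.Dual Ch (HSer M) where
  toFun t := PowerSeries.mk fun n => f (coeff n t)
  map_add' x y := by
    ext n
    simp
  map_smul' c x := by
    ext n
    simp [coeff_smul, PowerSeries.coeff_mul]

/-- `e^{hu} = ∑ hⁿ uⁿ / n!`. -/
def hExp {M : Type} [Ring M] [Algebra ℂ M] (u : M) : HSer M :=
  mk fun n => ((n.factorial : ℂ)⁻¹) • u ^ n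

end HSer

open HSer

/-- `x = ∑ hⁿ bₙ`, the sum being convergent in the `h`-adic topology. -/
def IsHSum {M : Type} [AddCommGroup M] [Module Ch M] (b : ℕ → M) (x : M) : Prop :=
  ∀ N : ℕ, ∃ s : M,
    x = (∑ n ∈ Finset.range N, (PowerSeries.X : Ch) ^ n • b n) + (PowerSeries.X : Ch) ^ N • s

/-- The subalgebra topologically generated over `ℂ[[h]]` by `S`: all `h`-adic sums `∑ hⁿ bₙ` with
`bₙ` in the algebra generated by `S` (the image of the `h`-adic completion of that algebra). -/
def topAdjoin {E : Type} [Ring E] [Algebra Ch E] (S : Set E) : Subalgebra Ch E where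
  carrier := {T | ∃ b : ℕ → E, (∀ n, b n ∈ Algebra.adjoin Ch S) ∧ IsHSum b T}
  mul_mem' := by
    rintro x y ⟨b, hb, hx⟩ ⟨c, hc, hy⟩
    refine ⟨fun n => ∑ p ∈ Finset.HasAntidiagonal.antidiagonal n, b p.1 * c p.2, fun n =>
      Subalgebra.sum_mem _ fun p _ => Subalgebra.mul_mem _ (hb _) (hc _), fun N => ?_⟩
    obtain ⟨s, hs⟩ := hx N
    obtain ⟨t, ht⟩ := hy N
    have key : ∃ r : E, (∑ n ∈ Finset.range N, (PowerSeries.X : Ch) ^ n • b n) *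
        (∑ n ∈ Finset.range N, (PowerSeries.X : Ch) ^ n • c n) =
        (∑ n ∈ Finset.range N, (PowerSeries.X : Ch) ^ n •
          ∑ p ∈ Finset.HasAntidiagonal.antidiagonal n, b p.1 * c p.2) + (PowerSeries.X : Ch) ^ N • r := by
      refine ⟨∑ p ∈ (Finset.range N ×ˢ Finset.range N).filter (fun p => ¬ p.1 + p.2 < N),
        (PowerSeries.X : Ch) ^ (p.1 + p.2 - N) • (b p.1 * c p.2), ?_⟩
      rw [Finset.sum_mul_sum, ← Finset.sum_product',
        ← Finset.sum_filter_add_sum_filter_not _ (fun p : ℕ × ℕ => p.1 + p.2 < N)]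
      congr 1
      · simp only [Finset.smul_sum]
        rw [Finset.sum_sigma']
        refine Finset.sum_nbij' (fun p => ⟨p.1 + p.2, p⟩) (fun p => p.2) ?_ ?_ ?_ ?_ ?_
        · rintro ⟨i, j⟩ H
          simp at H ⊢
          omega
        · rintro ⟨n, ⟨i, j⟩⟩ H
          simp at H ⊢
          omega
        · rintro ⟨i, j⟩ _
          rfl
        · rintro ⟨n, ⟨i, j⟩⟩ H
          simp at H ⊢
          omega
        · rintro ⟨i, j⟩ _
          simp [smul_smul, ← pow_add, add_comm]
      · rw [Finset.smul_sum]
        refine Finset.sum_congr rfl fun p hp => ?_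
        have hN : N + (p.1 + p.2 - N) = p.1 + p.2 := by
          have := (Finset.mem_filter.1 hp).2
          omega
        rw [smul_smul, ← pow_add, hN, smul_mul_smul_comm, pow_add]
    obtain ⟨r, hr⟩ := key
    refine ⟨r + (∑ n ∈ Finset.range N, (PowerSeries.X : Ch) ^ n • b n) * t + s * y, ?_⟩
    rw [smul_add, smul_add, ← add_assoc, ← add_assoc, ← hr, ← mul_smul_comm, ← smul_mul_assoc,
      ← mul_add, ← ht, ← add_mul, ← hs]
  add_mem' := by
    rintro x y ⟨b, hb, hx⟩ ⟨c, hc, hy⟩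
    refine ⟨fun n => b n + c n, fun n => Subalgebra.add_mem _ (hb n) (hc n), fun N => ?_⟩
    obtain ⟨s, hs⟩ := hx N
    obtain ⟨t, ht⟩ := hy N
    refine ⟨s + t, ?_⟩
    conv_lhs => rw [hs, ht]
    simp only [smul_add, Finset.sum_add_distrib]
    abel
  algebraMap_mem' r := by
    refine ⟨fun n => if n = 0 then algebraMap Ch E r else 0, fun n => ?_, fun N => ?_⟩
    · dsimp only
      split_ifs
      · exact Subalgebra.algebraMap_mem _ r
      · exact Subalgebra.zero_mem _
    · rcases N with _ | N
      · exact ⟨algebraMap Ch E r, by simp⟩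
      · exact ⟨0, by simp⟩

/-! ### The QUE algebra of the Borel subalgebra -/

/-- Names of the generators `H`, `D`. -/
inductive BGen : Type
  | H
  | D

/-- The relation `HD - DH = D`. -/
inductive BRel : FreeAlgebra ℂ BGen → FreeAlgebra ℂ BGen → Prop
  | comm : BRel (FreeAlgebra.ι ℂ BGen.H * FreeAlgebra.ι ℂ BGen.D
      - FreeAlgebra.ι ℂ BGen.D * FreeAlgebra.ι ℂ BGen.H) (FreeAlgebra.ι ℂ BGen.D)

/-- The enveloping algebra of `b(2,ℂ)`: complex algebra generated by `H`, `D` with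
`HD - DH = D`. -/
def UB : Type := RingQuot BRel

instance : Ring UB := inferInstanceAs (Ring (RingQuot BRel))

instance : Algebra ℂ UB := inferInstanceAs (Algebra ℂ (RingQuot BRel))

/-- The quotient map from the free algebra. -/
def ubMk : FreeAlgebra ℂ BGen →ₐ[ℂ] UB := RingQuot.mkAlgHom ℂ BRel

/-- The generator `H` of the enveloping algebra. -/
def uH : UB := ubMk (FreeAlgebra.ι ℂ BGen.H)

/-- The generator `D` of the enveloping algebra. -/
def uD : UB := ubMk (FreeAlgebra.ι ℂ BGen.D)

/-- Algebra maps out of the enveloping algebra. -/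
def ubLift {B : Type} [Ring B] [Algebra ℂ B] (x y : B) (hxy : x * y - y * x = y) : UB →ₐ[ℂ] B :=
  RingQuot.liftAlgHom ℂ ⟨FreeAlgebra.lift ℂ (fun g => match g with
    | BGen.H => x
    | BGen.D => y), by
      intro a b hab
      cases hab
      simpa using hxy⟩

/-- `U_h(b(2,ℂ))` as an algebra: topologically generated over `ℂ[[h]]` by `H`, `D` with
`HD - DH = D`.  As the relation does not involve `h`, this is `U(b(2,ℂ))[[h]]`. -/
abbrev Uh : Type := HSer UB

/-- The generator `H` of `U_h(b(2,ℂ))`. -/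
def hH : Uh := const uH

/-- The generator `D` of `U_h(b(2,ℂ))`. -/
def hD : Uh := const uD

/-- `q = e^{-h}`. -/
def q : Ch := PowerSeries.mk fun n => (-1) ^ n / (n.factorial : ℂ)

/-- `Δ(H) = H ⊗ 1 + 1 ⊗ H`. -/
def comulH : HSer (UB ⊗[ℂ] UB) := const (uH ⊗ₜ 1 + 1 ⊗ₜ uH)

/-- `Δ(D) = 1 ⊗ D + D ⊗ e^{hH}`. -/
def comulD : HSer (UB ⊗[ℂ] UB) :=
  const (1 ⊗ₜ uD) + const (uD ⊗ₜ 1) * hExp (1 ⊗ₜ uH)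

theorem uH_mul_uD : uH * uD - uD * uH = uD := by
  have H : ubMk _ = ubMk _ := RingQuot.mkAlgHom_rel (S := ℂ) BRel.comm
  simpa [uH, uD] using H

theorem const_mul_hExp {M : Type} [Ring M] [Algebra ℂ M] (a u : M) (hc : Commute a u) :
    const a * hExp u = hExp u * const a := by
  refine HSer.ext fun n => ?_
  have h1 : coeff n (const a * hExp u) = a * coeff n (hExp u) :=
    PowerSeries.coeff_C_mul (R := M) n _ a
  have h2 : coeff n (hExp u * const a) = coeff n (hExp u) * a :=
    PowerSeries.coeff_mul_C (R := M) n _ a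
  rw [h1, h2, hExp, coeff_mk, mul_smul_comm, smul_mul_assoc, (hc.pow_right n).eq]

theorem comul_rel : comulH * comulD - comulD * comulH = comulD := by
  have hmul : ∀ a b : UB ⊗[ℂ] UB, const a * const b = const (a * b) := fun a b =>
    (map_mul (PowerSeries.C (R := UB ⊗[ℂ] UB)) a b).symm
  have hsub : ∀ a b : UB ⊗[ℂ] UB, const a - const b = const (a - b) := fun a b =>
    (map_sub (PowerSeries.C (R := UB ⊗[ℂ] UB)) a b).symm
  have hcomm : comulH * hExp ((1 : UB) ⊗ₜ[ℂ] uH) = hExp ((1 : UB) ⊗ₜ[ℂ] uH) * comulH := by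
    refine const_mul_hExp _ _ ?_
    simp [Commute, SemiconjBy, add_mul, mul_add]
  have e1 : comulH * const ((1 : UB) ⊗ₜ[ℂ] uD) - const ((1 : UB) ⊗ₜ[ℂ] uD) * comulH
      = const (1 ⊗ₜ uD) := by
    rw [comulH, hmul, hmul, hsub]
    congr 1
    simp only [add_mul, mul_add, Algebra.TensorProduct.tmul_mul_tmul, mul_one, one_mul]
    rw [add_sub_add_left_eq_sub, ← TensorProduct.tmul_sub, uH_mul_uD]
  have e2 : comulH * const (uD ⊗ₜ[ℂ] (1 : UB)) - const (uD ⊗ₜ[ℂ] (1 : UB)) * comulH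
      = const (uD ⊗ₜ 1) := by
    rw [comulH, hmul, hmul, hsub]
    congr 1
    simp only [add_mul, mul_add, Algebra.TensorProduct.tmul_mul_tmul, mul_one, one_mul]
    rw [add_sub_add_right_eq_sub, ← TensorProduct.sub_tmul, uH_mul_uD]
  rw [comulD, mul_add, add_mul, ← mul_assoc, mul_assoc (const (uD ⊗ₜ[ℂ] (1 : UB))), ← hcomm,
    ← mul_assoc, add_sub_add_comm, e1, ← sub_mul, e2]

/-- The comultiplication `Δ : U_h(b(2,ℂ)) → U_h(b(2,ℂ)) ⊗ U_h(b(2,ℂ))` (completed tensor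
product), the continuous algebra map with the above values on `H` and `D`. -/
def comul : Uh →ₗ[Ch] HSer (UB ⊗[ℂ] UB) :=
  seriesMap fun j => coeff j ∘ₗ (ubLift comulH comulD comul_rel).toLinearMap

/-! ### The dual and the two representations -/

/-- The linear dual `Hom(U_h, ℂ[[h]])`, with the product `Δ^*`; it contains the QUE dual defined
below, and both algebras act on it. -/
abbrev UhDual : Type := Module.Dual Ch Uh

/-- Right multiplication by `a`. -/
def rmul (a : Uh) : Uh →ₗ[Ch] Uh := LinearMap.mulRight Ch a

/-- `(x ⊗ id) ∘ Δ`. -/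
def contract (x : UhDual) : Uh →ₗ[Ch] Uh :=
  seriesMap (fun j => (TensorProduct.lid ℂ UB).toLinearMap ∘ₗ (formCoeff x j).rTensor UB) ∘ₗ comul

/-- `π_A(a) = (id ⊗ ev_a) m^*`, that is, `(π_A(a) x)(b) = x(ba)`. -/
def piA (a : Uh) : Module.End Ch UhDual := (rmul a).dualMap

/-- `π_{A^*}(x)`: left multiplication by `x` for the product `Δ^*` on the dual:
`(π_{A^*}(x) y)(b) = (x ⊗ y)(Δ b)`. -/
def piDual (x : UhDual) : Module.End Ch UhDual := (contract x).dualMap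

/-- The counit of `U_h(b(2,ℂ))`; it is the unit of the dual. -/
def counit : UhDual := formExt (ubLift (B := ℂ) 0 0 (by simp)).toLinearMap

/-- The form on `U(b(2,ℂ))` with `H^m D^n ↦ 1` if `(m, n) = (1, 0)` and `0` otherwise: a matrix
coefficient of the representation `H ↦ E₁₂`, `D ↦ 0`. -/
def formH : UB →ₗ[ℂ] ℂ where
  toFun u := ubLift (B := Matrix (Fin 2) (Fin 2) ℂ) !![0, 1; 0, 0] 0 (by simp) u 0 1
  map_add' := by simp
  map_smul' := by simp

/-- The form on `U(b(2,ℂ))` with `H^m D^n ↦ 1` if `(m, n) = (0, 1)` and `0` otherwise: a matrix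
coefficient of the representation `H ↦ -E₂₂`, `D ↦ E₁₂`. -/
def formD : UB →ₗ[ℂ] ℂ where
  toFun u := ubLift (B := Matrix (Fin 2) (Fin 2) ℂ) !![0, 0; 0, -1] !![0, 1; 0, 0]
    (by ext i j; fin_cases i <;> fin_cases j <;> simp) u 0 1
  map_add' := by simp
  map_smul' := by simp

/-- The element `H̄`, dual to `H`. -/
def Hbar : UhDual := formExt formH

/-- The element `D̄`, dual to `D / (1 - q)`. -/
def Dbar : UhDual := (1 - q) • formExt formD

/-- Monomials in `H̄`, `D̄` for the product of the dual. -/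
def dualWord : List BGen → UhDual
  | [] => counit
  | BGen.H :: l => piDual Hbar (dualWord l)
  | BGen.D :: l => piDual Dbar (dualWord l)

/-- The QUE dual `U_h^*(b(2,ℂ))`, topologically generated over `ℂ[[h]]` by `H̄` and `D̄`. -/
def queDual : Set UhDual :=
  {x | ∃ b : ℕ → UhDual, (∀ n, b n ∈ Submodule.span Ch (Set.range dualWord)) ∧ IsHSum b x}

/-- The Heisenberg double over `ℂ[[h]]`: the subalgebra of endomorphisms of the dual topologically
generated by the images of `π_A` and `π_{A^*}`. -/
def doubleInt : Subalgebra Ch (Module.End Ch UhDual) :=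
  topAdjoin (Set.range piA ∪ piDual '' queDual)

/-- The Heisenberg double of `U_h(b(2,ℂ))`, as a `ℂ((h))`-algebra. -/
abbrev Double : Type := ChField ⊗[Ch] doubleInt

/-! ### The presented algebra -/

/-- `x - y` lies in the `h`-adic closure of the two-sided ideal generated by `rels`. -/
def ClosedIdealRel {G : Type} (rels : Set (HSer (FreeAlgebra ℂ G)))
    (x y : HSer (FreeAlgebra ℂ G)) : Prop :=
  ∀ N : ℕ, ∃ z : HSer (FreeAlgebra ℂ G),
    x - y - (PowerSeries.X : Ch) ^ N • z ∈ TwoSidedIdeal.span rels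

/-- The algebra topologically generated over `ℂ[[h]]` by `G` with the relations `r = 0`, `r ∈ rels`:
the quotient of `ℂ⟨G⟩[[h]]` by the `h`-adic closure of the two-sided ideal generated by `rels`. -/
def TopPres {G : Type} (rels : Set (HSer (FreeAlgebra ℂ G))) : Type :=
  RingQuot (ClosedIdealRel rels)

instance {G : Type} (rels : Set (HSer (FreeAlgebra ℂ G))) : Ring (TopPres rels) :=
  inferInstanceAs (Ring (RingQuot (ClosedIdealRel rels)))

instance {G : Type} (rels : Set (HSer (FreeAlgebra ℂ G))) : Algebra Ch (TopPres rels) :=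
  inferInstanceAs (Algebra Ch (RingQuot (ClosedIdealRel rels)))

/-- The quotient map onto the presented algebra. -/
def TopPres.quot {G : Type} (rels : Set (HSer (FreeAlgebra ℂ G))) :
    HSer (FreeAlgebra ℂ G) →ₐ[Ch] TopPres rels :=
  RingQuot.mkAlgHom Ch (ClosedIdealRel rels)

/-- Names of the generators `H`, `D`, `H̄`, `D̄`. -/
inductive HGen : Type
  | H
  | D
  | Hb
  | Db

/-- A generator as a constant series. -/
def gen (g : HGen) : HSer (FreeAlgebra ℂ HGen) := const (FreeAlgebra.ι ℂ g)

open HGen in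
/-- The six defining relations. -/
def doubleRels : Set (HSer (FreeAlgebra ℂ HGen)) :=
  { gen H * gen D - gen D * gen H - gen D,
    gen Hb * gen Db - gen Db * gen Hb + (PowerSeries.X : Ch) • gen Db,
    gen H * gen Hb - gen Hb * gen H - 1,
    gen D * gen Hb - gen Hb * gen D,
    gen H * gen Db - gen Db * gen H + gen Db,
    gen D * gen Db - gen Db * gen D - (1 - q) • hExp (FreeAlgebra.ι ℂ HGen.H) }

/-- The algebra topologically generated over `ℂ[[h]]` by `H`, `D`, `H̄`, `D̄` with these
relations. -/
abbrev PresInt : Type := TopPres doubleRels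

/-- The same algebra with `h` inverted. -/
abbrev Pres : Type := ChField ⊗[Ch] PresInt

/-- The image of a generator in the presented algebra. -/
def presGen (g : HGen) : PresInt := TopPres.quot doubleRels (gen g)

/-! ### Tensor powers and the canonical element -/

/-- The completed tensor power `U_h(b(2,ℂ))^{⊗ n}`. -/
abbrev UhPow (n : ℕ) : Type := HSer (⨂[ℂ] _ : Fin n, UB)

/-- The operator `T` on the `i`-th tensor factor. -/
def leg {n : ℕ} (i : Fin n) (T : Uh →ₗ[Ch] Uh) : UhPow n →ₗ[Ch] UhPow n :=
  seriesMap fun j => PiTensorProduct.map (Function.update (fun _ => LinearMap.id) i (mapCoeff T j))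

/-- The (weakly) completed tensor power of the dual, `Hom(U_h^{⊗ n}, ℂ[[h]])`, with `h` inverted. -/
abbrev DualPow (n : ℕ) : Type := ChField ⊗[Ch] Module.Dual Ch (UhPow n)

/-- `π_A(a)` on the `i`-th factor. -/
def actA {n : ℕ} (i : Fin n) (a : Uh) : Module.End ChField (DualPow n) :=
  (leg i (rmul a)).dualMap.baseChange ChField

/-- `π_{A^*}(x)` on the `i`-th factor. -/
def actDual {n : ℕ} (i : Fin n) (x : UhDual) : Module.End ChField (DualPow n) :=
  (leg i (contract x)).dualMap.baseChange ChField

/-- Evaluation at `t`. -/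
def evalAt {n : ℕ} (t : UhPow n) : DualPow n →ₗ[ChField] ChField :=
  (TensorProduct.AlgebraTensorModule.rid Ch ChField ChField).toLinearMap ∘ₗ
    (LinearMap.applyₗ (R := Ch) t).baseChange ChField

/-- `s = ∑ cᵢ` for the `h`-adic topology of `ℂ((h))` (unconditional convergence). -/
def IsLaurentSum {ι : Type} (c : ι → ChField) (s : ChField) : Prop :=
  ∀ N : ℤ, ∃ F₀ : Finset ι, ∀ F : Finset ι, F₀ ⊆ F →
    ∀ n : ℤ, n < N → HahnSeries.coeff (s - ∑ i ∈ F, c i) n = 0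

/-- `S = ∑ Tᵢ` as operators, the convergence being pointwise (weak) and `h`-adic. -/
def IsOpSum {ι : Type} {n : ℕ} (T : ι → Module.End ChField (DualPow n))
    (S : Module.End ChField (DualPow n)) : Prop :=
  ∀ (f : DualPow n) (t : UhPow n), IsLaurentSum (fun i => evalAt t (T i f)) (evalAt t (S f))

/-- `(eᵢ)` is a topological basis of `U_h(b(2,ℂ))` and `(e'ᵢ)` is the dual basis: `⟨e'ᵢ, eⱼ⟩ = δᵢⱼ`
and `a = ∑ ⟨e'ᵢ, a⟩ eᵢ` (`h`-adically) for all `a`. -/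
def IsDualBasis {ι : Type} (e : ι → Uh) (e' : ι → UhDual) : Prop :=
  (∀ i, e' i (e i) = 1) ∧ (∀ i j, i ≠ j → e' i (e j) = 0) ∧
    ∀ (a : Uh) (N : ℕ), ∃ F₀ : Finset ι, ∀ F : Finset ι, F₀ ⊆ F →
      ∃ z : Uh, a = (∑ i ∈ F, e' i a • e i) + (PowerSeries.X : Ch) ^ N • z

/-- `R` is the canonical element `∑ e_γ ⊗ e^γ`, in the tensor factors `i` and `j`, for
every pair of dual topological bases. -/
def IsCanonicalElement {n : ℕ} (i j : Fin n) (R : Module.End ChField (DualPow n)) : Prop :=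
  ∀ (ι : Type) (e : ι → Uh) (e' : ι → UhDual), IsDualBasis e e' →
    IsOpSum (fun c => actA i (e c) * actDual j (e' c)) R

/-- `(q)_n = (1 - q)(1 - q²) ⋯ (1 - qⁿ)`. -/
def qFact (n : ℕ) : Ch := ∏ i ∈ Finset.range n, (1 - q ^ (i + 1))

/-- The coefficient of `xⁿ` in the `q`-dilogarithm
`(x; q)_∞ = ∑ q^{n(n-1)/2} (-x)ⁿ / (q)_n`. -/
def qDilogCoeff (n : ℕ) : ChField :=
  algebraMap Ch ChField (q ^ (n * (n - 1) / 2) * (-1) ^ n) / algebraMap Ch ChField (qFact n)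

/-- `E = e^T = ∑ T^m / m!`. -/
def IsExp {n : ℕ} (T E : Module.End ChField (DualPow n)) : Prop :=
  IsOpSum (fun m : ℕ => ((m.factorial : ChField)⁻¹) • T ^ m) E

/-- `Q = (T; q)_∞`. -/
def IsQDilog {n : ℕ} (T Q : Module.End ChField (DualPow n)) : Prop :=
  IsOpSum (fun m : ℕ => qDilogCoeff m • T ^ m) Q

/-- The element `H̄^m D̄^n` of the dual. -/
def dualMonomial (m n : ℕ) : UhDual := dualWord (List.replicate m BGen.H ++ List.replicate n BGen.D)

end HeisenbergDouble

end

noncomputable section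

namespace HeisenbergDouble

open HSer

/-! ### The `h`-adic topology -/

/-- The `h`-adic topology of `E` is separated. -/
class HSeparated (E : Type) [AddCommGroup E] [Module Ch E] : Prop where
  eq_zero : ∀ x : E, (∀ N : ℕ, ∃ s : E, x = (PowerSeries.X : Ch) ^ N • s) → x = 0

section HSum

variable {E F : Type} [AddCommGroup E] [Module Ch E] [AddCommGroup F] [Module Ch F]

theorem HSeparated.eq [HSeparated E] {x y : E}
    (H : ∀ N : ℕ, ∃ s : E, x - y = (PowerSeries.X : Ch) ^ N • s) : x = y :=
  sub_eq_zero.1 (HSeparated.eq_zero _ H)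

theorem IsHSum.unique [HSeparated E] {b : ℕ → E} {x y : E} (hx : IsHSum b x) (hy : IsHSum b y) :
    x = y := by
  refine HSeparated.eq fun N => ?_
  obtain ⟨s, hs⟩ := hx N
  obtain ⟨t, ht⟩ := hy N
  refine ⟨s - t, ?_⟩
  conv_lhs => rw [hs, ht]
  rw [smul_sub]
  abel

theorem IsHSum.map {b : ℕ → E} {x : E} (hx : IsHSum b x) (f : E →ₗ[Ch] F) :
    IsHSum (fun n => f (b n)) (f x) := by
  intro N
  obtain ⟨s, hs⟩ := hx N
  refine ⟨f s, ?_⟩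
  conv_lhs => rw [hs]
  simp

theorem IsHSum.add {b c : ℕ → E} {x y : E} (hx : IsHSum b x) (hy : IsHSum c y) :
    IsHSum (fun n => b n + c n) (x + y) := by
  intro N
  obtain ⟨s, hs⟩ := hx N
  obtain ⟨t, ht⟩ := hy N
  refine ⟨s + t, ?_⟩
  conv_lhs => rw [hs, ht]
  simp only [smul_add, Finset.sum_add_distrib]
  abel

theorem IsHSum.zero : IsHSum (fun _ => (0 : E)) 0 := fun _ => ⟨0, by simp⟩

theorem IsHSum.single (x : E) : IsHSum (fun n => if n = 0 then x else 0) x := by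
  rintro (_ | N)
  · exact ⟨x, by simp⟩
  · exact ⟨0, by simp⟩

/-- A series of series can be rearranged by total degree. -/
theorem IsHSum.assoc {b : ℕ → ℕ → E} {c : ℕ → E} {x : E} (hb : ∀ l, IsHSum (b l) (c l))
    (hc : IsHSum c x) :
    IsHSum (fun k => ∑ p ∈ Finset.HasAntidiagonal.antidiagonal k, b p.1 p.2) x := by
  intro N
  obtain ⟨s, hs⟩ := hc N
  choose t ht using fun l => hb l (N - l)
  refine ⟨s + ∑ l ∈ Finset.range N, t l, ?_⟩
  have key : ∑ l ∈ Finset.range N, (PowerSeries.X : Ch) ^ l • c l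
      = (∑ k ∈ Finset.range N, (PowerSeries.X : Ch) ^ k •
          ∑ p ∈ Finset.HasAntidiagonal.antidiagonal k, b p.1 p.2)
        + (PowerSeries.X : Ch) ^ N • ∑ l ∈ Finset.range N, t l := by
    have e : ∀ l ∈ Finset.range N, (PowerSeries.X : Ch) ^ l • c l
        = (∑ n ∈ Finset.range (N - l), (PowerSeries.X : Ch) ^ (l + n) • b l n)
          + (PowerSeries.X : Ch) ^ N • t l := by
      intro l hl
      have hl' : N = l + (N - l) := by
        have := Finset.mem_range.1 hl
        omega
      conv_lhs => rw [ht l]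
      conv_rhs => rw [hl']
      rw [smul_add, Finset.smul_sum, smul_smul, ← pow_add, Nat.add_sub_cancel_left]
      simp only [smul_smul, ← pow_add]
    rw [Finset.sum_congr rfl e, Finset.sum_add_distrib, Finset.smul_sum]
    congr 1
    simp only [Finset.smul_sum]
    rw [Finset.sum_sigma', Finset.sum_sigma']
    refine Finset.sum_nbij' (fun p => ⟨p.1 + p.2, (p.1, p.2)⟩) (fun p => ⟨p.2.1, p.2.2⟩)
      ?_ ?_ ?_ ?_ ?_
    · rintro ⟨i, j⟩ H
      simp at H ⊢
      omega
    · rintro ⟨n, ⟨i, j⟩⟩ H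
      simp at H ⊢
      omega
    · rintro ⟨i, j⟩ _
      rfl
    · rintro ⟨n, ⟨i, j⟩⟩ H
      simp at H ⊢
      omega
    · rintro ⟨i, j⟩ _
      rfl
  conv_lhs => rw [hs, key]
  rw [smul_add]
  abel

theorem IsHSum.mul {E : Type} [Ring E] [Algebra Ch E] {b c : ℕ → E} {x y : E}
    (hx : IsHSum b x) (hy : IsHSum c y) :
    IsHSum (fun n => ∑ p ∈ Finset.HasAntidiagonal.antidiagonal n, b p.1 * c p.2) (x * y) :=
  IsHSum.assoc (b := fun l m => b l * c m) (fun l => hy.map (LinearMap.mulLeft Ch (b l)))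
    (hx.map (LinearMap.mulRight Ch y))

end HSum

namespace HSer

section Const

variable {M : Type} [Ring M]

theorem const_mul (a b : M) : const (a * b) = const a * const b :=
  map_mul (PowerSeries.C (R := M)) a b

theorem const_add (a b : M) : const (a + b) = const a + const b :=
  map_add (PowerSeries.C (R := M)) a b

theorem const_sub (a b : M) : const (a - b) = const a - const b :=
  map_sub (PowerSeries.C (R := M)) a b

theorem const_zero : const (0 : M) = 0 := map_zero (PowerSeries.C (R := M))

theorem const_one : const (1 : M) = 1 := map_one (PowerSeries.C (R := M))

theorem const_pow (a : M) (n : ℕ) : const (a ^ n) = const a ^ n :=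
  map_pow (PowerSeries.C (R := M)) a n

theorem const_sum {ι : Type} (s : Finset ι) (f : ι → M) :
    const (∑ i ∈ s, f i) = ∑ i ∈ s, const (f i) :=
  map_sum (PowerSeries.C (R := M)) f s

end Const

section Coeff

variable {M N : Type} [Ring M] [Algebra ℂ M] [Ring N] [Algebra ℂ N]

theorem coeff_const (n : ℕ) (m : M) : coeff n (const m) = if n = 0 then m else 0 :=
  PowerSeries.coeff_C n m

theorem coeff_zero_const (m : M) : coeff 0 (const m) = m := by simp [coeff_const]

theorem coeff_X_pow_smul (k n : ℕ) (x : HSer M) :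
    coeff n ((PowerSeries.X : Ch) ^ k • x) = if k ≤ n then coeff (n - k) x else 0 := by
  rw [coeff_smul]
  simp only [PowerSeries.coeff_X_pow, ite_smul, one_smul, zero_smul]
  split_ifs with hk
  · rw [Finset.sum_eq_single (k, n - k)]
    · simp
    · rintro ⟨a, b⟩ hab hne
      simp only [ite_eq_right_iff]
      rintro rfl
      simp at hab
      exact absurd (by rw [← hab]; simp) hne
    · simp
      omega
  · refine Finset.sum_eq_zero ?_
    rintro ⟨a, b⟩ hab
    simp at hab
    simp
    omega

theorem exists_eq_X_pow_smul {N : ℕ} {x : HSer M} (H : ∀ n < N, coeff n x = 0) :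
    ∃ s : HSer M, x = (PowerSeries.X : Ch) ^ N • s := by
  refine ⟨mk fun n => coeff (N + n) x, HSer.ext fun n => ?_⟩
  rw [coeff_X_pow_smul, coeff_mk]
  split_ifs with hn
  · rw [Nat.add_sub_cancel' hn]
  · exact H n (not_le.1 hn)

instance : HSeparated (HSer M) where
  eq_zero x H := by
    refine HSer.ext fun n => ?_
    obtain ⟨s, hs⟩ := H (n + 1)
    rw [hs, coeff_X_pow_smul, map_zero]
    simp

theorem isHSum_iff (b : ℕ → HSer M) (x : HSer M) :
    IsHSum b x ↔ ∀ n, coeff n x = ∑ p ∈ Finset.HasAntidiagonal.antidiagonal n, coeff p.2 (b p.1) := by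
  have key : ∀ N n, n < N → coeff n (∑ k ∈ Finset.range N, (PowerSeries.X : Ch) ^ k • b k)
      = ∑ p ∈ Finset.HasAntidiagonal.antidiagonal n, coeff p.2 (b p.1) := by
    intro N n hn
    rw [map_sum, Finset.Nat.sum_antidiagonal_eq_sum_range_succ (fun i j => coeff j (b i)),
      ← Finset.sum_subset (Finset.range_subset_range.2 hn)]
    · refine Finset.sum_congr rfl fun k hk => ?_
      rw [coeff_X_pow_smul, if_pos (Nat.lt_succ_iff.1 (Finset.mem_range.1 hk))]
    · intro k _ hk
      rw [coeff_X_pow_smul, if_neg]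
      simp at hk
      omega
  constructor
  · intro H n
    obtain ⟨s, hs⟩ := H (n + 1)
    conv_lhs => rw [hs]
    rw [map_add, key _ _ (Nat.lt_succ_self n), coeff_X_pow_smul, if_neg (by omega), add_zero]
  · intro H N
    obtain ⟨s, hs⟩ := exists_eq_X_pow_smul (N := N)
      (x := x - ∑ k ∈ Finset.range N, (PowerSeries.X : Ch) ^ k • b k) (fun n hn => by
        rw [map_sub, key N n hn, H, sub_self])
    exact ⟨s, by rw [← hs]; abel⟩

/-- The sum `∑ hⁿ bₙ`. -/
def hsum (b : ℕ → HSer M) : HSer M :=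
  mk fun n => ∑ p ∈ Finset.HasAntidiagonal.antidiagonal n, coeff p.2 (b p.1)

theorem isHSum_hsum (b : ℕ → HSer M) : IsHSum b (hsum b) :=
  (isHSum_iff _ _).2 fun _ => coeff_mk _ _

theorem isHSum_mk (f : ℕ → M) : IsHSum (fun n => const (f n)) (mk f) := by
  refine (isHSum_iff _ _).2 fun n => ?_
  rw [coeff_mk, Finset.sum_eq_single (n, 0)]
  · simp [coeff_const]
  · rintro ⟨a, b⟩ hab hne
    simp only [coeff_const, ite_eq_right_iff]
    rintro rfl
    simp at hab
    exact absurd (by rw [hab]) hne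
  · simp

theorem isHSum_coeff (x : HSer M) : IsHSum (fun n => const (coeff n x)) x := by
  have : mk (fun n => coeff n x) = x := HSer.ext fun n => coeff_mk _ _
  conv => arg 2; rw [← this]
  exact isHSum_mk _

theorem isHSum_hExp (u : M) : IsHSum (fun n => const (((n.factorial : ℂ)⁻¹) • u ^ n)) (hExp u) :=
  isHSum_mk _

theorem smul_const' (c : ℂ) (m : M) : const (c • m) = algebraMap ℂ Ch c • const m :=
  smul_const c m

instance : IsScalarTower ℂ Ch (HSer M) where
  smul_assoc c f x := by
    refine HSer.ext fun n => ?_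
    rw [coeff_smul, map_smul, coeff_smul, Finset.smul_sum]
    refine Finset.sum_congr rfl fun p _ => ?_
    simp [smul_smul]

/-- Linear maps are determined by their values on constants. -/
theorem hom_ext {E : Type} [AddCommGroup E] [Module Ch E] [HSeparated E]
    {f g : HSer M →ₗ[Ch] E} (H : ∀ m, f (const m) = g (const m)) : f = g := by
  refine LinearMap.ext fun x => ?_
  refine IsHSum.unique (((isHSum_coeff x).map f)) ?_
  simp only [H]
  exact (isHSum_coeff x).map g

theorem seriesMap_const (φ : ℕ → M →ₗ[ℂ] N) (m : M) : seriesMap φ (const m) = mk fun n => φ n m := by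
  refine HSer.ext fun n => ?_
  rw [coeff_mk]
  change coeff n (mk fun n => ∑ p ∈ Finset.HasAntidiagonal.antidiagonal n, φ p.1 (coeff p.2 (const m))) = _
  rw [coeff_mk, Finset.sum_eq_single (n, 0)]
  · simp [coeff_const]
  · rintro ⟨a, b⟩ hab hne
    rw [coeff_const, if_neg, map_zero]
    rintro rfl
    simp at hab
    exact hne (by simp [hab])
  · simp

theorem coeff_mapCoeff (T : HSer M →ₗ[Ch] HSer N) (j : ℕ) (m : M) :
    mapCoeff T j m = coeff j (T (const m)) := rfl

/-- The continuous extension to series of an algebra map defined on constants. -/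
def extend (f : M →ₐ[ℂ] HSer N) : HSer M →ₐ[Ch] HSer N :=
  AlgHom.ofLinearMap (seriesMap fun j => coeff j ∘ₗ f.toLinearMap)
    (by
      rw [← const_one (M := M), seriesMap_const]
      refine HSer.ext fun n => ?_
      simp [coeff_mk])
    (by
      have hc : ∀ m, seriesMap (fun j => coeff j ∘ₗ f.toLinearMap) (const m) = f m := fun m => by
        rw [seriesMap_const]
        exact HSer.ext fun n => coeff_mk _ _
      set S := seriesMap (fun j => coeff j ∘ₗ f.toLinearMap) with hS
      intro x y
      have h1 : S ∘ₗ LinearMap.mulRight Ch y = LinearMap.mulRight Ch (S y) ∘ₗ S := by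
        refine hom_ext fun m => ?_
        have h2 : S ∘ₗ LinearMap.mulLeft Ch (const m) = LinearMap.mulLeft Ch (S (const m)) ∘ₗ S := by
          refine hom_ext fun m' => ?_
          simp [← const_mul, hc]
        exact LinearMap.congr_fun h2 y
      exact LinearMap.congr_fun h1 x)

theorem extend_const (f : M →ₐ[ℂ] HSer N) (m : M) : extend f (const m) = f m := by
  change seriesMap (fun j => coeff j ∘ₗ f.toLinearMap) (const m) = f m
  rw [seriesMap_const]
  exact HSer.ext fun n => coeff_mk _ _

/-- Constant series, as an algebra map. -/
def constHom (M : Type) [Ring M] [Algebra ℂ M] : M →ₐ[ℂ] HSer M where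
  toFun := const
  map_one' := const_one
  map_mul' := const_mul
  map_zero' := const_zero
  map_add' := const_add
  commutes' c := by
    rw [Algebra.algebraMap_eq_smul_one, smul_const', const_one, algebraMap_smul,
      Algebra.algebraMap_eq_smul_one]

theorem hom_hExp {E : Type} [Ring E] [Algebra Ch E] [HSeparated E] (f : HSer M →ₐ[Ch] E) (u : M)
    {e : E} (he : IsHSum (fun n => algebraMap ℂ Ch ((n.factorial : ℂ)⁻¹) • f (const u) ^ n) e) :
    f (hExp u) = e := by
  refine IsHSum.unique ((isHSum_hExp u).map f.toLinearMap) ?_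
  simpa [smul_const', const_pow] using he

theorem isHSum_hExp' (u : M) :
    IsHSum (fun n => algebraMap ℂ Ch ((n.factorial : ℂ)⁻¹) • const u ^ n) (hExp u) := by
  simpa [smul_const', const_pow] using isHSum_hExp u

theorem formExt_const (f : M →ₗ[ℂ] ℂ) (m : M) : formExt f (const m) = algebraMap ℂ Ch (f m) := by
  ext n
  change PowerSeries.coeff n (PowerSeries.mk fun n => f (coeff n (const m))) = PowerSeries.coeff n (PowerSeries.C (f m))
  rw [PowerSeries.coeff_mk, coeff_const, PowerSeries.coeff_C]
  split_ifs <;> simp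

end Coeff

end HSer

/-! ### Separatedness -/

instance : HSeparated Ch where
  eq_zero x H := by
    ext n
    obtain ⟨s, hs⟩ := H (n + 1)
    rw [hs, smul_eq_mul, PowerSeries.coeff_X_pow_mul', map_zero, if_neg (by omega)]

instance {E F : Type} [AddCommGroup E] [Module Ch E] [AddCommGroup F] [Module Ch F]
    [HSeparated F] : HSeparated (E →ₗ[Ch] F) where
  eq_zero x H := by
    ext e
    refine HSeparated.eq_zero _ fun N => ?_
    obtain ⟨s, hs⟩ := H N
    exact ⟨s e, by rw [hs]; rfl⟩

theorem Ch.isHSum_iff (b : ℕ → Ch) (x : Ch) :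
    IsHSum b x ↔ ∀ n, PowerSeries.coeff n x
      = ∑ p ∈ Finset.HasAntidiagonal.antidiagonal n, PowerSeries.coeff p.2 (b p.1) := by
  have key := HSer.isHSum_iff (M := ℂ) b x
  have e : ∀ (c : Ch) (y : HSer ℂ), (c • y : HSer ℂ) = (c * (show Ch from y) : Ch) := fun c y => by
    rw [Algebra.smul_def]
    have : (algebraMap Ch (HSer ℂ)) c = c := by
      change PowerSeries.map (algebraMap ℂ ℂ) c = c
      simp
    rw [this]
    rfl
  have : IsHSum (M := Ch) b x ↔ IsHSum (M := HSer ℂ) b x := by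
    unfold IsHSum
    simp only [e]
    rfl
  rw [this, key]
  rfl

/-- The sum `∑ hⁿ bₙ` in `ℂ[[h]]`, as a linear map. -/
def chSum : (ℕ → Ch) →ₗ[Ch] Ch where
  toFun b := PowerSeries.mk fun n =>
    ∑ p ∈ Finset.HasAntidiagonal.antidiagonal n, PowerSeries.coeff p.2 (b p.1)
  map_add' x y := by
    ext n
    simp [Finset.sum_add_distrib]
  map_smul' c x := by
    have h1 : ∀ b : ℕ → Ch, IsHSum b (PowerSeries.mk fun n =>
        ∑ p ∈ Finset.HasAntidiagonal.antidiagonal n, PowerSeries.coeff p.2 (b p.1)) := fun b =>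
      (Ch.isHSum_iff _ _).2 fun n => PowerSeries.coeff_mk _ _
    exact (h1 _).unique ((h1 x).map (LinearMap.mulLeft Ch c))

theorem isHSum_chSum (b : ℕ → Ch) : IsHSum b (chSum b) :=
  (Ch.isHSum_iff _ _).2 fun n =>
    PowerSeries.coeff_mk n fun n =>
      ∑ p ∈ Finset.HasAntidiagonal.antidiagonal n, PowerSeries.coeff p.2 (b p.1)

theorem Ch.isHSum_coeff (x : Ch) : IsHSum (fun n => algebraMap ℂ Ch (PowerSeries.coeff n x)) x := by
  refine (Ch.isHSum_iff _ _).2 fun n => ?_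
  rw [Finset.sum_eq_single (n, 0)]
  · change _ = PowerSeries.coeff 0 (PowerSeries.C _)
    simp
  · rintro ⟨a, b⟩ hab hne
    change PowerSeries.coeff b (PowerSeries.C _) = 0
    rw [PowerSeries.coeff_C, if_neg]
    rintro rfl
    simp at hab
    exact hne (by simp [hab])
  · simp

/-! ### Unconditional sums -/

section HasHSum

variable {ι : Type} {E F : Type} [AddCommGroup E] [Module Ch E] [AddCommGroup F] [Module Ch F]

/-- `s = ∑ fᵢ`, the sum being unconditionally convergent in the `h`-adic topology. -/
def HasHSum (f : ι → E) (s : E) : Prop :=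
  ∀ N : ℕ, ∃ F₀ : Finset ι, ∀ F : Finset ι, F₀ ⊆ F →
    ∃ z : E, s = (∑ i ∈ F, f i) + (PowerSeries.X : Ch) ^ N • z

theorem HasHSum.unique [HSeparated E] {f : ι → E} {s t : E} (hs : HasHSum f s)
    (ht : HasHSum f t) : s = t := by
  classical
  refine HSeparated.eq fun N => ?_
  obtain ⟨A, hA⟩ := hs N
  obtain ⟨B, hB⟩ := ht N
  obtain ⟨y, hy⟩ := hA (A ∪ B) Finset.subset_union_left
  obtain ⟨z, hz⟩ := hB (A ∪ B) Finset.subset_union_right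
  exact ⟨y - z, by rw [hy, hz, smul_sub]; abel⟩

theorem HasHSum.map {f : ι → E} {s : E} (hs : HasHSum f s) (T : E →ₗ[Ch] F) :
    HasHSum (fun i => T (f i)) (T s) := by
  intro N
  obtain ⟨A, hA⟩ := hs N
  refine ⟨A, fun B hB => ?_⟩
  obtain ⟨y, hy⟩ := hA B hB
  exact ⟨T y, by conv_lhs => rw [hy]
                 simp⟩

theorem HasHSum.zero : HasHSum (fun _ : ι => (0 : E)) 0 := fun _ => ⟨∅, fun _ _ => ⟨0, by simp⟩⟩

theorem HasHSum.add {f g : ι → E} {s t : E} (hs : HasHSum f s) (ht : HasHSum g t) :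
    HasHSum (fun i => f i + g i) (s + t) := by
  classical
  intro N
  obtain ⟨A, hA⟩ := hs N
  obtain ⟨B, hB⟩ := ht N
  refine ⟨A ∪ B, fun C hC => ?_⟩
  obtain ⟨y, hy⟩ := hA C (Finset.union_subset_left hC)
  obtain ⟨z, hz⟩ := hB C (Finset.union_subset_right hC)
  refine ⟨y + z, ?_⟩
  conv_lhs => rw [hy, hz]
  rw [Finset.sum_add_distrib, smul_add]
  abel

theorem hasHSum_of_finite (f : ι → E) (A : Finset ι) (hA : ∀ i, i ∉ A → f i = 0) :
    HasHSum f (∑ i ∈ A, f i) := fun N => ⟨A, fun B hB => ⟨0, by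
  rw [smul_zero, add_zero, Finset.sum_subset hB fun i _ hi => hA i hi]⟩⟩

/-- Convergence of a family of linear maps need only be tested modulo each power of `h`. -/
theorem hasHSum_of_approx {T : ι → E →ₗ[Ch] F} {S : E →ₗ[Ch] F} {x : E}
    (H : ∀ N : ℕ, ∃ y z : E, x = y + (PowerSeries.X : Ch) ^ N • z ∧
      HasHSum (fun i => T i y) (S y)) : HasHSum (fun i => T i x) (S x) := by
  intro N
  obtain ⟨y, z, rfl, hy⟩ := H N
  obtain ⟨A, hA⟩ := hy N
  refine ⟨A, fun B hB => ?_⟩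
  obtain ⟨w, hw⟩ := hA B hB
  refine ⟨w + S z - ∑ i ∈ B, T i z, ?_⟩
  rw [map_add, map_smul, hw]
  simp only [map_add, map_smul, Finset.sum_add_distrib, smul_sub, smul_add, Finset.smul_sum]
  abel

theorem HasHSum.sum {κ : Type} (A : Finset κ) {f : κ → ι → E} {s : κ → E}
    (H : ∀ k ∈ A, HasHSum (f k) (s k)) : HasHSum (fun i => ∑ k ∈ A, f k i) (∑ k ∈ A, s k) := by
  classical
  induction A using Finset.induction_on with
  | empty => simpa using HasHSum.zero
  | insert a A ha ih =>
    simp only [Finset.sum_insert ha]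
    exact (H _ (Finset.mem_insert_self _ _)).add (ih fun k hk => H k (Finset.mem_insert_of_mem hk))

theorem hasHSum_of_isHSum {T : ι → E →ₗ[Ch] F} {S : E →ₗ[Ch] F} {b : ℕ → E} {x : E}
    (hx : IsHSum b x) (H : ∀ n, HasHSum (fun i => T i (b n)) (S (b n))) :
    HasHSum (fun i => T i x) (S x) := by
  refine hasHSum_of_approx fun N => ?_
  obtain ⟨s, hs⟩ := hx N
  refine ⟨_, s, hs, ?_⟩
  have := HasHSum.sum (Finset.range N) fun n _ =>
    (H n).map ((PowerSeries.X : Ch) ^ n • (LinearMap.id : F →ₗ[Ch] F))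
  simpa only [map_sum, map_smul, LinearMap.smul_apply, LinearMap.id_apply] using this

end HasHSum

/-! ### The Poincaré–Birkhoff–Witt basis -/

section UBLift

variable {B : Type} [Ring B] [Algebra ℂ B] (x y : B) (hxy : x * y - y * x = y)

theorem ubLift_uH : ubLift x y hxy uH = x := by
  change RingQuot.liftAlgHom ℂ _ (RingQuot.mkAlgHom ℂ BRel _) = x
  rw [RingQuot.liftAlgHom_mkAlgHom_apply]
  simp

theorem ubLift_uD : ubLift x y hxy uD = y := by
  change RingQuot.liftAlgHom ℂ _ (RingQuot.mkAlgHom ℂ BRel _) = y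
  rw [RingQuot.liftAlgHom_mkAlgHom_apply]
  simp

end UBLift

/-- Induction on words, multiplying by generators on the right. -/
theorem UB.induction_right {P : UB → Prop} (one : P 1) (add : ∀ u v, P u → P v → P (u + v))
    (smul : ∀ (c : ℂ) u, P u → P (c • u)) (mulH : ∀ u, P u → P (u * uH))
    (mulD : ∀ u, P u → P (u * uD)) (u : UB) : P u := by
  obtain ⟨w, rfl⟩ := RingQuot.mkAlgHom_surjective ℂ BRel u
  change P (ubMk w)
  suffices H : ∀ v, P v → P (v * ubMk w) by simpa using H 1 one
  induction w using FreeAlgebra.induction with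
  | grade0 r =>
    intro v hv
    rw [AlgHom.commutes, Algebra.algebraMap_eq_smul_one, mul_smul_comm, mul_one]
    exact smul r v hv
  | grade1 g => cases g with
    | H => exact mulH
    | D => exact mulD
  | mul a b ha hb =>
    intro v hv
    rw [map_mul, ← mul_assoc]
    exact hb _ (ha _ hv)
  | add a b ha hb =>
    intro v hv
    rw [map_add, mul_add]
    exact add _ _ (ha _ hv) (hb _ hv)

/-- The monomial `H^a D^b`. -/
def ubMonomial (p : ℕ × ℕ) : UB := uH ^ p.1 * uD ^ p.2

theorem uD_pow_mul_uH (b : ℕ) : uD ^ b * uH = uH * uD ^ b - (b : ℂ) • uD ^ b := by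
  induction b with
  | zero => simp
  | succ b ih =>
    have h : uD * uH = uH * uD - uD := by rw [eq_sub_iff_add_eq, ← eq_sub_iff_add_eq', uH_mul_uD]
    rw [pow_succ', mul_assoc, ih, mul_sub, ← mul_assoc, mul_smul_comm, h, sub_mul, mul_assoc,
      ← pow_succ', Nat.cast_succ, add_smul, one_smul]
    abel

theorem ubMonomial_mul_uD (a b : ℕ) : ubMonomial (a, b) * uD = ubMonomial (a, b + 1) := by
  simp [ubMonomial, pow_succ, mul_assoc]

theorem ubMonomial_mul_uH (a b : ℕ) :
    ubMonomial (a, b) * uH = ubMonomial (a + 1, b) - (b : ℂ) • ubMonomial (a, b) := by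
  simp only [ubMonomial]
  rw [mul_assoc, uD_pow_mul_uH, mul_sub, ← mul_assoc, ← pow_succ, mul_smul_comm]

theorem span_ubMonomial : Submodule.span ℂ (Set.range ubMonomial) = ⊤ := by
  rw [eq_top_iff]
  rintro u -
  have key : ∀ T : UB →ₗ[ℂ] UB, (∀ p, T (ubMonomial p) ∈ Submodule.span ℂ (Set.range ubMonomial)) →
      ∀ v ∈ Submodule.span ℂ (Set.range ubMonomial),
        T v ∈ Submodule.span ℂ (Set.range ubMonomial) := by
    intro T hT v hv
    have : Submodule.span ℂ (Set.range ubMonomial)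
        ≤ (Submodule.span ℂ (Set.range ubMonomial)).comap T :=
      Submodule.span_le.2 (by rintro _ ⟨p, rfl⟩; exact hT p)
    exact this hv
  refine UB.induction_right (P := fun u => u ∈ Submodule.span ℂ (Set.range ubMonomial))
    ?_ (fun _ _ => Submodule.add_mem _) (fun c _ => Submodule.smul_mem _ c)
    (key (LinearMap.mulRight ℂ uH) ?_) (key (LinearMap.mulRight ℂ uD) ?_) u
  · exact Submodule.subset_span ⟨(0, 0), by simp [ubMonomial]⟩
  · rintro ⟨a, b⟩
    rw [LinearMap.mulRight_apply, ubMonomial_mul_uH]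
    exact Submodule.sub_mem _ (Submodule.subset_span ⟨_, rfl⟩)
      (Submodule.smul_mem _ _ (Submodule.subset_span ⟨_, rfl⟩))
  · rintro ⟨a, b⟩
    rw [LinearMap.mulRight_apply, ubMonomial_mul_uD]
    exact Submodule.subset_span ⟨_, rfl⟩

open Polynomial in
/-- The representation of `U(b)` on polynomials `∑ fₙ(X) Yⁿ` given by left multiplication on
`∑ fₙ(H) Dⁿ`. -/
def pbwRep : UB →ₐ[ℂ] Module.End ℂ ℂ[X][X] :=
  ubLift (LinearMap.mulLeft ℂ (C (X : ℂ[X])))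
    (LinearMap.mulLeft ℂ (X : ℂ[X][X]) ∘ₗ (mapAlgHom (aeval (X - 1 : ℂ[X]))).toLinearMap) (by
      refine LinearMap.ext fun f => ?_
      simp only [LinearMap.sub_apply, Module.End.mul_apply, LinearMap.mulLeft_apply,
        LinearMap.comp_apply, AlgHom.toLinearMap_apply, map_mul]
      have : mapAlgHom (aeval (X - 1 : ℂ[X])) (C (X : ℂ[X])) = (C X - 1 : ℂ[X][X]) := by
        simp [mapAlgHom]
      rw [this]
      ring)

open Polynomial in
theorem pbwRep_ubMonomial (p : ℕ × ℕ) :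
    pbwRep (ubMonomial p) 1 = C (X ^ p.1) * X ^ p.2 := by
  have hD : ∀ b : ℕ, pbwRep (uD ^ b) 1 = X ^ b := by
    intro b
    induction b with
    | zero => simp
    | succ b ih =>
      rw [pow_succ', map_mul, Module.End.mul_apply, ih, pbwRep, ubLift_uD]
      simp [mapAlgHom, pow_succ']
  have hH : ∀ (a : ℕ) (f : ℂ[X][X]), pbwRep (uH ^ a) f = C (X ^ a) * f := by
    intro a f
    induction a with
    | zero => simp
    | succ a ih =>
      rw [pow_succ', map_mul, Module.End.mul_apply, ih, pbwRep, ubLift_uH]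
      simp [pow_succ', mul_assoc]
  rw [ubMonomial, map_mul, Module.End.mul_apply, hD, hH]

/-- The coefficient of `H^m D^n`. -/
def ubCoord (p : ℕ × ℕ) : UB →ₗ[ℂ] ℂ :=
  Polynomial.lcoeff ℂ p.1 ∘ₗ (Polynomial.lcoeff (Polynomial ℂ) p.2).restrictScalars ℂ ∘ₗ
    LinearMap.applyₗ (R := ℂ) (1 : Polynomial (Polynomial ℂ)) ∘ₗ pbwRep.toLinearMap

theorem ubCoord_ubMonomial (p p' : ℕ × ℕ) :
    ubCoord p (ubMonomial p') = if p' = p then 1 else 0 := by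
  obtain ⟨m, n⟩ := p
  obtain ⟨a, b⟩ := p'
  change ((pbwRep (ubMonomial (a, b)) 1).coeff n).coeff m = _
  rw [pbwRep_ubMonomial, Polynomial.coeff_C_mul, Polynomial.coeff_X_pow]
  simp only [mul_ite, mul_one, mul_zero, Prod.mk.injEq]
  split_ifs with h1 h2 h3
  · simp [h2.1]
  · rw [Polynomial.coeff_X_pow, if_neg]
    exact fun h => h2 ⟨h.symm, h1.symm⟩
  · exact absurd h3.2.symm h1
  · simp

theorem linearIndependent_ubMonomial : LinearIndependent ℂ ubMonomial := by
  rw [linearIndependent_iff]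
  intro l hl
  ext p
  have := congrArg (ubCoord p) hl
  rw [Finsupp.linearCombination_apply, Finsupp.sum, map_sum, map_zero] at this
  simp only [map_smul, ubCoord_ubMonomial, smul_eq_mul, mul_ite, mul_one, mul_zero,
    Finset.sum_ite_eq', Finsupp.mem_support_iff] at this
  by_contra h
  exact h (by simpa [h] using this)

/-- The Poincaré–Birkhoff–Witt basis `H^a D^b`. -/
def ubBasis : Module.Basis (ℕ × ℕ) ℂ UB :=
  Module.Basis.mk linearIndependent_ubMonomial span_ubMonomial.ge

theorem ubBasis_apply (p : ℕ × ℕ) : ubBasis p = ubMonomial p := by simp [ubBasis]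

theorem ubBasis_coord (p : ℕ × ℕ) : ubBasis.coord p = ubCoord p := by
  refine ubBasis.ext fun p' => ?_
  rw [ubBasis_apply, ubCoord_ubMonomial, ← ubBasis_apply, Module.Basis.coord_apply,
    Module.Basis.repr_self, Finsupp.single_apply]

theorem ubCoord_eq_repr (p : ℕ × ℕ) (u : UB) : ubCoord p u = ubBasis.repr u p := by
  rw [← ubBasis_coord, Module.Basis.coord_apply]

theorem ub_hom_ext {F : Type} [AddCommGroup F] [Module ℂ F] {f g : UB →ₗ[ℂ] F}
    (H : ∀ p, f (ubMonomial p) = g (ubMonomial p)) : f = g :=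
  ubBasis.ext fun p => by rw [ubBasis_apply, H]

theorem formH_eq : formH = ubCoord (1, 0) := by
  refine ub_hom_ext fun ⟨a, b⟩ => ?_
  rw [ubCoord_ubMonomial]
  change ubLift (B := Matrix (Fin 2) (Fin 2) ℂ) _ _ _ (ubMonomial (a, b)) 0 1 = _
  rw [ubMonomial, map_mul, map_pow, map_pow, ubLift_uH, ubLift_uD]
  have h2 : (!![0, 1; 0, 0] : Matrix (Fin 2) (Fin 2) ℂ) ^ 2 = 0 := by
    ext i j
    fin_cases i <;> fin_cases j <;> simp [pow_two]
  rcases b with _ | b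
  · rcases a with _ | _ | a
    · simp
    · simp
    · have h3 : (!![0, 1; 0, 0] : Matrix (Fin 2) (Fin 2) ℂ) ^ (a + 1 + 1) = 0 := by
        rw [add_assoc, pow_add, h2, mul_zero]
      simp [h3]
  · simp

theorem formD_eq : formD = ubCoord (0, 1) := by
  refine ub_hom_ext fun ⟨a, b⟩ => ?_
  rw [ubCoord_ubMonomial]
  change ubLift (B := Matrix (Fin 2) (Fin 2) ℂ) _ _ _ (ubMonomial (a, b)) 0 1 = _
  rw [ubMonomial, map_mul, map_pow, map_pow, ubLift_uH, ubLift_uD]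
  have h2 : (!![0, 1; 0, 0] : Matrix (Fin 2) (Fin 2) ℂ) ^ 2 = 0 := by
    ext i j
    fin_cases i <;> fin_cases j <;> simp [pow_two]
  have h3 : (!![0, 0; 0, -1] : Matrix (Fin 2) (Fin 2) ℂ) * !![0, 1; 0, 0] = 0 := by
    ext i j
    fin_cases i <;> fin_cases j <;> simp
  rcases b with _ | _ | b
  · have : (!![0, 0; 0, -1] : Matrix (Fin 2) (Fin 2) ℂ) = Matrix.diagonal ![0, -1] := by
      ext i j
      fin_cases i <;> fin_cases j <;> simp
    rw [this, Matrix.diagonal_pow]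
    simp
  · rcases a with _ | a
    · simp
    · rw [zero_add, pow_one, pow_succ, mul_assoc, h3]
      simp
  · rw [pow_add _ b 2, h2]
    simp

/-! ### The `ℂ[[h]]`-bilinear extension -/

theorem uh_hom_ext {E : Type} [AddCommGroup E] [Module Ch E] [HSeparated E]
    {f g : Uh →ₗ[Ch] E} (H : ∀ p, f (const (ubMonomial p)) = g (const (ubMonomial p))) : f = g := by
  refine hom_ext fun u => ?_
  have : u ∈ Submodule.span ℂ (Set.range ubMonomial) := by
    rw [span_ubMonomial]
    trivial
  induction this using Submodule.span_induction with
  | mem x h =>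
    obtain ⟨p, rfl⟩ := h
    exact H p
  | zero => simp [const_zero]
  | add x y _ _ hx hy => rw [const_add, map_add, map_add, hx, hy]
  | smul c x _ hx => rw [smul_const', map_smul, map_smul, hx]

/-- The coefficient of `H^m D^n` in `U_h(b(2,ℂ))`. -/
def uhCoord (p : ℕ × ℕ) : UhDual := formExt (ubCoord p)

theorem uhCoord_ubMonomial (p p' : ℕ × ℕ) :
    uhCoord p (const (ubMonomial p')) = if p' = p then 1 else 0 := by
  rw [uhCoord, formExt_const, ubCoord_ubMonomial]
  split_ifs <;> simp

theorem coeff_uhCoord (p : ℕ × ℕ) (a : Uh) (n : ℕ) :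
    PowerSeries.coeff n (uhCoord p a) = ubCoord p (coeff n a) :=
  PowerSeries.coeff_mk n fun n => ubCoord p (coeff n a)

theorem uh_ext {a b : Uh} (H : ∀ p, uhCoord p a = uhCoord p b) : a = b := by
  refine HSer.ext fun n => ubBasis.ext_elem fun p => ?_
  rw [← ubCoord_eq_repr, ← ubCoord_eq_repr, ← coeff_uhCoord, ← coeff_uhCoord, H]

theorem uh_ext_dual {a b : Uh} (H : ∀ y : UhDual, y a = y b) : a = b := uh_ext fun _ => H _

theorem const_ubMonomial (p : ℕ × ℕ) : const (ubMonomial p) = hH ^ p.1 * hD ^ p.2 := by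
  rw [ubMonomial, const_mul, const_pow, const_pow]
  rfl

theorem isDualBasis_uhCoord : IsDualBasis (fun p : ℕ × ℕ => hH ^ p.1 * hD ^ p.2) uhCoord := by
  simp only [← const_ubMonomial]
  refine ⟨fun p => ?_, fun p p' hp => ?_, fun a => ?_⟩
  · rw [uhCoord_ubMonomial, if_pos rfl]
  · rw [uhCoord_ubMonomial, if_neg (Ne.symm hp)]
  · change HasHSum (fun p => (uhCoord p).smulRight (const (ubMonomial p)) a)
      ((LinearMap.id : Uh →ₗ[Ch] Uh) a)
    refine hasHSum_of_isHSum (isHSum_coeff a) fun n => ?_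
    have := hasHSum_of_finite
      (fun p => (uhCoord p).smulRight (const (ubMonomial p)) (const (coeff n a)))
      (ubBasis.repr (coeff n a)).support (fun p hp => by
        rw [LinearMap.smulRight_apply, uhCoord, formExt_const, ubCoord_eq_repr,
          Finsupp.notMem_support_iff.1 hp, map_zero, zero_smul])
    convert this using 1
    conv_lhs => rw [LinearMap.id_apply, ← ubBasis.linearCombination_repr (coeff n a),
      Finsupp.linearCombination_apply, Finsupp.sum, const_sum]
    refine Finset.sum_congr rfl fun p _ => ?_
    rw [LinearMap.smulRight_apply, uhCoord, formExt_const, ubCoord_eq_repr, smul_const',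
      ubBasis_apply]

/-! ### Exponentials -/

namespace HSer

section Exp

variable {M N : Type} [Ring M] [Algebra ℂ M] [Ring N] [Algebra ℂ N]

theorem coeff_hExp (n : ℕ) (u : M) : coeff n (hExp u) = ((n.factorial : ℂ)⁻¹) • u ^ n :=
  coeff_mk _ _

theorem coeff_const_mul (n : ℕ) (a : M) (x : HSer M) : coeff n (const a * x) = a * coeff n x :=
  PowerSeries.coeff_C_mul (R := M) n x a

theorem coeff_mul_const (n : ℕ) (a : M) (x : HSer M) : coeff n (x * const a) = coeff n x * a :=
  PowerSeries.coeff_mul_C (R := M) n x a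

theorem hExp_zero : hExp (0 : M) = 1 := by
  rw [← const_one]
  refine HSer.ext fun n => ?_
  rw [coeff_hExp, coeff_const]
  split_ifs with hn
  · simp [hn]
  · simp [hn]

theorem hExp_add {u v : M} (huv : Commute u v) : hExp (u + v) = hExp u * hExp v := by
  refine HSer.ext fun n => ?_
  rw [coeff_mul, coeff_hExp, huv.add_pow', Finset.smul_sum]
  refine Finset.sum_congr rfl fun p hp => ?_
  rw [coeff_hExp, coeff_hExp, smul_mul_smul_comm, ← Nat.cast_smul_eq_nsmul ℂ, smul_smul]
  congr 1
  have hp' := Finset.HasAntidiagonal.mem_antidiagonal.1 hp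
  rw [← hp', Nat.cast_add_choose]
  have h0 : ((p.1 + p.2).factorial : ℂ) ≠ 0 := Nat.cast_ne_zero.2 (Nat.factorial_ne_zero _)
  field_simp

theorem hExp_mul_hExp_neg (u : M) : hExp u * hExp (-u) = 1 := by
  rw [← hExp_add (Commute.refl u).neg_right, add_neg_cancel, hExp_zero]

theorem const_mul_hExp_of_semiconj {a u v : M} (H : SemiconjBy a u v) :
    const a * hExp u = hExp v * const a := by
  refine HSer.ext fun n => ?_
  rw [coeff_const_mul, coeff_mul_const, coeff_hExp, coeff_hExp, mul_smul_comm, smul_mul_assoc,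
    (H.pow_right n).eq]

theorem extend_hExp (f : M →ₐ[ℂ] HSer N) {u : M} {v : N} (H : f u = const v) :
    extend f (hExp u) = hExp v := by
  refine hom_hExp _ _ ?_
  rw [extend_const, H]
  exact isHSum_hExp' v

theorem coeff_smul_const (n : ℕ) (c : Ch) (m : M) :
    coeff n (c • const m) = PowerSeries.coeff n c • m := by
  rw [coeff_smul, Finset.sum_eq_single (n, 0)]
  · simp [coeff_const]
  · rintro ⟨a, b⟩ hab hne
    rw [coeff_const, if_neg, smul_zero]
    rintro rfl
    simp at hab
    exact hne (by simp [hab])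
  · simp

end Exp

/-- The extension to series of an algebra map. -/
def mapAlg {M N : Type} [Ring M] [Algebra ℂ M] [Ring N] [Algebra ℂ N] (f : M →ₐ[ℂ] N) :
    HSer M →ₐ[Ch] HSer N := extend ((constHom N).comp f)

theorem mapAlg_const {M N : Type} [Ring M] [Algebra ℂ M] [Ring N] [Algebra ℂ N] (f : M →ₐ[ℂ] N)
    (m : M) : mapAlg f (const m) = const (f m) := extend_const _ _

theorem mapAlg_hExp {M N : Type} [Ring M] [Algebra ℂ M] [Ring N] [Algebra ℂ N] (f : M →ₐ[ℂ] N)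
    (m : M) : mapAlg f (hExp m) = hExp (f m) := extend_hExp _ rfl

end HSer

/-- The element `e^{hH}`. -/
def hE : Uh := hExp uH

theorem hE_mul_inv : hE * hExp (-uH) = 1 := hExp_mul_hExp_neg uH

theorem inv_mul_hE : hExp (-uH) * hE = 1 := by
  simpa [hE] using hExp_mul_hExp_neg (-uH)

theorem hExp_neg_one : hExp (-1 : UB) = q • (1 : Uh) := by
  rw [← const_one]
  refine HSer.ext fun n => ?_
  rw [coeff_hExp, coeff_smul_const, q, PowerSeries.coeff_mk, div_eq_inv_mul, mul_smul]
  congr 1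
  rcases Nat.even_or_odd n with h | h
  · simp [h.neg_one_pow]
  · simp [h.neg_one_pow]

theorem hD_mul_hE : hD * hE = q • (hE * hD) := by
  have h1 : SemiconjBy uD uH (uH + -1) := by
    rw [SemiconjBy, add_mul, neg_one_mul, ← sub_eq_add_neg, eq_sub_iff_add_eq,
      ← eq_sub_iff_add_eq', uH_mul_uD]
  have h2 := const_mul_hExp_of_semiconj h1
  rw [hExp_add ((Commute.one_right uH).neg_right), hExp_neg_one] at h2
  rw [hD, hE, h2]
  simp

theorem hD_pow_mul_hE (b : ℕ) : hD ^ b * hE = q ^ b • (hE * hD ^ b) := by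
  induction b with
  | zero => simp
  | succ b ih =>
    rw [pow_succ', mul_assoc, ih, mul_smul_comm, ← mul_assoc, hD_mul_hE, smul_mul_assoc, smul_smul,
      mul_assoc, ← pow_succ]

/-! ### The comultiplication -/

/-- The comultiplication as an algebra map. -/
def comulHom : Uh →ₐ[Ch] HSer (UB ⊗[ℂ] UB) := extend (ubLift comulH comulD comul_rel)

/-- `a ↦ a ⊗ 1`. -/
def inLeft : Uh →ₐ[Ch] HSer (UB ⊗[ℂ] UB) := mapAlg Algebra.TensorProduct.includeLeft

/-- `a ↦ 1 ⊗ a`. -/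
def inRight : Uh →ₐ[Ch] HSer (UB ⊗[ℂ] UB) := mapAlg Algebra.TensorProduct.includeRight

theorem comulHom_hH : comulHom hH = inLeft hH + inRight hH := by
  rw [comulHom, hH, extend_const, ubLift_uH, inLeft, inRight, mapAlg_const, mapAlg_const,
    ← const_add]
  rfl

theorem comulHom_hD : comulHom hD = inRight hD + inLeft hD * inRight hE := by
  rw [comulHom, hD, extend_const, ubLift_uD, inLeft, inRight, mapAlg_const, mapAlg_const, hE,
    mapAlg_hExp]
  rfl

theorem comulHom_hE : comulHom hE = inLeft hE * inRight hE := by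
  rw [comulHom, hE, extend_hExp _ (v := uH ⊗ₜ 1 + 1 ⊗ₜ uH) (ubLift_uH _ _ comul_rel),
    inLeft, inRight, mapAlg_hExp, mapAlg_hExp,
    ← hExp_add]
  · rfl
  · simp [Commute, SemiconjBy]

/-- `x ⊗ id` on the completed tensor square. -/
def pairLeft (x : UhDual) : HSer (UB ⊗[ℂ] UB) →ₗ[Ch] Uh :=
  seriesMap fun j => (TensorProduct.lid ℂ UB).toLinearMap ∘ₗ (formCoeff x j).rTensor UB

theorem contract_apply (x : UhDual) (a : Uh) : contract x a = pairLeft x (comulHom a) := rfl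

theorem pairLeft_tmul (x : UhDual) (u v : UB) :
    pairLeft x (const (u ⊗ₜ v)) = x (const u) • const v := by
  rw [pairLeft, seriesMap_const]
  refine HSer.ext fun n => ?_
  rw [coeff_mk, coeff_smul_const]
  rfl

theorem tensor_hom_ext {E : Type} [AddCommGroup E] [Module Ch E] [HSeparated E]
    {f g : HSer (UB ⊗[ℂ] UB) →ₗ[Ch] E}
    (H : ∀ u v, f (const (u ⊗ₜ v)) = g (const (u ⊗ₜ v))) : f = g := by
  refine hom_ext fun m => ?_
  induction m using TensorProduct.induction_on with
  | zero => simp [const_zero]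
  | tmul u v => exact H u v
  | add x y hx hy => rw [const_add, map_add, map_add, hx, hy]

theorem pairLeft_mul_inRight (x : UhDual) (w : HSer (UB ⊗[ℂ] UB)) (a : Uh) :
    pairLeft x (w * inRight a) = pairLeft x w * a := by
  have h1 : pairLeft x ∘ₗ LinearMap.mulLeft Ch w ∘ₗ inRight.toLinearMap
      = LinearMap.mulLeft Ch (pairLeft x w) := by
    refine hom_ext fun m => ?_
    have h2 : pairLeft x ∘ₗ LinearMap.mulRight Ch (inRight (const m))
        = LinearMap.mulRight Ch (const m) ∘ₗ pairLeft x := by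
      refine tensor_hom_ext fun u v => ?_
      simp only [LinearMap.comp_apply, LinearMap.mulRight_apply]
      rw [inRight, mapAlg_const, ← const_mul, Algebra.TensorProduct.includeRight_apply,
        Algebra.TensorProduct.tmul_mul_tmul, mul_one, pairLeft_tmul, pairLeft_tmul,
        smul_mul_assoc, const_mul]
    exact LinearMap.congr_fun h2 w
  exact LinearMap.congr_fun h1 a

theorem piA_apply (a : Uh) (x : UhDual) (b : Uh) : piA a x b = x (b * a) := rfl

theorem piDual_apply (x y : UhDual) (b : Uh) : piDual x y b = y (contract x b) := rfl

theorem pairLeft_mul_inLeft (x : UhDual) (w : HSer (UB ⊗[ℂ] UB)) (a : Uh) :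
    pairLeft x (w * inLeft a) = pairLeft (piA a x) w := by
  have h2 : pairLeft x ∘ₗ LinearMap.mulRight Ch (inLeft a) = pairLeft (piA a x) := by
    refine tensor_hom_ext fun u v => ?_
    have h1 : pairLeft x ∘ₗ LinearMap.mulLeft Ch (const (u ⊗ₜ v)) ∘ₗ inLeft.toLinearMap
        = (x ∘ₗ LinearMap.mulLeft Ch (const u)).smulRight (const v) := by
      refine hom_ext fun m => ?_
      simp only [LinearMap.comp_apply, LinearMap.mulLeft_apply, LinearMap.smulRight_apply,
        AlgHom.toLinearMap_apply]
      rw [inLeft, mapAlg_const, ← const_mul, Algebra.TensorProduct.includeLeft_apply,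
        Algebra.TensorProduct.tmul_mul_tmul, mul_one, pairLeft_tmul, const_mul]
    have h3 := LinearMap.congr_fun h1 a
    simp only [LinearMap.comp_apply, LinearMap.mulLeft_apply, LinearMap.smulRight_apply,
      AlgHom.toLinearMap_apply] at h3
    rw [LinearMap.comp_apply, LinearMap.mulRight_apply, h3, pairLeft_tmul, piA_apply]
  exact LinearMap.congr_fun h2 w

/-! ### Contractions -/

theorem contract_mul_hH (x : UhDual) (b : Uh) :
    contract x (b * hH) = contract x b * hH + contract (piA hH x) b := by
  rw [contract_apply, map_mul, comulHom_hH, mul_add, map_add, pairLeft_mul_inLeft,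
    pairLeft_mul_inRight, add_comm]
  rfl

theorem contract_mul_hD (x : UhDual) (b : Uh) :
    contract x (b * hD) = contract x b * hD + contract (piA hD x) b * hE := by
  rw [contract_apply, map_mul, comulHom_hD, mul_add, map_add, ← mul_assoc, pairLeft_mul_inRight,
    pairLeft_mul_inRight, pairLeft_mul_inLeft]
  rfl

theorem contract_mul_hE (x : UhDual) (b : Uh) :
    contract x (b * hE) = contract (piA hE x) b * hE := by
  rw [contract_apply, map_mul, comulHom_hE, ← mul_assoc, pairLeft_mul_inRight, pairLeft_mul_inLeft]
  rfl

theorem contract_one (x : UhDual) : contract x 1 = x 1 • 1 := by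
  rw [contract_apply, map_one, ← const_one, Algebra.TensorProduct.one_def, pairLeft_tmul,
    const_one]

theorem pairLeft_add (x y : UhDual) : pairLeft (x + y) = pairLeft x + pairLeft y :=
  tensor_hom_ext fun u v => by
    rw [LinearMap.add_apply, pairLeft_tmul, pairLeft_tmul, pairLeft_tmul, LinearMap.add_apply,
      add_smul]

theorem pairLeft_smul (c : Ch) (x : UhDual) : pairLeft (c • x) = c • pairLeft x :=
  tensor_hom_ext fun u v => by
    rw [LinearMap.smul_apply, pairLeft_tmul, pairLeft_tmul, LinearMap.smul_apply, smul_eq_mul,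
      mul_smul]

/-- `contract` as a linear map. -/
def contractHom : UhDual →ₗ[Ch] Uh →ₗ[Ch] Uh where
  toFun := contract
  map_add' x y := LinearMap.ext fun a => by
    simp only [contract_apply, pairLeft_add, LinearMap.add_apply]
  map_smul' c x := LinearMap.ext fun a => by
    simp only [contract_apply, pairLeft_smul, LinearMap.smul_apply, RingHom.id_apply]

theorem contract_add (x y : UhDual) : contract (x + y) = contract x + contract y :=
  map_add contractHom x y

theorem contract_smul (c : Ch) (x : UhDual) : contract (c • x) = c • contract x :=
  map_smul contractHom c x

theorem contract_sub (x y : UhDual) : contract (x - y) = contract x - contract y :=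
  map_sub contractHom x y

theorem contract_zero : contract 0 = 0 := map_zero contractHom

/-- Induction for `ℂ[[h]]`-linear maps on `U_h`, multiplying by generators on the right. -/
theorem uh_hom_ext_right {κ E : Type} [AddCommGroup E] [Module Ch E] [HSeparated E]
    {f g : κ → Uh →ₗ[Ch] E} (one : ∀ k, f k 1 = g k 1)
    (mulH : ∀ b, (∀ k, f k b = g k b) → ∀ k, f k (b * hH) = g k (b * hH))
    (mulD : ∀ b, (∀ k, f k b = g k b) → ∀ k, f k (b * hD) = g k (b * hD)) (k : κ) : f k = g k := by
  refine hom_ext fun u => ?_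
  revert k
  refine UB.induction_right (P := fun u => ∀ k, f k (const u) = g k (const u)) ?_ ?_ ?_ ?_ ?_ u
  · rw [const_one]
    exact one
  · intro u v hu hv k
    rw [const_add, map_add, map_add, hu, hv]
  · intro c u hu k
    rw [smul_const', map_smul, map_smul, hu]
  · intro u hu
    rw [const_mul]
    exact mulH _ hu
  · intro u hu
    rw [const_mul]
    exact mulD _ hu

theorem piA_mul (a b : Uh) : piA (a * b) = piA a * piA b := by
  refine LinearMap.ext fun x => LinearMap.ext fun c => ?_
  simp [piA_apply, mul_assoc]

/-- `π_A` as an algebra map. -/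
def piAHom : Uh →ₐ[Ch] Module.End Ch UhDual :=
  AlgHom.ofLinearMap
    { toFun := piA
      map_add' := fun a b => LinearMap.ext fun x => LinearMap.ext fun c => by
        simp [piA_apply, mul_add]
      map_smul' := fun r a => LinearMap.ext fun x => LinearMap.ext fun c => by
        simp [piA_apply] }
    (LinearMap.ext fun x => LinearMap.ext fun c => by simp [piA_apply])
    piA_mul

theorem piAHom_apply (a : Uh) : piAHom a = piA a := rfl

/-- `π_{A^*}` as a linear map. -/
def piDualHom : UhDual →ₗ[Ch] Module.End Ch UhDual where
  toFun := piDual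
  map_add' x y := LinearMap.ext fun z => LinearMap.ext fun c => by
    simp [piDual_apply, contract_add]
  map_smul' r x := LinearMap.ext fun z => LinearMap.ext fun c => by
    simp [piDual_apply, contract_smul]

theorem piDualHom_apply (x : UhDual) : piDualHom x = piDual x := rfl

theorem piA_hH_piDual (x y : UhDual) :
    piA hH (piDual x y) = piDual x (piA hH y) + piDual (piA hH x) y :=
  LinearMap.ext fun b => by
    simp [piA_apply, piDual_apply, contract_mul_hH]

theorem piA_hD_piDual (x y : UhDual) :
    piA hD (piDual x y) = piDual x (piA hD y) + piDual (piA hD x) (piA hE y) :=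
  LinearMap.ext fun b => by
    simp [piA_apply, piDual_apply, contract_mul_hD]

/-- Coassociativity. -/
theorem contract_comp_contract (x y : UhDual) :
    contract y ∘ₗ contract x = contract (piDual x y) := by
  refine uh_hom_ext_right (κ := UhDual × UhDual) (f := fun k => contract k.2 ∘ₗ contract k.1)
    (g := fun k => contract (piDual k.1 k.2)) ?_ ?_ ?_ (x, y)
  · rintro ⟨x, y⟩
    simp [contract_one, piDual_apply, smul_smul]
  · rintro b H ⟨x, y⟩
    simp only [LinearMap.comp_apply, Prod.forall] at H ⊢
    rw [contract_mul_hH, map_add, contract_mul_hH, contract_mul_hH, piA_hH_piDual, contract_add,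
      H, H, H, LinearMap.add_apply, add_assoc]
  · rintro b H ⟨x, y⟩
    simp only [LinearMap.comp_apply, Prod.forall] at H ⊢
    rw [contract_mul_hD, map_add, contract_mul_hD, contract_mul_hE, contract_mul_hD, piA_hD_piDual,
      contract_add, H, H, H, LinearMap.add_apply, add_mul, add_assoc]

theorem piDual_piDual (x y : UhDual) : piDual (piDual x y) = piDual x * piDual y := by
  refine LinearMap.ext fun z => LinearMap.ext fun b => ?_
  rw [piDual_apply, ← contract_comp_contract]
  rfl

/-! ### The counit -/

theorem counit_const (u : UB) :
    counit (const u) = algebraMap ℂ Ch (ubLift (B := ℂ) 0 0 (by simp) u) := formExt_const _ _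

theorem counit_one : counit 1 = 1 := by
  rw [← const_one, counit_const, map_one, map_one]

theorem counit_mul (a b : Uh) : counit (a * b) = counit a * counit b := by
  have h1 : counit ∘ₗ LinearMap.mulRight Ch b = LinearMap.mulRight Ch (counit b) ∘ₗ counit := by
    refine hom_ext fun m => ?_
    have h2 : counit ∘ₗ LinearMap.mulLeft Ch (const m)
        = LinearMap.mulLeft Ch (counit (const m)) ∘ₗ counit := by
      refine hom_ext fun m' => ?_
      simp only [LinearMap.comp_apply, LinearMap.mulLeft_apply]
      rw [← const_mul, counit_const, counit_const, counit_const, map_mul, map_mul]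
    exact LinearMap.congr_fun h2 b
  exact LinearMap.congr_fun h1 a

theorem counit_hH : counit hH = 0 := by rw [hH, counit_const, ubLift_uH, map_zero]

theorem counit_hD : counit hD = 0 := by rw [hD, counit_const, ubLift_uD, map_zero]

theorem piA_counit (a : Uh) : piA a counit = counit a • counit :=
  LinearMap.ext fun b => by simp [piA_apply, counit_mul, mul_comm]

/-- The counit as an algebra map. -/
def counitHom : Uh →ₐ[Ch] Ch := AlgHom.ofLinearMap counit counit_one counit_mul

theorem counit_hE : counit hE = 1 := by
  refine hom_hExp counitHom uH ?_
  change IsHSum (fun n => _ • counit hH ^ n) _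
  rw [counit_hH]
  convert IsHSum.single (1 : Ch) using 2 with n
  split_ifs with hn
  · simp [hn]
  · simp [hn]

theorem contract_counit : contract counit = LinearMap.id := by
  refine uh_hom_ext_right (κ := Unit) (f := fun _ => contract counit) (g := fun _ => LinearMap.id)
    ?_ ?_ ?_ ()
  · simp [contract_one, counit_one]
  · intro b H _
    rw [contract_mul_hH, piA_counit, counit_hH, zero_smul, contract_zero, H ()]
    simp
  · intro b H _
    rw [contract_mul_hD, piA_counit, counit_hD, zero_smul, contract_zero, H ()]
    simp

theorem piDual_counit : piDual counit = 1 := by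
  refine LinearMap.ext fun z => LinearMap.ext fun b => ?_
  rw [piDual_apply, contract_counit]
  rfl

theorem counit_comp_contract (x : UhDual) : counit ∘ₗ contract x = x := by
  refine uh_hom_ext_right (κ := UhDual) (f := fun x => counit ∘ₗ contract x) (g := fun x => x)
    ?_ ?_ ?_ x
  · intro x
    simp [contract_one, counit_one]
  · intro b H x
    simp only [LinearMap.comp_apply] at H ⊢
    rw [contract_mul_hH, map_add, counit_mul, counit_hH, mul_zero, zero_add, H, piA_apply]
  · intro b H x
    simp only [LinearMap.comp_apply] at H ⊢
    rw [contract_mul_hD, map_add, counit_mul, counit_mul, counit_hD, mul_zero, zero_add, counit_hE,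
      mul_one, H, piA_apply]

theorem piDual_apply_counit (x : UhDual) : piDual x counit = x := counit_comp_contract x

theorem dual_ext_right {x y : UhDual} (one : x 1 = y 1)
    (mulH : ∀ b, x b = y b → x (b * hH) = y (b * hH))
    (mulD : ∀ b, x b = y b → x (b * hD) = y (b * hD)) : x = y :=
  uh_hom_ext_right (κ := Unit) (f := fun _ => x) (g := fun _ => y) (fun _ => one)
    (fun b H _ => mulH b (H ())) (fun b H _ => mulD b (H ())) ()

/-! ### Gaussian binomial coefficients -/

/-- Gaussian binomial coefficients at `q`. -/
def gauss : ℕ → ℕ → Ch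
  | _, 0 => 1
  | 0, _ + 1 => 0
  | b + 1, n + 1 => gauss b (n + 1) + q ^ (b - n) * gauss b n

theorem gauss_zero_right (b : ℕ) : gauss b 0 = 1 := by cases b <;> rfl

theorem gauss_succ (b n : ℕ) :
    gauss (b + 1) (n + 1) = gauss b (n + 1) + q ^ (b - n) * gauss b n := rfl

theorem gauss_eq_zero {b n : ℕ} (h : b < n) : gauss b n = 0 := by
  induction b generalizing n with
  | zero =>
    obtain ⟨n, rfl⟩ := Nat.exists_eq_succ_of_ne_zero h.ne'
    rfl
  | succ b ih =>
    obtain ⟨n, rfl⟩ := Nat.exists_eq_succ_of_ne_zero (Nat.ne_zero_of_lt h)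
    rw [gauss_succ, ih (by omega), ih (by omega), mul_zero, add_zero]

theorem gauss_self (n : ℕ) : gauss n n = 1 := by
  induction n with
  | zero => rfl
  | succ n ih => rw [gauss_succ, gauss_eq_zero (Nat.lt_succ_self n), ih]; simp

theorem one_sub_q_mul_gauss_one (b : ℕ) : (1 - q) * gauss b 1 = 1 - q ^ b := by
  induction b with
  | zero => simp [gauss]
  | succ b ih => rw [gauss_succ, mul_add, ih, gauss_zero_right, Nat.sub_zero]; ring

theorem qFact_succ (n : ℕ) : qFact (n + 1) = qFact n * (1 - q ^ (n + 1)) :=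
  Finset.prod_range_succ _ _

theorem coeff_one_q_pow (n : ℕ) :
    PowerSeries.coeff 0 (q ^ n) = 1 ∧ PowerSeries.coeff 1 (q ^ n) = -n := by
  have h0 : PowerSeries.coeff 0 q = 1 := by simp [q]
  have h1 : PowerSeries.coeff 1 q = -1 := by simp [q]
  induction n with
  | zero => simp [PowerSeries.coeff_one]
  | succ n ih =>
    rw [PowerSeries.coeff_zero_eq_constantCoeff] at *
    rw [pow_succ, map_mul, PowerSeries.coeff_one_mul, ih.1, ih.2, h0, h1]
    push_cast
    exact ⟨by ring, by ring⟩

theorem one_sub_q_pow_ne_zero (n : ℕ) : 1 - q ^ (n + 1) ≠ 0 := fun h => by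
  have := congrArg (PowerSeries.coeff 1) h
  rw [map_sub, (coeff_one_q_pow _).2, PowerSeries.coeff_one] at this
  simp at this
  exact Nat.cast_add_one_ne_zero n this

theorem qFact_ne_zero (n : ℕ) : qFact n ≠ 0 :=
  Finset.prod_ne_zero_iff.2 fun i _ => one_sub_q_pow_ne_zero i

theorem qFact_mul_gauss (b n : ℕ) (h : n ≤ b) : qFact n * qFact (b - n) * gauss b n = qFact b := by
  induction b generalizing n with
  | zero =>
    obtain rfl : n = 0 := by omega
    simp [qFact, gauss]
  | succ b ih =>
    rcases n with _ | n
    · simp [gauss_zero_right, qFact]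
    · rw [gauss_succ, mul_add, Nat.add_sub_add_right]
      have h1 := ih n (by omega)
      have e1 : qFact (n + 1) * qFact (b - n) * (q ^ (b - n) * gauss b n)
          = (1 - q ^ (n + 1)) * q ^ (b - n) * qFact b := by
        rw [← h1, qFact_succ]
        ring
      rw [e1, qFact_succ b]
      rcases (show n ≤ b by omega).eq_or_lt with rfl | hlt
      · rw [gauss_eq_zero (Nat.lt_succ_self n)]
        simp
        ring
      · have h2 := ih (n + 1) (by omega)
        obtain ⟨d, rfl⟩ : ∃ d, b = n + 1 + d := ⟨b - (n + 1), by omega⟩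
        rw [show n + 1 + d - n = d + 1 by omega, qFact_succ d]
        rw [show n + 1 + d - (n + 1) = d by omega] at h2
        have e2 : qFact (n + 1) * (qFact d * (1 - q ^ (d + 1))) * gauss (n + 1 + d) (n + 1)
            = (1 - q ^ (d + 1)) * qFact (n + 1 + d) := by
          rw [← h2]
          ring
        rw [e2]
        ring

/-- The finite `q`-binomial theorem. -/
theorem sum_gauss (x : Ch) (b : ℕ) :
    ∑ n ∈ Finset.range (b + 1), q ^ (n * (n - 1) / 2) * (-x) ^ n * gauss b n
      = ∏ i ∈ Finset.range b, (1 - x * q ^ i) := by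
  induction b with
  | zero => simp [gauss]
  | succ b ih =>
    rw [Finset.prod_range_succ, ← ih, Finset.sum_range_succ']
    have e : ∀ n ∈ Finset.range (b + 1),
        q ^ ((n + 1) * (n + 1 - 1) / 2) * (-x) ^ (n + 1) * gauss (b + 1) (n + 1)
          = q ^ ((n + 1) * (n + 1 - 1) / 2) * (-x) ^ (n + 1) * gauss b (n + 1)
            + q ^ (n * (n - 1) / 2) * (-x) ^ n * gauss b n * (-x * q ^ b) := by
      intro n hn
      have h1 : (n + 1) * (n + 1 - 1) / 2 = n * (n - 1) / 2 + n := by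
        have := Finset.sum_range_succ (fun i => i) n
        rwa [Finset.sum_range_id, Finset.sum_range_id] at this
      have h2 : q ^ n * q ^ (b - n) = q ^ b := by
        rw [← pow_add]
        congr 1
        have := Finset.mem_range.1 hn
        omega
      rw [gauss_succ, mul_add, h1, ← h2]
      ring
    rw [Finset.sum_congr rfl e, Finset.sum_add_distrib, ← Finset.sum_mul,
      Finset.sum_range_succ (fun n => q ^ ((n + 1) * (n + 1 - 1) / 2) * (-x) ^ (n + 1)
        * gauss b (n + 1)), gauss_eq_zero (Nat.lt_succ_self b)]
    rw [Finset.sum_range_succ' _ b]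
    simp only [gauss_zero_right]
    ring

/-! ### The basis of coordinates -/

theorem piA_hD_uhCoord_zero (m : ℕ) : piA hD (uhCoord (m, 0)) = 0 :=
  uh_hom_ext fun ⟨a, b⟩ => by
    rw [piA_apply, hD, ← const_mul, ubMonomial_mul_uD, uhCoord_ubMonomial]
    simp

theorem piA_hD_uhCoord_succ (m n : ℕ) : piA hD (uhCoord (m, n + 1)) = uhCoord (m, n) :=
  uh_hom_ext fun ⟨a, b⟩ => by
    rw [piA_apply, hD, ← const_mul, ubMonomial_mul_uD, uhCoord_ubMonomial, uhCoord_ubMonomial]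
    simp

theorem piA_hH_uhCoord_zero (n : ℕ) : piA hH (uhCoord (0, n)) = -(n : Ch) • uhCoord (0, n) :=
  uh_hom_ext fun ⟨a, b⟩ => by
    rw [piA_apply, hH, ← const_mul, ubMonomial_mul_uH, const_sub, smul_const', map_sub, map_smul,
      LinearMap.smul_apply, uhCoord_ubMonomial, uhCoord_ubMonomial]
    by_cases h : b = n
    · by_cases h' : a = 0 <;> simp [h, h']
    · simp [h]

theorem piA_hH_uhCoord_succ (m n : ℕ) :
    piA hH (uhCoord (m + 1, n)) = uhCoord (m, n) - (n : Ch) • uhCoord (m + 1, n) :=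
  uh_hom_ext fun ⟨a, b⟩ => by
    rw [piA_apply, hH, ← const_mul, ubMonomial_mul_uH, const_sub, smul_const', map_sub, map_smul,
      LinearMap.sub_apply, LinearMap.smul_apply, uhCoord_ubMonomial, uhCoord_ubMonomial,
      uhCoord_ubMonomial]
    by_cases h : b = n
    · simp [h]
    · simp [h]

theorem uhCoord_one (p : ℕ × ℕ) : uhCoord p 1 = if p = 0 then 1 else 0 := by
  have h := uhCoord_ubMonomial p (0, 0)
  rw [show const (ubMonomial (0, 0)) = 1 by simp [ubMonomial, const_one]] at h
  rw [h]
  congr 1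
  exact propext eq_comm

theorem contract_uhCoord (m n a b : ℕ) :
    contract (uhCoord (m, n)) (const (ubMonomial (a, b)))
      = ((a.choose m : Ch) * gauss b n) • (hH ^ (a - m) * hE ^ n * hD ^ (b - n)) := by
  induction b generalizing m n with
  | zero =>
    induction a generalizing m n with
    | zero =>
      rw [show const (ubMonomial (0, 0)) = 1 by simp [ubMonomial, const_one], contract_one,
        uhCoord_one]
      rcases m with _ | m <;> rcases n with _ | n <;> simp [gauss]
    | succ a ih =>
      have e : const (ubMonomial (a + 1, 0)) = const (ubMonomial (a, 0)) * hH := by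
        rw [hH, ← const_mul, ubMonomial_mul_uH]
        simp
      rw [e, contract_mul_hH]
      rcases n with _ | n
      · rcases m with _ | m
        · rw [piA_hH_uhCoord_zero, contract_smul, ih]
          simp [gauss, pow_succ]
        · rw [piA_hH_uhCoord_succ, Nat.cast_zero, zero_smul, sub_zero, ih, ih, gauss_zero_right,
            Nat.choose_succ_succ, Nat.add_sub_add_right]
          rcases Nat.lt_or_ge a (m + 1) with hlt | hge
          · rw [Nat.choose_eq_zero_of_lt hlt]
            simp
          · obtain ⟨d, rfl⟩ := Nat.exists_eq_add_of_le hge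
            rw [show m + 1 + d - (m + 1) = d by omega, show m + 1 + d - m = d + 1 by omega]
            simp [add_smul, pow_succ, add_comm]
      · have hz : ∀ m', contract (uhCoord (m', n + 1)) (const (ubMonomial (a, 0))) = 0 := by
          intro m'
          rw [ih]
          simp [gauss]
        have hz' : contract (piA hH (uhCoord (m, n + 1))) (const (ubMonomial (a, 0))) = 0 := by
          rcases m with _ | m
          · rw [piA_hH_uhCoord_zero, contract_smul, LinearMap.smul_apply, hz, smul_zero]
          · rw [piA_hH_uhCoord_succ, contract_sub, contract_smul, LinearMap.sub_apply,
              LinearMap.smul_apply, hz, hz, smul_zero, sub_zero]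
        rw [hz, hz', zero_mul, add_zero]
        simp [gauss]
  | succ b ih =>
    have e : const (ubMonomial (a, b + 1)) = const (ubMonomial (a, b)) * hD := by
      rw [hD, ← const_mul, ubMonomial_mul_uD]
    rw [e, contract_mul_hD]
    rcases n with _ | n
    · rw [piA_hD_uhCoord_zero, contract_zero, ih, gauss_zero_right, gauss_zero_right]
      simp [pow_succ, mul_assoc]
    · rw [piA_hD_uhCoord_succ, ih, ih, gauss_succ, Nat.add_sub_add_right, smul_mul_assoc,
        smul_mul_assoc, mul_assoc _ (hD ^ (b - n)), hD_pow_mul_hE, mul_smul_comm, smul_smul, mul_add,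
        add_smul]
      congr 1
      · rcases Nat.lt_or_ge b (n + 1) with hlt | hge
        · rw [gauss_eq_zero hlt]
          simp
        · obtain ⟨d, rfl⟩ := Nat.exists_eq_add_of_le hge
          rw [show n + 1 + d - (n + 1) = d by omega, show n + 1 + d - n = d + 1 by omega,
            pow_succ hD, mul_assoc, mul_assoc]
      · rw [mul_comm (q ^ _) (gauss b n), pow_succ hE]
        simp only [mul_assoc]

theorem contract_uhCoord_eq_zero {m n a b : ℕ} (h : ¬(m ≤ a ∧ n ≤ b)) :
    contract (uhCoord (m, n)) (const (ubMonomial (a, b))) = 0 := by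
  rw [contract_uhCoord]
  rcases not_and_or.1 h with h | h
  · rw [Nat.choose_eq_zero_of_lt (not_le.1 h)]
    simp
  · rw [gauss_eq_zero (not_le.1 h)]
    simp

theorem contract_uhCoord_self (m n : ℕ) :
    contract (uhCoord (m, n)) (const (ubMonomial (m, n))) = hE ^ n := by
  rw [contract_uhCoord, gauss_self]
  simp

theorem Hbar_eq : Hbar = uhCoord (1, 0) := by rw [Hbar, formH_eq, uhCoord]

theorem Dbar_eq : Dbar = (1 - q) • uhCoord (0, 1) := by rw [Dbar, formD_eq, uhCoord]

theorem counit_eq : counit = uhCoord (0, 0) := by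
  refine dual_ext_right ?_ ?_ ?_
  · rw [counit_one, uhCoord_one]
    simp
  · intro b _
    rw [counit_mul, counit_hH, mul_zero, ← piA_apply, piA_hH_uhCoord_zero]
    simp
  · intro b _
    rw [counit_mul, counit_hD, mul_zero, ← piA_apply, piA_hD_uhCoord_zero]
    simp

theorem piDual_Hbar_uhCoord (m n : ℕ) :
    piDual Hbar (uhCoord (m, n)) = ((m + 1 : ℕ) : Ch) • uhCoord (m + 1, n) :=
  uh_hom_ext fun ⟨a, b⟩ => by
    rw [piDual_apply, Hbar_eq, contract_uhCoord, map_smul, pow_zero, mul_one, Nat.sub_zero,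
      gauss_zero_right, ← const_ubMonomial (a - 1, b), uhCoord_ubMonomial, LinearMap.smul_apply,
      uhCoord_ubMonomial, Nat.choose_one_right]
    rcases a with _ | a
    · simp
    · simp only [Nat.add_sub_cancel, Prod.mk.injEq, Nat.add_right_cancel_iff]
      split_ifs with h
      · simp [h.1]
      · simp

theorem uhCoord_zero_hH_mul (n : ℕ) (c : Uh) : uhCoord (0, n) (hH * c) = 0 := by
  have h : uhCoord (0, n) ∘ₗ LinearMap.mulLeft Ch hH = 0 := by
    refine uh_hom_ext fun ⟨a, b⟩ => ?_
    rw [LinearMap.comp_apply, LinearMap.mulLeft_apply, hH, ← const_mul, ubMonomial, ← mul_assoc,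
      ← pow_succ', show uH ^ (a + 1) * uD ^ b = ubMonomial (a + 1, b) from rfl, uhCoord_ubMonomial]
    simp
  exact LinearMap.congr_fun h c

theorem uhCoord_zero_hH_pow_mul (n a : ℕ) (c : Uh) :
    uhCoord (0, n) (hH ^ a * c) = if a = 0 then uhCoord (0, n) c else 0 := by
  rcases a with _ | a
  · simp
  · rw [pow_succ', mul_assoc, uhCoord_zero_hH_mul]
    simp

theorem uhCoord_zero_hE_mul (n : ℕ) (c : Uh) : uhCoord (0, n) (hE * c) = uhCoord (0, n) c := by
  have h := (isHSum_hExp' uH).map (uhCoord (0, n) ∘ₗ LinearMap.mulRight Ch c)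
  refine h.unique ?_
  convert IsHSum.single (uhCoord (0, n) c) using 2 with k
  simp only [LinearMap.comp_apply, LinearMap.mulRight_apply, map_smul]
  rw [show const uH = hH from rfl, uhCoord_zero_hH_pow_mul]
  split_ifs with hk
  · simp [hk]
  · simp

theorem piDual_Dbar_uhCoord (n : ℕ) :
    piDual Dbar (uhCoord (0, n)) = (1 - q ^ (n + 1)) • uhCoord (0, n + 1) :=
  uh_hom_ext fun ⟨a, b⟩ => by
    rw [piDual_apply, Dbar_eq, contract_smul, LinearMap.smul_apply, contract_uhCoord, smul_smul,
      map_smul, pow_one, Nat.sub_zero, mul_assoc, uhCoord_zero_hH_pow_mul, uhCoord_zero_hE_mul,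
      ← one_mul (hD ^ (b - 1)), ← pow_zero hH, ← const_ubMonomial (0, b - 1), uhCoord_ubMonomial,
      LinearMap.smul_apply, uhCoord_ubMonomial, Nat.choose_zero_right, Nat.cast_one, one_mul,
      one_sub_q_mul_gauss_one]
    rcases b with _ | b
    · simp
    · by_cases h : b = n
      · by_cases h' : a = 0 <;> simp [h, h']
      · simp [h]

theorem dualMonomial_eq (m n : ℕ) :
    dualMonomial m n = ((m.factorial : Ch) * qFact n) • uhCoord (m, n) := by
  induction m with
  | zero =>
    rw [Nat.factorial_zero, Nat.cast_one, one_mul]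
    induction n with
    | zero =>
      change counit = _
      simp [counit_eq, qFact]
    | succ n ih =>
      change piDual Dbar (dualMonomial 0 n) = _
      rw [ih, map_smul, piDual_Dbar_uhCoord, smul_smul, qFact_succ]
  | succ m ih =>
    change piDual Hbar (dualMonomial m n) = _
    rw [ih, map_smul, piDual_Hbar_uhCoord, smul_smul, Nat.factorial_succ]
    congr 1
    push_cast
    ring

instance : CharZero Ch :=
  charZero_of_injective_algebraMap (algebraMap ℂ Ch).injective

theorem factorial_mul_qFact_ne_zero (m n : ℕ) : (m.factorial : Ch) * qFact n ≠ 0 :=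
  mul_ne_zero (Nat.cast_ne_zero.2 (Nat.factorial_ne_zero m)) (qFact_ne_zero n)

/-! ### The relations of the double -/

theorem piA_hH_Hbar : piA hH Hbar = counit := by
  rw [Hbar_eq, counit_eq, piA_hH_uhCoord_succ]
  simp

theorem piA_hD_Hbar : piA hD Hbar = 0 := by rw [Hbar_eq, piA_hD_uhCoord_zero]

theorem piA_hH_Dbar : piA hH Dbar = -Dbar := by
  rw [Dbar_eq, map_smul, piA_hH_uhCoord_zero]
  refine LinearMap.ext fun b => ?_
  simp only [LinearMap.smul_apply, LinearMap.neg_apply, smul_eq_mul, Nat.cast_one]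
  ring

theorem piA_hD_Dbar : piA hD Dbar = (1 - q) • counit := by
  rw [Dbar_eq, map_smul, piA_hD_uhCoord_succ, counit_eq]

theorem piA_hE_Hbar : piA hE Hbar = Hbar + (PowerSeries.X : Ch) • counit := by
  have h := (isHSum_hExp' uH).map (LinearMap.applyₗ Hbar ∘ₗ piAHom.toLinearMap)
  refine h.unique ?_
  have h' : IsHSum (fun n => if n = 0 then Hbar else if n = 1 then counit else 0)
      (Hbar + (PowerSeries.X : Ch) • counit) := by
    rintro (_ | _ | N)
    · exact ⟨Hbar + (PowerSeries.X : Ch) • counit, by simp⟩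
    · exact ⟨counit, by simp⟩
    · refine ⟨0, ?_⟩
      rw [Finset.sum_range_succ', Finset.sum_range_succ']
      simp [add_comm]
  convert h' using 2 with n
  simp only [LinearMap.comp_apply, LinearMap.applyₗ_apply_apply, AlgHom.toLinearMap_apply, map_smul,
    map_pow]
  rw [show piAHom (const uH) = piA hH from rfl]
  rcases n with _ | _ | n
  · simp
  · simp [piA_hH_Hbar]
  · rw [pow_succ, pow_succ, Module.End.mul_apply, Module.End.mul_apply, piA_hH_Hbar, piA_counit,
      counit_hH]
    simp

theorem Hbar_one : Hbar 1 = 0 := by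
  rw [Hbar_eq, uhCoord_one]
  simp

theorem Dbar_one : Dbar 1 = 0 := by
  rw [Dbar_eq, LinearMap.smul_apply, uhCoord_one]
  simp

theorem piDual_Hbar_Dbar :
    piDual Hbar Dbar - piDual Dbar Hbar = -((PowerSeries.X : Ch) • Dbar) := by
  rw [← sub_eq_zero, sub_neg_eq_add]
  set z := piDual Hbar Dbar - piDual Dbar Hbar + (PowerSeries.X : Ch) • Dbar with hz
  have hzH : piA hH z = -z := by
    rw [hz, map_add, map_sub, map_smul, piA_hH_piDual, piA_hH_piDual, piA_hH_Hbar, piA_hH_Dbar,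
      piDual_counit, piDual_apply_counit, map_neg, ← piDualHom_apply, ← piDualHom_apply,
      ← piDualHom_apply, map_neg, LinearMap.neg_apply, Module.End.one_apply, smul_neg]
    abel
  have hzD : piA hD z = 0 := by
    rw [hz, map_add, map_sub, map_smul, piA_hD_piDual, piA_hD_piDual, piA_hD_Hbar, piA_hD_Dbar,
      map_smul, piDual_apply_counit, map_zero, piA_hE_Hbar, ← piDualHom_apply, ← piDualHom_apply,
      map_zero, map_smul, piDualHom_apply, piDual_counit, LinearMap.zero_apply,
      LinearMap.smul_apply, Module.End.one_apply, smul_add, smul_smul, smul_smul,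
      mul_comm (PowerSeries.X : Ch)]
    abel
  refine dual_ext_right ?_ (fun b hb => ?_) (fun b _ => ?_)
  · simp [hz, piDual_apply, contract_one, Hbar_one, Dbar_one]
  · rw [← piA_apply, hzH, LinearMap.neg_apply, hb]
    simp
  · rw [← piA_apply, hzD]
    simp

/-! ### Completeness of the algebra of operators on the dual -/

theorem IsHSum.shift {E : Type} [AddCommGroup E] [Module Ch E] {c : ℕ → E} {s : E}
    (hs : IsHSum (fun n => c (n + 1)) s) : IsHSum c (c 0 + (PowerSeries.X : Ch) • s) := by
  rintro (_ | N)
  · exact ⟨c 0 + (PowerSeries.X : Ch) • s, by simp⟩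
  · obtain ⟨t, ht⟩ := hs N
    refine ⟨t, ?_⟩
    conv_lhs => rw [ht]
    rw [Finset.sum_range_succ', smul_add, Finset.smul_sum]
    simp only [smul_smul, ← pow_succ', pow_zero, one_smul]
    abel

theorem chSum_eq (c : ℕ → Ch) (N : ℕ) :
    chSum c = (∑ n ∈ Finset.range N, (PowerSeries.X : Ch) ^ n • c n)
      + (PowerSeries.X : Ch) ^ N • chSum (fun n => c (n + N)) := by
  induction N with
  | zero => simp
  | succ N ih =>
    have h := (isHSum_chSum fun n => c (n + N)).unique
      (IsHSum.shift (isHSum_chSum fun n => c (n + 1 + N)))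
    rw [ih, h, Finset.sum_range_succ, smul_add, smul_smul, ← pow_succ, zero_add]
    simp only [add_assoc, add_comm 1 N]

/-- The sum `∑ hⁿ yₙ` of linear forms. -/
def dualSum {E : Type} [AddCommGroup E] [Module Ch E] :
    (ℕ → Module.Dual Ch E) →ₗ[Ch] Module.Dual Ch E where
  toFun y := chSum ∘ₗ LinearMap.pi y
  map_add' y z := LinearMap.ext fun b => map_add chSum (fun n => y n b) (fun n => z n b)
  map_smul' r y := LinearMap.ext fun b => map_smul chSum r (fun n => y n b)

theorem exists_isHSum_end {E : Type} [AddCommGroup E] [Module Ch E]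
    (T : ℕ → Module.End Ch (Module.Dual Ch E)) :
    ∃ S, @IsHSum (Module.End Ch (Module.Dual Ch E)) Ring.toAddCommGroup Algebra.toModule T S := by
  refine ⟨dualSum ∘ₗ LinearMap.pi T, fun N => ⟨dualSum ∘ₗ LinearMap.pi fun n => T (n + N),
    LinearMap.ext fun y => LinearMap.ext fun b => ?_⟩⟩
  have h := chSum_eq (fun n => T n y b) N
  simp only [LinearMap.add_apply, LinearMap.sum_apply, LinearMap.smul_apply]
  exact h

theorem IsHSum.map_algHom {A E : Type} [Ring A] [Algebra Ch A] [Ring E] [Algebra Ch E] {b : ℕ → A}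
    {x : A} (hx : IsHSum b x) (f : A →ₐ[Ch] E) : IsHSum (fun n => f (b n)) (f x) :=
  hx.map f.toLinearMap

theorem IsHSum.map_end {A E : Type} [AddCommGroup A] [Module Ch A] [AddCommGroup E] [Module Ch E]
    {b : ℕ → A} {x : A} (hx : IsHSum b x) (f : A →ₗ[Ch] Module.End Ch E) :
    @IsHSum (Module.End Ch E) Ring.toAddCommGroup Algebra.toModule (fun n => f (b n)) (f x) :=
  hx.map f

theorem mem_range_of_isHSum {M E : Type} [Ring M] [Algebra ℂ M] [Ring E] [Algebra Ch E]
    [HSeparated E] (f : HSer M →ₐ[Ch] E) {b : ℕ → E} {T : E} (hb : ∀ n, b n ∈ f.range)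
    (hT : IsHSum b T) : T ∈ f.range := by
  choose x hx using hb
  refine ⟨hsum x, ?_⟩
  have h := (isHSum_hsum x).map_algHom f
  have e : (fun n => f (x n)) = b := funext hx
  rw [e] at h
  exact h.unique hT

theorem topAdjoin_le_range {M E : Type} [Ring M] [Algebra ℂ M] [Ring E] [Algebra Ch E]
    [HSeparated E] (f : HSer M →ₐ[Ch] E) {S : Set E} (hS : S ⊆ f.range) :
    topAdjoin S ≤ f.range := by
  rintro T ⟨b, hb, hT⟩
  exact mem_range_of_isHSum f (fun n => Algebra.adjoin_le hS (hb n)) hT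

instance {E : Type} [AddCommGroup E] [Module Ch E] [HSeparated E] :
    @HSeparated (Module.End Ch E) Ring.toAddCommGroup Algebra.toModule :=
  inferInstanceAs (HSeparated (E →ₗ[Ch] E))

section ExtendTo

variable {M E : Type} [Ring M] [Algebra ℂ M] [Ring E] [Algebra Ch E] [HSeparated E] [Algebra ℂ E]
  [IsScalarTower ℂ Ch E]

/-- The continuous extension to series of an algebra map to a complete algebra. -/
def extendTo (hE : ∀ T : ℕ → E, ∃ S, IsHSum T S) (f : M →ₐ[ℂ] E) : HSer M →ₐ[Ch] E where
  toFun x := (hE fun n => f (coeff n x)).choose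
  map_one' := by
    refine (hE _).choose_spec.unique ?_
    convert IsHSum.single (1 : E) using 2 with n
    rw [← const_one, coeff_const]
    split_ifs <;> simp
  map_zero' := by
    refine (hE _).choose_spec.unique ?_
    simpa using IsHSum.zero
  map_add' x y := by
    refine (hE _).choose_spec.unique ?_
    simpa using (hE _).choose_spec.add (hE _).choose_spec
  map_mul' x y := by
    refine (hE _).choose_spec.unique ?_
    simp only [coeff_mul, map_sum, map_mul]
    have h := (hE fun n => f (coeff n x)).choose_spec.mul (hE fun n => f (coeff n y)).choose_spec
    exact h
  commutes' c := by
    refine (hE _).choose_spec.unique ?_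
    have h := (Ch.isHSum_coeff c).map (Algebra.linearMap Ch E)
    simp only [Algebra.linearMap_apply] at h
    convert h using 2 with n
    rw [show algebraMap Ch (HSer M) c = ofCh M c from rfl, coeff_ofCh, AlgHom.commutes,
      IsScalarTower.algebraMap_apply ℂ Ch E]

theorem isHSum_extendTo (hE : ∀ T : ℕ → E, ∃ S, IsHSum T S) (f : M →ₐ[ℂ] E) (x : HSer M) :
    IsHSum (fun n => f (coeff n x)) (extendTo hE f x) := (hE _).choose_spec

theorem extendTo_const (hE : ∀ T : ℕ → E, ∃ S, IsHSum T S) (f : M →ₐ[ℂ] E) (m : M) :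
    extendTo hE f (const m) = f m := by
  refine (isHSum_extendTo hE f _).unique ?_
  convert IsHSum.single (f m) using 2 with n
  rw [coeff_const]
  split_ifs <;> simp

theorem extendTo_mem_topAdjoin (hE : ∀ T : ℕ → E, ∃ S, IsHSum T S) (f : M →ₐ[ℂ] E) {S : Set E}
    (hS : ∀ m, f m ∈ Algebra.adjoin Ch S) (x : HSer M) : extendTo hE f x ∈ topAdjoin S :=
  ⟨_, fun n => hS (coeff n x), isHSum_extendTo hE f x⟩

end ExtendTo

/-! ### Presented algebras -/

section TopPres

variable {G : Type} {rels : Set (HSer (FreeAlgebra ℂ G))}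

variable (rels) in
/-- Congruence modulo the closed ideal generated by the relations. -/
def closedIdealCon : RingCon (HSer (FreeAlgebra ℂ G)) where
  r := ClosedIdealRel rels
  iseqv :=
    { refl := fun x N => ⟨0, by simp⟩
      symm := fun {x y} H N => by
        obtain ⟨z, hz⟩ := H N
        refine ⟨-z, ?_⟩
        convert TwoSidedIdeal.neg_mem _ hz using 1
        rw [smul_neg]
        abel
      trans := fun {x y w} H K N => by
        obtain ⟨z, hz⟩ := H N
        obtain ⟨z', hz'⟩ := K N
        refine ⟨z + z', ?_⟩
        convert TwoSidedIdeal.add_mem _ hz hz' using 1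
        rw [smul_add]
        abel }
  add' := fun {a b c d} H K N => by
    obtain ⟨z, hz⟩ := H N
    obtain ⟨z', hz'⟩ := K N
    refine ⟨z + z', ?_⟩
    convert TwoSidedIdeal.add_mem _ hz hz' using 1
    rw [smul_add]
    abel
  mul' := fun {a b c d} H K N => by
    obtain ⟨z, hz⟩ := H N
    obtain ⟨z', hz'⟩ := K N
    refine ⟨z * c + b * z', ?_⟩
    convert TwoSidedIdeal.add_mem _ (TwoSidedIdeal.mul_mem_right _ _ c hz)
      (TwoSidedIdeal.mul_mem_left _ b _ hz') using 1
    rw [smul_add, ← smul_mul_assoc, ← mul_smul_comm, sub_mul, sub_mul, mul_sub, mul_sub]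
    abel

theorem TopPres.quot_eq_iff {x y : HSer (FreeAlgebra ℂ G)} :
    TopPres.quot rels x = TopPres.quot rels y ↔ ClosedIdealRel rels x y := by
  constructor
  · intro H
    let f : RingQuot (ClosedIdealRel rels) →+* (closedIdealCon rels).Quotient :=
      RingQuot.lift ⟨(closedIdealCon rels).mk', fun {a b} hab => (RingCon.eq _).2 hab⟩
    have hf : ∀ z, f (TopPres.quot rels z) = (closedIdealCon rels).mk' z := by
      intro z
      change f (RingQuot.mkAlgHom Ch (ClosedIdealRel rels) z) = _
      have e : RingQuot.mkAlgHom Ch (ClosedIdealRel rels) z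
          = RingQuot.mkRingHom (ClosedIdealRel rels) z := by
        rw [← RingQuot.mkAlgHom_coe Ch (ClosedIdealRel rels)]
        rfl
      rw [e]
      exact RingQuot.lift_mkRingHom_apply _ _ _
    have h := congrArg f H
    rw [hf, hf] at h
    exact (RingCon.eq _).1 h
  · exact fun H => RingQuot.mkAlgHom_rel Ch H

theorem TopPres.quot_surjective : Function.Surjective (TopPres.quot rels) :=
  RingQuot.mkAlgHom_surjective Ch _

instance : HSeparated (TopPres rels) where
  eq_zero p H := by
    obtain ⟨x, rfl⟩ := TopPres.quot_surjective p
    rw [← map_zero (TopPres.quot rels), TopPres.quot_eq_iff]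
    intro N
    obtain ⟨s, hs⟩ := H N
    obtain ⟨y, rfl⟩ := TopPres.quot_surjective s
    rw [← map_smul, TopPres.quot_eq_iff] at hs
    obtain ⟨z, hz⟩ := hs N
    refine ⟨y + z, ?_⟩
    convert hz using 1
    rw [smul_add]
    abel

theorem TopPres.quot_eq_zero {r : HSer (FreeAlgebra ℂ G)} (hr : r ∈ rels) :
    TopPres.quot rels r = 0 := by
  rw [← map_zero (TopPres.quot rels), TopPres.quot_eq_iff]
  exact fun N => ⟨0, by simpa using TwoSidedIdeal.subset_span hr⟩

/-- Continuous algebra maps out of a presented algebra. -/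
def TopPres.lift {E : Type} [Ring E] [Algebra Ch E] [HSeparated E]
    (f : HSer (FreeAlgebra ℂ G) →ₐ[Ch] E) (hf : ∀ r ∈ rels, f r = 0) : TopPres rels →ₐ[Ch] E :=
  RingQuot.liftAlgHom Ch ⟨f, fun x y H => by
    refine HSeparated.eq fun N => ?_
    obtain ⟨z, hz⟩ := H N
    have hle : TwoSidedIdeal.span rels ≤ TwoSidedIdeal.ker f :=
      TwoSidedIdeal.span_le.2 fun r hr => (TwoSidedIdeal.mem_ker f).2 (hf r hr)
    have h := (TwoSidedIdeal.mem_ker f).1 (hle hz)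
    rw [map_sub, map_sub, map_smul, sub_eq_zero] at h
    exact ⟨f z, h⟩⟩

theorem TopPres.lift_quot {E : Type} [Ring E] [Algebra Ch E] [HSeparated E]
    (f : HSer (FreeAlgebra ℂ G) →ₐ[Ch] E) (hf : ∀ r ∈ rels, f r = 0) (x : HSer (FreeAlgebra ℂ G)) :
    TopPres.lift f hf (TopPres.quot rels x) = f x :=
  RingQuot.liftAlgHom_mkAlgHom_apply Ch _ _ x

instance : Algebra ℂ (TopPres rels) := Algebra.compHom _ (algebraMap ℂ Ch)

instance : IsScalarTower ℂ Ch (TopPres rels) := IsScalarTower.of_algebraMap_eq' rfl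

end TopPres

/-! ### The action of the presented algebra -/

/-- The action of the free algebra on the dual. -/
def freeAction : FreeAlgebra ℂ HGen →ₐ[ℂ] Module.End Ch UhDual :=
  FreeAlgebra.lift ℂ fun g => match g with
    | HGen.H => piA hH
    | HGen.D => piA hD
    | HGen.Hb => piDual Hbar
    | HGen.Db => piDual Dbar

/-- The action of the completed free algebra on the dual. -/
def seriesAction : HSer (FreeAlgebra ℂ HGen) →ₐ[Ch] Module.End Ch UhDual :=
  extendTo (E := Module.End Ch UhDual) (exists_isHSum_end (E := Uh)) freeAction

theorem seriesAction_gen (g : HGen) :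
    seriesAction (gen g) = match g with
      | HGen.H => piA hH
      | HGen.D => piA hD
      | HGen.Hb => piDual Hbar
      | HGen.Db => piDual Dbar := by
  rw [gen, seriesAction, extendTo_const, freeAction, FreeAlgebra.lift_ι_apply]

theorem seriesAction_hExp : seriesAction (hExp (FreeAlgebra.ι ℂ HGen.H)) = piA hE := by
  refine hom_hExp (E := Module.End Ch UhDual) _ _ ?_
  rw [show const (FreeAlgebra.ι ℂ HGen.H) = gen HGen.H from rfl, seriesAction_gen]
  have h := (isHSum_hExp' uH).map_algHom (E := Module.End Ch UhDual) piAHom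
  simp only [map_smul, map_pow] at h
  exact h

theorem seriesAction_rels : ∀ r ∈ doubleRels, seriesAction r = 0 := by
  have smul : ∀ (c : Ch) x, piDual (c • x) = c • piDual x := map_smul piDualHom
  have sub : ∀ x y, piDual (x - y) = piDual x - piDual y := map_sub piDualHom
  have neg : ∀ x, piDual (-x) = -piDual x := map_neg piDualHom
  rintro r (rfl | rfl | rfl | rfl | rfl | rfl)
  · simp only [map_sub, map_mul, seriesAction_gen]
    rw [← piA_mul, ← piA_mul, ← piAHom_apply, ← piAHom_apply, ← piAHom_apply, ← map_sub, ← map_sub,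
      hH, hD, ← const_mul, ← const_mul, ← const_sub, uH_mul_uD, sub_self, map_zero]
  · simp only [map_sub, map_add, map_mul, map_smul, seriesAction_gen]
    rw [← piDual_piDual, ← piDual_piDual, ← sub, piDual_Hbar_Dbar, neg, smul]
    exact neg_add_cancel ((PowerSeries.X : Ch) • piDual Dbar)
  · simp only [map_sub, map_mul, map_one, seriesAction_gen]
    refine LinearMap.ext fun y => ?_
    simp [piA_hH_piDual, piA_hH_Hbar, piDual_counit]
  · simp only [map_sub, map_mul, seriesAction_gen]
    refine LinearMap.ext fun y => ?_
    have h0 : piDual 0 = 0 := map_zero piDualHom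
    simp [piA_hD_piDual, piA_hD_Hbar, h0]
  · simp only [map_sub, map_add, map_mul, seriesAction_gen]
    refine LinearMap.ext fun y => ?_
    simp [piA_hH_piDual, piA_hH_Dbar, neg]
  · simp only [map_sub, map_mul, seriesAction_gen, map_smul, seriesAction_hExp]
    refine LinearMap.ext fun y => ?_
    simp [piA_hD_piDual, piA_hD_Dbar, smul, piDual_counit]

/-- The action of the presented algebra on the dual. -/
def presAction : PresInt →ₐ[Ch] Module.End Ch UhDual :=
  TopPres.lift (E := Module.End Ch UhDual) seriesAction seriesAction_rels

theorem presAction_quot (x : HSer (FreeAlgebra ℂ HGen)) :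
    presAction (TopPres.quot doubleRels x) = seriesAction x :=
  TopPres.lift_quot (E := Module.End Ch UhDual) _ _ _

theorem presAction_presGen (g : HGen) :
    presAction (presGen g) = match g with
      | HGen.H => piA hH
      | HGen.D => piA hD
      | HGen.Hb => piDual Hbar
      | HGen.Db => piDual Dbar := by
  rw [presGen, presAction_quot, seriesAction_gen]

/-! ### Normal forms in the presented algebra -/

section Relations

theorem presGen_H_mul_D : presGen .H * presGen .D - presGen .D * presGen .H = presGen .D := by
  have h := TopPres.quot_eq_zero (rels := doubleRels) (Or.inl rfl)
  rw [map_sub, map_sub, map_mul, map_mul, sub_eq_zero] at h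
  exact h

theorem presGen_Db_mul_Hb : presGen .Db * presGen .Hb
    = presGen .Hb * presGen .Db + (PowerSeries.X : Ch) • presGen .Db := by
  have h := TopPres.quot_eq_zero (rels := doubleRels) (Or.inr (Or.inl rfl))
  rw [map_add, map_sub, map_mul, map_mul, map_smul, sub_add_eq_add_sub, sub_eq_zero] at h
  exact h.symm

theorem presGen_H_mul_Hb : presGen .H * presGen .Hb = presGen .Hb * presGen .H + 1 := by
  have h := TopPres.quot_eq_zero (rels := doubleRels) (Or.inr (Or.inr (Or.inl rfl)))
  rw [map_sub, map_sub, map_mul, map_mul, map_one, sub_eq_zero, sub_eq_iff_eq_add'] at h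
  exact h

theorem presGen_D_mul_Hb : presGen .D * presGen .Hb = presGen .Hb * presGen .D := by
  have h := TopPres.quot_eq_zero (rels := doubleRels) (Or.inr (Or.inr (Or.inr (Or.inl rfl))))
  rw [map_sub, map_mul, map_mul, sub_eq_zero] at h
  exact h

theorem presGen_H_mul_Db : presGen .H * presGen .Db
    = presGen .Db * presGen .H - presGen .Db := by
  have h := TopPres.quot_eq_zero (rels := doubleRels)
    (Or.inr (Or.inr (Or.inr (Or.inr (Or.inl rfl)))))
  rw [map_add, map_sub, map_mul, map_mul, ← eq_neg_iff_add_eq_zero, sub_eq_iff_eq_add',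
    ← sub_eq_add_neg] at h
  exact h

/-- The element `e^{hH}` of the presented algebra. -/
def presE : PresInt := TopPres.quot doubleRels (hExp (FreeAlgebra.ι ℂ HGen.H))

theorem presGen_D_mul_Db : presGen .D * presGen .Db
    = presGen .Db * presGen .D + (1 - q) • presE := by
  have h := TopPres.quot_eq_zero (rels := doubleRels)
    (Or.inr (Or.inr (Or.inr (Or.inr (Or.inr rfl)))))
  rw [map_sub, map_sub, map_mul, map_mul, map_smul, sub_eq_zero, sub_eq_iff_eq_add'] at h
  exact h

end Relations

/-- The subalgebra generated by `H` and `D` in the presented algebra. -/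
def presUB : UB →ₐ[ℂ] PresInt := ubLift (presGen .H) (presGen .D) presGen_H_mul_D

/-- The normally ordered element `H̄^m D̄^n u`, `u ∈ U(b)`. -/
def normalTerm (p : ℕ × ℕ) (u : UB) : PresInt := presGen .Hb ^ p.1 * (presGen .Db ^ p.2 * presUB u)

/-- Finite sums of normally ordered elements. -/
def normalSum (w : ℕ × ℕ →₀ UB) : PresInt := w.sum normalTerm

theorem normalTerm_zero (p : ℕ × ℕ) : normalTerm p 0 = 0 := by simp [normalTerm]

theorem normalTerm_add (p : ℕ × ℕ) (u v : UB) :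
    normalTerm p (u + v) = normalTerm p u + normalTerm p v := by simp [normalTerm, mul_add]

theorem normalSum_add (w w' : ℕ × ℕ →₀ UB) : normalSum (w + w') = normalSum w + normalSum w' :=
  Finsupp.sum_add_index' normalTerm_zero normalTerm_add

theorem normalSum_smul (c : ℂ) (w : ℕ × ℕ →₀ UB) :
    normalSum (c • w) = algebraMap ℂ Ch c • normalSum w := by
  rw [normalSum, Finsupp.sum_smul_index' normalTerm_zero, normalSum, Finsupp.smul_sum]
  refine Finsupp.sum_congr fun p _ => ?_
  rw [algebraMap_smul, normalTerm, normalTerm, map_smul, mul_smul_comm, mul_smul_comm]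

theorem normalSum_sum {ι : Type} (s : Finset ι) (w : ι → ℕ × ℕ →₀ UB) :
    normalSum (∑ i ∈ s, w i) = ∑ i ∈ s, normalSum (w i) :=
  map_sum (AddMonoidHom.mk' normalSum normalSum_add) w s

/-- `p` is an `h`-adic sum of normally ordered elements. -/
def IsNormal (p : PresInt) : Prop := ∃ w : ℕ → ℕ × ℕ →₀ UB, IsHSum (fun n => normalSum (w n)) p

theorem IsNormal.of_isHSum {b : ℕ → PresInt} {p : PresInt} (hb : ∀ n, IsNormal (b n))
    (hp : IsHSum b p) : IsNormal p := by
  choose w hw using hb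
  refine ⟨fun k => ∑ p ∈ Finset.HasAntidiagonal.antidiagonal k, w p.1 p.2, ?_⟩
  simp only [normalSum_sum]
  have h := IsHSum.assoc hw hp
  exact h

theorem isNormal_normalSum (w : ℕ × ℕ →₀ UB) : IsNormal (normalSum w) := by
  refine ⟨fun n => if n = 0 then w else 0, ?_⟩
  convert IsHSum.single (normalSum w) using 2 with n
  split_ifs with hn
  · simp [hn]
  · simp [hn, normalSum]

theorem isNormal_normalTerm (p : ℕ × ℕ) (u : UB) : IsNormal (normalTerm p u) := by
  have h := isNormal_normalSum (Finsupp.single p u)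
  rwa [normalSum, Finsupp.sum_single_index (normalTerm_zero p)] at h

theorem isNormal_mul (m n : ℕ) (u : UB) :
    IsNormal (presGen .Hb ^ m * (presGen .Db ^ n * presUB u)) := isNormal_normalTerm (m, n) u

theorem IsNormal.zero : IsNormal 0 := by
  simpa [normalSum] using isNormal_normalSum 0

theorem IsNormal.add {p p' : PresInt} (hp : IsNormal p) (hp' : IsNormal p') :
    IsNormal (p + p') := by
  obtain ⟨w, hw⟩ := hp
  obtain ⟨w', hw'⟩ := hp'
  refine ⟨fun n => w n + w' n, ?_⟩
  simp only [normalSum_add]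
  exact hw.add hw'

theorem IsNormal.smul (c : Ch) {p : PresInt} (hp : IsNormal p) : IsNormal (c • p) := by
  refine IsNormal.of_isHSum (b := fun n => algebraMap ℂ Ch (PowerSeries.coeff n c) • p)
    (fun n => ?_) ((Ch.isHSum_coeff c).map (LinearMap.toSpanSingleton Ch PresInt p))
  obtain ⟨w, hw⟩ := hp
  refine ⟨fun k => PowerSeries.coeff n c • w k, ?_⟩
  simp only [normalSum_smul]
  exact hw.map (algebraMap ℂ Ch (PowerSeries.coeff n c) • (LinearMap.id : PresInt →ₗ[Ch] PresInt))

theorem IsNormal.sub {p p' : PresInt} (hp : IsNormal p) (hp' : IsNormal p') :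
    IsNormal (p - p') := by
  simpa [sub_eq_add_neg] using hp.add (hp'.smul (-1))

theorem IsNormal.mul_left {a p : PresInt}
    (ha : ∀ m n u, IsNormal (a * (presGen .Hb ^ m * (presGen .Db ^ n * presUB u))))
    (hp : IsNormal p) : IsNormal (a * p) := by
  obtain ⟨w, hw⟩ := hp
  refine IsNormal.of_isHSum (fun k => ?_) (hw.map (LinearMap.mulLeft Ch a))
  rw [LinearMap.mulLeft_apply, normalSum, Finsupp.sum, Finset.mul_sum]
  exact Finset.sum_induction _ IsNormal (fun _ _ => IsNormal.add) IsNormal.zero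
    fun p _ => ha p.1 p.2 _

theorem IsNormal.Hb_mul {p : PresInt} (hp : IsNormal p) : IsNormal (presGen .Hb * p) := by
  refine hp.mul_left fun m n u => ?_
  rw [← mul_assoc, ← pow_succ']
  exact isNormal_mul _ _ _

theorem IsNormal.Db_mul {p : PresInt} (hp : IsNormal p) : IsNormal (presGen .Db * p) := by
  refine hp.mul_left fun m n u => ?_
  induction m with
  | zero =>
    rw [pow_zero, one_mul, ← mul_assoc, ← pow_succ']
    simpa using isNormal_mul 0 (n + 1) u
  | succ m ih =>
    rw [pow_succ', mul_assoc, ← mul_assoc, presGen_Db_mul_Hb, add_mul, smul_mul_assoc, mul_assoc]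
    exact ih.Hb_mul.add (ih.smul _)

theorem IsNormal.H_mul {p : PresInt} (hp : IsNormal p) : IsNormal (presGen .H * p) := by
  refine hp.mul_left fun m n u => ?_
  induction m with
  | zero =>
    rw [pow_zero, one_mul]
    induction n with
    | zero =>
      have h := isNormal_mul 0 0 (uH * u)
      rw [map_mul, show presUB uH = presGen .H from ubLift_uH _ _ _] at h
      simpa using h
    | succ n ih =>
      rw [pow_succ', mul_assoc, ← mul_assoc, presGen_H_mul_Db, sub_mul, mul_assoc]
      refine ih.Db_mul.sub ?_
      rw [← mul_assoc, ← pow_succ']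
      simpa using isNormal_mul 0 (n + 1) u
  | succ m ih =>
    rw [pow_succ', mul_assoc, ← mul_assoc, presGen_H_mul_Hb, add_mul, one_mul, mul_assoc]
    exact ih.Hb_mul.add (isNormal_mul _ _ _)

theorem IsNormal.E_mul {p : PresInt} (hp : IsNormal p) : IsNormal (presE * p) := by
  have h := (isHSum_hExp' (FreeAlgebra.ι ℂ HGen.H)).map
    (LinearMap.mulRight Ch p ∘ₗ (TopPres.quot doubleRels).toLinearMap)
  refine IsNormal.of_isHSum (fun n => ?_) h
  simp only [LinearMap.comp_apply, map_smul, AlgHom.toLinearMap_apply, map_pow,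
    LinearMap.mulRight_apply]
  refine IsNormal.smul _ ?_
  change IsNormal (presGen .H ^ n * p)
  induction n with
  | zero => simpa using hp
  | succ n ih =>
    rw [pow_succ', mul_assoc]
    exact ih.H_mul

theorem IsNormal.D_mul {p : PresInt} (hp : IsNormal p) : IsNormal (presGen .D * p) := by
  refine hp.mul_left fun m n u => ?_
  induction m with
  | zero =>
    rw [pow_zero, one_mul]
    induction n with
    | zero =>
      have h := isNormal_mul 0 0 (uD * u)
      rw [map_mul, show presUB uD = presGen .D from ubLift_uD _ _ _] at h
      simpa using h
    | succ n ih =>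
      rw [pow_succ', mul_assoc, ← mul_assoc, presGen_D_mul_Db, add_mul, mul_assoc, smul_mul_assoc]
      refine ih.Db_mul.add (IsNormal.smul _ (IsNormal.E_mul ?_))
      simpa using isNormal_mul 0 n u
  | succ m ih =>
    rw [pow_succ', mul_assoc, ← mul_assoc, presGen_D_mul_Hb, mul_assoc]
    exact ih.Hb_mul

theorem isNormal (p : PresInt) : IsNormal p := by
  obtain ⟨x, rfl⟩ := TopPres.quot_surjective p
  refine IsNormal.of_isHSum (fun n => ?_) ((isHSum_coeff x).map (TopPres.quot doubleRels).toLinearMap)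
  generalize coeff n x = w
  rw [AlgHom.toLinearMap_apply]
  suffices H : ∀ p, IsNormal p → IsNormal (TopPres.quot doubleRels (const w) * p) by
    have h := H 1 (by simpa using isNormal_mul 0 0 1)
    rwa [mul_one] at h
  induction w using FreeAlgebra.induction with
  | grade0 r =>
    intro p hp
    rw [Algebra.algebraMap_eq_smul_one, smul_const', map_smul, const_one, map_one, smul_mul_assoc,
      one_mul]
    exact hp.smul _
  | grade1 g =>
    intro p hp
    cases g with
    | H => exact hp.H_mul
    | D => exact hp.D_mul
    | Hb => exact hp.Hb_mul
    | Db => exact hp.Db_mul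
  | mul a b ha hb =>
    intro p hp
    rw [const_mul, map_mul, mul_assoc]
    exact ha _ (hb _ hp)
  | add a b ha hb =>
    intro p hp
    rw [const_add, map_add, add_mul]
    exact (ha _ hp).add (hb _ hp)

/-! ### Faithfulness -/

theorem presAction_presUB (u : UB) : presAction (presUB u) = piA (const u) := by
  refine UB.induction_right (P := fun u => presAction (presUB u) = piA (const u)) ?_ ?_ ?_ ?_ ?_ u
  · rw [map_one, map_one, const_one, ← piAHom_apply, map_one]
  · intro u v hu hv
    rw [map_add, map_add, hu, hv, const_add]
    exact (map_add piAHom _ _).symm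
  · intro c u hu
    rw [map_smul, ← algebraMap_smul Ch c (presUB u), map_smul, hu, smul_const']
    exact (map_smul piAHom _ _).symm
  · intro u hu
    rw [map_mul, map_mul, hu, const_mul, piA_mul, presUB, ubLift_uH, presAction_presGen]
    rfl
  · intro u hu
    rw [map_mul, map_mul, hu, const_mul, piA_mul, presUB, ubLift_uD, presAction_presGen]
    rfl

theorem piDual_dualWord_append (l l' : List BGen) :
    piDual (dualWord (l ++ l')) = piDual (dualWord l) * piDual (dualWord l') := by
  induction l with
  | nil => simp [dualWord, piDual_counit]
  | cons g l ih =>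
    cases g with
    | H =>
      change piDual (piDual Hbar (dualWord (l ++ l'))) = piDual (piDual Hbar (dualWord l)) * _
      rw [piDual_piDual, piDual_piDual, ih, mul_assoc]
    | D =>
      change piDual (piDual Dbar (dualWord (l ++ l'))) = piDual (piDual Dbar (dualWord l)) * _
      rw [piDual_piDual, piDual_piDual, ih, mul_assoc]

theorem piDual_dualMonomial (m n : ℕ) :
    piDual (dualMonomial m n) = piDual Hbar ^ m * piDual Dbar ^ n := by
  rw [dualMonomial, piDual_dualWord_append]
  congr 1
  · induction m with
    | zero => simp [dualWord, piDual_counit]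
    | succ m ih =>
      rw [List.replicate_succ, dualWord, piDual_piDual, ih, pow_succ']
  · induction n with
    | zero => simp [dualWord, piDual_counit]
    | succ n ih =>
      rw [List.replicate_succ, dualWord, piDual_piDual, ih, pow_succ']

theorem presAction_normalTerm (p : ℕ × ℕ) (u : UB) (y : UhDual) (b : Uh) :
    presAction (normalTerm p u) y b = ((p.1.factorial : Ch) * qFact p.2) •
      y (contract (uhCoord p) b * const u) := by
  rw [normalTerm, map_mul, map_mul, map_pow, map_pow, presAction_presUB, presAction_presGen,
    presAction_presGen, ← mul_assoc]
  change ((piDual Hbar ^ p.1 * piDual Dbar ^ p.2) * piA (const u)) y b = _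
  rw [← piDual_dualMonomial, dualMonomial_eq, Module.End.mul_apply, piDual_apply, contract_smul,
    LinearMap.smul_apply, map_smul, piA_apply]

theorem uh_smul_eq_zero {c : Ch} (hc : c ≠ 0) {a : Uh} (h : c • a = 0) : a = 0 :=
  uh_ext fun p => by
    have := congrArg (uhCoord p) h
    rw [map_smul, map_zero, smul_eq_mul, mul_eq_zero] at this
    rw [map_zero]
    exact this.resolve_left hc

theorem hE_pow_mul_eq_zero (n : ℕ) {a : Uh} (h : hE ^ n * a = 0) : a = 0 := by
  have hu : IsUnit (hE ^ n) := IsUnit.pow n ⟨⟨hE, hExp (-uH), hE_mul_inv, inv_mul_hE⟩, rfl⟩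
  exact hu.mul_right_eq_zero.1 h

theorem presAction_injective : Function.Injective presAction := by
  rw [injective_iff_map_eq_zero]
  intro p hp
  obtain ⟨w, hw⟩ := isNormal p
  have key : ∀ s m n, m + n = s → ∀ k, w k (m, n) = 0 := by
    intro s
    induction s using Nat.strong_induction_on with
    | _ s ih =>
      intro m n hmn
      have hA : hE ^ n * (mk fun k => w k (m, n)) = 0 := by
        refine uh_smul_eq_zero (factorial_mul_qFact_ne_zero m n) (uh_ext_dual fun y => ?_)
        have h1 := hw.map (LinearMap.applyₗ (const (ubMonomial (m, n))) ∘ₗ LinearMap.applyₗ y ∘ₗ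
          presAction.toLinearMap)
        have h2 := (isHSum_mk fun k => w k (m, n)).map
          (((m.factorial : Ch) * qFact n) • (y ∘ₗ LinearMap.mulLeft Ch (hE ^ n)))
        have h3 := h2.unique (y := 0) (by
          convert h1 using 2 with k
          · simp only [LinearMap.comp_apply, LinearMap.applyₗ_apply_apply, LinearMap.smul_apply,
              AlgHom.toLinearMap_apply, LinearMap.mulLeft_apply]
            rw [normalSum, Finsupp.sum, map_sum, LinearMap.sum_apply, LinearMap.sum_apply,
              Finset.sum_eq_single (m, n)]
            · rw [presAction_normalTerm, contract_uhCoord_self]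
            · rintro ⟨m', n'⟩ - hne
              rw [presAction_normalTerm]
              by_cases hle : m' ≤ m ∧ n' ≤ n
              · have hlt : m' + n' < s := by
                  rcases hle with ⟨h, h'⟩
                  by_contra hge
                  exact hne (by rw [Prod.mk.injEq]; omega)
                rw [ih _ hlt _ _ rfl, const_zero, mul_zero, map_zero, smul_zero]
              · rw [contract_uhCoord_eq_zero hle, zero_mul, map_zero, smul_zero]
            · intro hs
              rw [Finsupp.notMem_support_iff.1 hs, normalTerm_zero, map_zero]
              rfl
          · simp [hp])
        rw [map_smul, map_zero]
        exact h3
      have hA' := hE_pow_mul_eq_zero n hA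
      intro k
      have := congrArg (coeff k) hA'
      rwa [coeff_mk, map_zero] at this
  have hz : ∀ n, normalSum (w n) = 0 := by
    intro n
    have : w n = 0 := Finsupp.ext fun ⟨i, j⟩ => key _ i j rfl n
    rw [this]
    simp [normalSum]
  simp only [hz] at hw
  exact hw.unique IsHSum.zero

/-! ### The image -/

theorem Hbar_mem : Hbar ∈ queDual := by
  refine ⟨fun n => if n = 0 then Hbar else 0, fun n => ?_, IsHSum.single _⟩
  dsimp only
  split_ifs
  · exact Submodule.subset_span ⟨[BGen.H], piDual_apply_counit Hbar⟩
  · exact Submodule.zero_mem _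

theorem Dbar_mem : Dbar ∈ queDual := by
  refine ⟨fun n => if n = 0 then Dbar else 0, fun n => ?_, IsHSum.single _⟩
  dsimp only
  split_ifs
  · exact Submodule.subset_span ⟨[BGen.D], piDual_apply_counit Dbar⟩
  · exact Submodule.zero_mem _

theorem presAction_mem (p : PresInt) : presAction p ∈ doubleInt := by
  obtain ⟨x, rfl⟩ := TopPres.quot_surjective p
  rw [presAction_quot]
  refine extendTo_mem_topAdjoin (E := Module.End Ch UhDual) (exists_isHSum_end (E := Uh)) freeAction
    (fun w => ?_) x
  induction w using FreeAlgebra.induction with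
  | grade0 r =>
    rw [AlgHom.commutes, IsScalarTower.algebraMap_apply ℂ Ch]
    exact Subalgebra.algebraMap_mem _ _
  | grade1 g =>
    rw [freeAction, FreeAlgebra.lift_ι_apply]
    refine Algebra.subset_adjoin ?_
    cases g with
    | H => exact Or.inl ⟨_, rfl⟩
    | D => exact Or.inl ⟨_, rfl⟩
    | Hb => exact Or.inr ⟨_, Hbar_mem, rfl⟩
    | Db => exact Or.inr ⟨_, Dbar_mem, rfl⟩
  | mul a b ha hb =>
    rw [map_mul]
    exact Subalgebra.mul_mem _ ha hb
  | add a b ha hb =>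
    rw [map_add]
    exact Subalgebra.add_mem _ ha hb

theorem range_presAction : presAction.range = seriesAction.range := by
  ext T
  constructor
  · rintro ⟨p, rfl⟩
    obtain ⟨x, rfl⟩ := TopPres.quot_surjective p
    exact ⟨x, (presAction_quot x).symm⟩
  · rintro ⟨x, rfl⟩
    exact ⟨_, presAction_quot x⟩

theorem piDual_dualWord_mem_range (l : List BGen) : piDual (dualWord l) ∈ presAction.range := by
  induction l with
  | nil => exact ⟨1, by rw [dualWord, piDual_counit]; exact map_one _⟩
  | cons g l ih =>
    cases g with
    | H =>
      rw [dualWord, piDual_piDual]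
      exact Subalgebra.mul_mem _ ⟨presGen .Hb, presAction_presGen _⟩ ih
    | D =>
      rw [dualWord, piDual_piDual]
      exact Subalgebra.mul_mem _ ⟨presGen .Db, presAction_presGen _⟩ ih

theorem piA_mem_range (a : Uh) : piA a ∈ presAction.range := by
  rw [range_presAction]
  have h := (isHSum_coeff a).map_algHom (E := Module.End Ch UhDual) piAHom
  have hb : ∀ n, piAHom (const (coeff n a)) ∈ seriesAction.range := fun n => by
    rw [← range_presAction]
    exact ⟨presUB (coeff n a), presAction_presUB _⟩
  have h' := mem_range_of_isHSum (E := Module.End Ch UhDual) seriesAction hb h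
  exact h'

theorem piDual_mem_range {x : UhDual} (hx : x ∈ queDual) : piDual x ∈ presAction.range := by
  obtain ⟨c, hc, hx⟩ := hx
  rw [range_presAction]
  have h := IsHSum.map_end (A := UhDual) (E := UhDual) hx piDualHom
  have hb : ∀ n, piDualHom (c n) ∈ seriesAction.range := fun n => by
    have hle : Submodule.span Ch (Set.range dualWord)
        ≤ (Subalgebra.toSubmodule presAction.range).comap piDualHom := by
      refine Submodule.span_le.2 ?_
      rintro _ ⟨l, rfl⟩
      exact piDual_dualWord_mem_range l
    rw [← range_presAction]
    exact hle (hc n)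
  have h' := mem_range_of_isHSum (E := Module.End Ch UhDual) seriesAction hb h
  exact h'

theorem doubleInt_le_range : doubleInt ≤ presAction.range := by
  have hS : (Set.range piA ∪ piDual '' queDual) ⊆ (seriesAction.range : Set (Module.End Ch UhDual)) := by
    rw [← range_presAction]
    refine Set.union_subset ?_ ?_
    · rintro _ ⟨a, rfl⟩
      exact piA_mem_range a
    · rintro _ ⟨x, hx, rfl⟩
      exact piDual_mem_range hx
  have h := topAdjoin_le_range (E := Module.End Ch UhDual) seriesAction hS
  rw [range_presAction]
  exact h

/-- The presented algebra is the Heisenberg double over `ℂ[[h]]`. -/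
def presEquiv : PresInt ≃ₐ[Ch] doubleInt :=
  AlgEquiv.ofBijective (presAction.codRestrict doubleInt presAction_mem)
    ⟨fun _ _ h => presAction_injective (congrArg Subtype.val h), fun T => by
      obtain ⟨p, hp⟩ := doubleInt_le_range T.2
      exact ⟨p, Subtype.ext hp⟩⟩

theorem coe_presEquiv (p : PresInt) : (presEquiv p : Module.End Ch UhDual) = presAction p := rfl

theorem exists_double_equiv :
    ∃ (Φ : Pres ≃ₐ[ChField] Double) (φ : PresInt ≃ₐ[Ch] doubleInt),
      (∀ p : PresInt, Φ ((1 : ChField) ⊗ₜ[Ch] p) = (1 : ChField) ⊗ₜ[Ch] φ p) ∧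
      (φ (presGen HGen.H) : Module.End Ch UhDual) = piA hH ∧
      (φ (presGen HGen.D) : Module.End Ch UhDual) = piA hD ∧
      (φ (presGen HGen.Hb) : Module.End Ch UhDual) = piDual Hbar ∧
      (φ (presGen HGen.Db) : Module.End Ch UhDual) = piDual Dbar := by
  refine ⟨Algebra.TensorProduct.congr AlgEquiv.refl presEquiv, presEquiv, fun p => ?_, ?_⟩
  · simp
  · simp only [coe_presEquiv, presAction_presGen, and_self]

/-! ### Tensor powers -/

theorem HSer.coeff_mapAlg {M N : Type} [Ring M] [Algebra ℂ M] [Ring N] [Algebra ℂ N]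
    (f : M →ₐ[ℂ] N) (x : HSer M) (k : ℕ) : coeff k (mapAlg f x) = f (coeff k x) := by
  have h := (isHSum_iff _ _).1 ((isHSum_coeff x).map (mapAlg f).toLinearMap) k
  rw [AlgHom.toLinearMap_apply] at h
  rw [h, Finset.sum_eq_single (k, 0)]
  · rw [AlgHom.toLinearMap_apply, mapAlg_const, coeff_zero_const]
  · rintro ⟨a, b⟩ hab hne
    rw [AlgHom.toLinearMap_apply, mapAlg_const, coeff_const, if_neg]
    rintro rfl
    simp at hab
    exact hne (by simp [hab])
  · simp

section Legs

variable {n : ℕ}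

/-- The inclusion of the `i`-th tensor factor, on constants. -/
def singleIn (i : Fin n) : UB →ₐ[ℂ] ⨂[ℂ] _ : Fin n, UB :=
  PiTensorProduct.singleAlgHom (R := ℂ) (A := fun _ => UB) i

theorem singleIn_apply (i : Fin n) (u : UB) :
    singleIn i u = PiTensorProduct.tprod ℂ (Pi.mulSingle (M := fun _ : Fin n => UB) i u) := rfl

/-- The inclusion of the `i`-th tensor factor. -/
def legIn (i : Fin n) : Uh →ₐ[Ch] UhPow n := mapAlg (singleIn i)

/-- Pure tensors as constant series. -/
def pureTensor (t : Fin n → UB) : UhPow n := const (PiTensorProduct.tprod ℂ t)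

theorem legIn_const (i : Fin n) (u : UB) :
    legIn i (const u) = pureTensor (Pi.mulSingle i u) := mapAlg_const _ _

theorem pureTensor_mul (t t' : Fin n → UB) : pureTensor t * pureTensor t' = pureTensor (t * t') := by
  rw [pureTensor, pureTensor, ← const_mul, PiTensorProduct.tprod_mul_tprod]
  rfl

theorem pureTensor_one : pureTensor (1 : Fin n → UB) = 1 := const_one

theorem pow_hom_ext {E : Type} [AddCommGroup E] [Module Ch E] [HSeparated E]
    {f g : UhPow n →ₗ[Ch] E} (H : ∀ t, f (pureTensor t) = g (pureTensor t)) : f = g := by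
  refine hom_ext fun m => ?_
  induction m using PiTensorProduct.induction_on with
  | smul_tprod r t =>
    rw [smul_const', map_smul, map_smul]
    exact congrArg _ (H t)
  | add x y hx hy => rw [const_add, map_add, map_add, hx, hy]

theorem pureTensor_update (t : Fin n → UB) (i : Fin n) (u : UB) :
    pureTensor (Function.update t i 1) * legIn i (const u)
      = pureTensor (Function.update t i u) := by
  rw [legIn_const, pureTensor_mul]
  congr 1
  funext k
  by_cases h : k = i
  · subst h
    simp
  · simp [h]

theorem pureTensor_eq (t : Fin n → UB) (i : Fin n) :
    pureTensor (Function.update t i 1) * legIn i (const (t i)) = pureTensor t := by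
  rw [pureTensor_update, Function.update_eq_self]

theorem leg_pureTensor (i : Fin n) (T : Uh →ₗ[Ch] Uh) (t : Fin n → UB) :
    leg i T (pureTensor t) = pureTensor (Function.update t i 1) * legIn i (T (const (t i))) := by
  rw [leg, pureTensor, seriesMap_const]
  refine HSer.ext fun k => ?_
  rw [coeff_mk, pureTensor, coeff_const_mul, legIn, coeff_mapAlg, PiTensorProduct.map_tprod]
  rw [singleIn_apply, PiTensorProduct.tprod_mul_tprod]
  congr 1
  funext j
  by_cases h : j = i
  · subst h
    simp [coeff_mapCoeff]
  · simp [h]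

theorem leg_mul_legIn (i : Fin n) (T : Uh →ₗ[Ch] Uh) (t : Fin n → UB) (u : Uh) :
    leg i T (pureTensor (Function.update t i 1) * legIn i u)
      = pureTensor (Function.update t i 1) * legIn i (T u) := by
  have h : leg i T ∘ₗ LinearMap.mulLeft Ch (pureTensor (Function.update t i 1)) ∘ₗ
      (legIn i).toLinearMap
      = LinearMap.mulLeft Ch (pureTensor (Function.update t i 1)) ∘ₗ (legIn i).toLinearMap ∘ₗ T := by
    refine hom_ext fun v => ?_
    simp only [LinearMap.comp_apply, AlgHom.toLinearMap_apply, LinearMap.mulLeft_apply]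
    rw [pureTensor_update, leg_pureTensor]
    simp
  exact LinearMap.congr_fun h u

theorem leg_comp (i : Fin n) (S T : Uh →ₗ[Ch] Uh) : leg i (S ∘ₗ T) = leg i S ∘ₗ leg i T :=
  pow_hom_ext fun t => by
    rw [LinearMap.comp_apply, leg_pureTensor, leg_pureTensor, leg_mul_legIn]
    rfl

theorem leg_smul (i : Fin n) (c : Ch) (T : Uh →ₗ[Ch] Uh) : leg i (c • T) = c • leg i T :=
  pow_hom_ext fun t => by
    rw [LinearMap.smul_apply, leg_pureTensor, leg_pureTensor, LinearMap.smul_apply, map_smul,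
      mul_smul_comm]

theorem leg_id (i : Fin n) : leg i LinearMap.id = LinearMap.id :=
  pow_hom_ext fun t => by
    rw [leg_pureTensor]
    simp [pureTensor_eq]

theorem leg_rmul (i : Fin n) (a : Uh) : leg i (rmul a) = LinearMap.mulRight Ch (legIn i a) :=
  pow_hom_ext fun t => by
    rw [leg_pureTensor, rmul, LinearMap.mulRight_apply, LinearMap.mulRight_apply, map_mul,
      ← mul_assoc, pureTensor_eq]

theorem legIn_commute {i j : Fin n} (hij : i ≠ j) (a b : Uh) :
    legIn i a * legIn j b = legIn j b * legIn i a := by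
  have h1 : LinearMap.mulRight Ch (legIn j b) ∘ₗ (legIn i).toLinearMap
      = LinearMap.mulLeft Ch (legIn j b) ∘ₗ (legIn i).toLinearMap := by
    refine hom_ext fun u => ?_
    have h2 : LinearMap.mulLeft Ch (legIn i (const u)) ∘ₗ (legIn j).toLinearMap
        = LinearMap.mulRight Ch (legIn i (const u)) ∘ₗ (legIn j).toLinearMap := by
      refine hom_ext fun v => ?_
      simp only [LinearMap.comp_apply, AlgHom.toLinearMap_apply, LinearMap.mulLeft_apply,
        LinearMap.mulRight_apply]
      rw [legIn_const, legIn_const, pureTensor_mul, pureTensor_mul]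
      congr 1
      exact Pi.mulSingle_commute (f := fun _ => UB) hij u v
    exact LinearMap.congr_fun h2 b
  exact LinearMap.congr_fun h1 a

theorem update_mul_mulSingle {i j : Fin n} (hij : i ≠ j) (t : Fin n → UB) (v : UB) :
    Function.update (t * Pi.mulSingle j v) i 1 = Function.update t i 1 * Pi.mulSingle j v := by
  funext k
  by_cases h : k = i
  · subst h
    simp [hij]
  · simp [h]

theorem update_mulSingle_mul {i j : Fin n} (hij : i ≠ j) (t : Fin n → UB) (v : UB) :
    Function.update (Pi.mulSingle j v * t) i 1 = Pi.mulSingle j v * Function.update t i 1 := by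
  funext k
  by_cases h : k = i
  · subst h
    simp [hij]
  · simp [h]

/-- Two families of operators agree if they agree on pure tensors and constants. -/
theorem pow_uh_hom_ext {f g : UhPow n →ₗ[Ch] Uh →ₗ[Ch] UhPow n}
    (H : ∀ t v, f (pureTensor t) (const v) = g (pureTensor t) (const v)) : f = g :=
  pow_hom_ext fun t => hom_ext fun v => H t v

theorem leg_mul_legIn_of_ne {i j : Fin n} (hij : i ≠ j) (T : Uh →ₗ[Ch] Uh) (x : UhPow n) (a : Uh) :
    leg i T (x * legIn j a) = leg i T x * legIn j a := by
  have h : ((LinearMap.mul Ch (UhPow n)).compl₂ (legIn j).toLinearMap).compr₂ (leg i T)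
      = (LinearMap.mul Ch (UhPow n)).compl₁₂ (leg i T) (legIn j).toLinearMap := by
    refine pow_uh_hom_ext fun t v => ?_
    simp only [LinearMap.compr₂_apply, LinearMap.compl₂_apply, LinearMap.compl₁₂_apply,
      LinearMap.mul_apply', AlgHom.toLinearMap_apply]
    rw [legIn_const, pureTensor_mul, leg_pureTensor, leg_pureTensor, update_mul_mulSingle hij,
      ← pureTensor_mul, mul_assoc, ← legIn_const, legIn_commute hij.symm, ← mul_assoc]
    simp [hij]
  exact LinearMap.congr_fun (LinearMap.congr_fun h x) a

/-- The inclusion of `U_h ⊗ U_h` as the factors `i` and `j`. -/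
def pairIn {i j : Fin n} (hij : i ≠ j) : HSer (UB ⊗[ℂ] UB) →ₐ[Ch] UhPow n :=
  mapAlg (Algebra.TensorProduct.lift (singleIn i) (singleIn j) fun u v => by
      change singleIn i u * singleIn j v = singleIn j v * singleIn i u
      rw [singleIn_apply, singleIn_apply, PiTensorProduct.tprod_mul_tprod,
        PiTensorProduct.tprod_mul_tprod]
      congr 1
      exact Pi.mulSingle_commute (f := fun _ => UB) hij u v)

theorem pairIn_tmul {i j : Fin n} (hij : i ≠ j) (u v : UB) :
    pairIn hij (const (u ⊗ₜ v)) = legIn i (const u) * legIn j (const v) := by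
  rw [pairIn, mapAlg_const, Algebra.TensorProduct.lift_tmul, const_mul, legIn, legIn, mapAlg_const,
    mapAlg_const]

theorem pairIn_inLeft {i j : Fin n} (hij : i ≠ j) (a : Uh) :
    pairIn hij (inLeft a) = legIn i a := by
  have h : (pairIn hij).toLinearMap ∘ₗ inLeft.toLinearMap = (legIn i).toLinearMap := by
    refine hom_ext fun u => ?_
    simp only [LinearMap.comp_apply, AlgHom.toLinearMap_apply]
    rw [inLeft, mapAlg_const, Algebra.TensorProduct.includeLeft_apply, pairIn_tmul, const_one,
      map_one, mul_one]
  exact LinearMap.congr_fun h a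

theorem pairIn_inRight {i j : Fin n} (hij : i ≠ j) (a : Uh) :
    pairIn hij (inRight a) = legIn j a := by
  have h : (pairIn hij).toLinearMap ∘ₗ inRight.toLinearMap = (legIn j).toLinearMap := by
    refine hom_ext fun u => ?_
    simp only [LinearMap.comp_apply, AlgHom.toLinearMap_apply]
    rw [inRight, mapAlg_const, Algebra.TensorProduct.includeRight_apply, pairIn_tmul, const_one,
      map_one, one_mul]
  exact LinearMap.congr_fun h a

theorem pairIn_commute {i j k : Fin n} (hij : i ≠ j) (hik : k ≠ i) (hjk : k ≠ j)
    (w : HSer (UB ⊗[ℂ] UB)) (a : Uh) :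
    pairIn hij w * legIn k a = legIn k a * pairIn hij w := by
  have h : LinearMap.mulRight Ch (legIn k a) ∘ₗ (pairIn hij).toLinearMap
      = LinearMap.mulLeft Ch (legIn k a) ∘ₗ (pairIn hij).toLinearMap := by
    refine tensor_hom_ext fun u v => ?_
    simp only [LinearMap.comp_apply, AlgHom.toLinearMap_apply, LinearMap.mulLeft_apply,
      LinearMap.mulRight_apply]
    rw [pairIn_tmul, mul_assoc, ← legIn_commute hjk, ← mul_assoc, ← legIn_commute hik, mul_assoc]
  exact LinearMap.congr_fun h w

/-- The comultiplication into the factors `i` and `j`. -/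
def comulIn {i j : Fin n} (hij : i ≠ j) : Uh →ₐ[Ch] UhPow n := (pairIn hij).comp comulHom

theorem comulIn_hH {i j : Fin n} (hij : i ≠ j) : comulIn hij hH = legIn i hH + legIn j hH := by
  rw [comulIn, AlgHom.comp_apply, comulHom_hH, map_add, pairIn_inLeft, pairIn_inRight]

theorem comulIn_hD {i j : Fin n} (hij : i ≠ j) :
    comulIn hij hD = legIn j hD + legIn i hD * legIn j hE := by
  rw [comulIn, AlgHom.comp_apply, comulHom_hD, map_add, map_mul, pairIn_inLeft, pairIn_inRight,
    pairIn_inRight]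

theorem comulIn_hE {i j : Fin n} (hij : i ≠ j) : comulIn hij hE = legIn i hE * legIn j hE := by
  rw [comulIn, AlgHom.comp_apply, comulHom_hE, map_mul, pairIn_inLeft, pairIn_inRight]

/-! ### The predual of the canonical element -/

/-- `a ⊗ b ↦ (a ⊗ 1) Δ(b)` in the factors `i` and `j`, as a multilinear map on constants. -/
def fundMultilinear {i j : Fin n} (hij : i ≠ j) :
    MultilinearMap ℂ (fun _ : Fin n => UB) (UhPow n) where
  toFun t := pureTensor (Function.update t j 1) * comulIn hij (const (t j))
  map_update_add' {inst} t k u v := by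
    obtain rfl := Subsingleton.elim inst (instDecidableEqFin n)
    by_cases h : k = j
    · subst h
      simp [const_add, mul_add]
    · simp only [Function.update_of_ne (Ne.symm h), Function.update_comm h, pureTensor,
        MultilinearMap.map_update_add, const_add, add_mul]
  map_update_smul' {inst} t k c u := by
    obtain rfl := Subsingleton.elim inst (instDecidableEqFin n)
    by_cases h : k = j
    · subst h
      simp only [Function.update_self, Function.update_idem]
      rw [smul_const', map_smul, mul_smul_comm, algebraMap_smul]
    · simp only [Function.update_of_ne (Ne.symm h), Function.update_comm h, pureTensor,
        MultilinearMap.map_update_smul, smul_const', smul_mul_assoc, algebraMap_smul]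

/-- The operator `a ⊗ b ↦ (a ⊗ 1) Δ(b)` in the factors `i` and `j`. -/
def fund {i j : Fin n} (hij : i ≠ j) : UhPow n →ₗ[Ch] UhPow n :=
  seriesMap fun k => coeff k ∘ₗ PiTensorProduct.lift (fundMultilinear hij)

theorem fund_pureTensor {i j : Fin n} (hij : i ≠ j) (t : Fin n → UB) :
    fund hij (pureTensor t) = pureTensor (Function.update t j 1) * comulIn hij (const (t j)) := by
  rw [fund, pureTensor, seriesMap_const]
  refine HSer.ext fun k => ?_
  rw [coeff_mk, LinearMap.comp_apply, PiTensorProduct.lift.tprod]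
  rfl

theorem fund_one {i j : Fin n} (hij : i ≠ j) : fund hij 1 = 1 := by
  rw [← pureTensor_one, fund_pureTensor]
  simp [const_one]

theorem fund_mul_legIn {i j : Fin n} (hij : i ≠ j) (x : UhPow n) (a : Uh) :
    fund hij (x * legIn j a) = fund hij x * comulIn hij a := by
  have h : ((LinearMap.mul Ch (UhPow n)).compl₂ (legIn j).toLinearMap).compr₂ (fund hij)
      = (LinearMap.mul Ch (UhPow n)).compl₁₂ (fund hij) (comulIn hij).toLinearMap := by
    refine pow_uh_hom_ext fun t v => ?_
    simp only [LinearMap.compr₂_apply, LinearMap.compl₂_apply, LinearMap.compl₁₂_apply,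
      LinearMap.mul_apply', AlgHom.toLinearMap_apply]
    rw [legIn_const, pureTensor_mul, fund_pureTensor, fund_pureTensor, mul_assoc, ← map_mul,
      ← const_mul]
    congr 2
    · funext k
      by_cases h : k = j
      · subst h
        simp
      · simp [h]
    · simp
  exact LinearMap.congr_fun (LinearMap.congr_fun h x) a

theorem fund_mul_legIn_of_ne {i j k : Fin n} (hij : i ≠ j) (hki : k ≠ i) (hkj : k ≠ j)
    (x : UhPow n) (a : Uh) : fund hij (x * legIn k a) = fund hij x * legIn k a := by
  have h : ((LinearMap.mul Ch (UhPow n)).compl₂ (legIn k).toLinearMap).compr₂ (fund hij)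
      = (LinearMap.mul Ch (UhPow n)).compl₁₂ (fund hij) (legIn k).toLinearMap := by
    refine pow_uh_hom_ext fun t v => ?_
    simp only [LinearMap.compr₂_apply, LinearMap.compl₂_apply, LinearMap.compl₁₂_apply,
      LinearMap.mul_apply', AlgHom.toLinearMap_apply]
    rw [legIn_const, pureTensor_mul, fund_pureTensor, fund_pureTensor,
      update_mul_mulSingle hkj.symm, ← pureTensor_mul, mul_assoc, mul_assoc, ← legIn_const,
      comulIn, AlgHom.comp_apply, AlgHom.comp_apply, pairIn_commute hij hki hkj]
    simp [hkj.symm]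
  exact LinearMap.congr_fun (LinearMap.congr_fun h x) a

theorem fund_legIn_mul {i j k : Fin n} (hij : i ≠ j) (hkj : k ≠ j) (x : UhPow n) (a : Uh) :
    fund hij (legIn k a * x) = legIn k a * fund hij x := by
  have h : ((LinearMap.mul Ch (UhPow n)).flip.compl₂ (legIn k).toLinearMap).compr₂ (fund hij)
      = (LinearMap.mul Ch (UhPow n)).flip.compl₁₂ (fund hij) (legIn k).toLinearMap := by
    refine pow_uh_hom_ext fun t v => ?_
    simp only [LinearMap.compr₂_apply, LinearMap.compl₂_apply, LinearMap.compl₁₂_apply,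
      LinearMap.mul_apply', AlgHom.toLinearMap_apply, LinearMap.flip_apply]
    rw [legIn_const, pureTensor_mul, fund_pureTensor, fund_pureTensor,
      update_mulSingle_mul hkj.symm, ← pureTensor_mul, mul_assoc]
    simp [hkj.symm]
  exact LinearMap.congr_fun (LinearMap.congr_fun h x) a

/-- `a ⊗ x` acting on the factors `i` and `j`, as the predual of `π_A(a)_i π_{A^*}(x)_j`. -/
def pairOp (i j : Fin n) (a : Uh) (x : UhDual) : UhPow n →ₗ[Ch] UhPow n :=
  leg j (contract x) ∘ₗ leg i (rmul a)

theorem pairOp_apply {i j : Fin n} (hij : i ≠ j) (a : Uh) (x : UhDual) (t : UhPow n) :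
    pairOp i j a x t = leg j (contract x) t * legIn i a := by
  rw [pairOp, LinearMap.comp_apply, leg_rmul, LinearMap.mulRight_apply,
    leg_mul_legIn_of_ne hij.symm]

theorem HasHSum.pairIn {ι : Type} {i j : Fin n} (hij : i ≠ j) {e : ι → Uh} {e' : ι → UhDual}
    (H : IsDualBasis e e') (w : HSer (UB ⊗[ℂ] UB)) :
    HasHSum (fun c => legIn i (e c) * legIn j (pairLeft (e' c) w)) (pairIn hij w) := by
  change HasHSum (fun c => (LinearMap.mulLeft Ch (legIn i (e c)) ∘ₗ (legIn j).toLinearMap ∘ₗ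
    pairLeft (e' c)) w) ((HeisenbergDouble.pairIn hij).toLinearMap w)
  refine hasHSum_of_isHSum (isHSum_coeff w) fun k => ?_
  generalize coeff k w = m
  induction m using TensorProduct.induction_on with
  | zero => simpa [const_zero] using HasHSum.zero
  | tmul u v =>
    have h : HasHSum (fun c => e' c (const u) • e c) (const u) := H.2.2 (const u)
    have h' := h.map (LinearMap.mulRight Ch (legIn j (const v)) ∘ₗ (legIn i).toLinearMap)
    simp only [LinearMap.comp_apply, AlgHom.toLinearMap_apply,
      LinearMap.mulRight_apply, map_smul] at h'
    simp only [LinearMap.comp_apply, AlgHom.toLinearMap_apply, LinearMap.mulLeft_apply,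
      pairLeft_tmul, pairIn_tmul, map_smul]
    exact h'
  | add x y hx hy =>
    simp only [const_add, map_add]
    exact hx.add hy

theorem hasHSum_of_pureTensor {ι E : Type} [AddCommGroup E] [Module Ch E]
    {T : ι → UhPow n →ₗ[Ch] E} {S : UhPow n →ₗ[Ch] E}
    (H : ∀ t, HasHSum (fun c => T c (pureTensor t)) (S (pureTensor t))) (x : UhPow n) :
    HasHSum (fun c => T c x) (S x) := by
  refine hasHSum_of_isHSum (isHSum_coeff x) fun k => ?_
  generalize coeff k x = m
  induction m using PiTensorProduct.induction_on with
  | smul_tprod r t =>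
    have h := (H t).map (algebraMap ℂ Ch r • (LinearMap.id : E →ₗ[Ch] E))
    simp only [smul_const', map_smul]
    exact h
  | add x y hx hy =>
    simp only [const_add, map_add]
    exact hx.add hy

theorem hasHSum_fund {ι : Type} {i j : Fin n} (hij : i ≠ j) {e : ι → Uh} {e' : ι → UhDual}
    (H : IsDualBasis e e') (x : UhPow n) :
    HasHSum (fun c => pairOp i j (e c) (e' c) x) (fund hij x) := by
  refine hasHSum_of_pureTensor (fun t => ?_) x
  have h := (HasHSum.pairIn hij H (comulHom (const (t j)))).map
    (LinearMap.mulLeft Ch (pureTensor (Function.update t j 1)))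
  rw [fund_pureTensor]
  convert h using 2 with c
  · rw [pairOp_apply hij, leg_pureTensor, LinearMap.mulLeft_apply, mul_assoc, legIn_commute hij]
    rfl
  · rfl

end Legs

/-! ### The pentagon equation -/

section Pentagon

theorem fund_mul_pairIn {n : ℕ} {i j k l : Fin n} (hij : i ≠ j) (hkl : k ≠ l) (hk : k ≠ j)
    (hl : l ≠ j) (x : UhPow n) (w : HSer (UB ⊗[ℂ] UB)) :
    fund hij (pairIn hkl w * x) = pairIn hkl w * fund hij x := by
  have h : fund hij ∘ₗ LinearMap.mulRight Ch x ∘ₗ (pairIn hkl).toLinearMap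
      = LinearMap.mulRight Ch (fund hij x) ∘ₗ (pairIn hkl).toLinearMap := by
    refine tensor_hom_ext fun u v => ?_
    simp only [LinearMap.comp_apply, AlgHom.toLinearMap_apply, LinearMap.mulRight_apply]
    rw [pairIn_tmul, mul_assoc, fund_legIn_mul hij hk, fund_legIn_mul hij hl, mul_assoc]
  exact LinearMap.congr_fun h w

theorem fund_pentagon {n : ℕ} {i j k : Fin n} (hij : i ≠ j) (hik : i ≠ k) (hjk : j ≠ k)
    (x₀ : UhPow n)
    (h₀ : fund hjk (fund hik (fund hij x₀)) = fund hij (fund hjk x₀)) (c : Uh) :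
    fund hjk (fund hik (fund hij (x₀ * legIn k c))) = fund hij (fund hjk (x₀ * legIn k c)) := by
  have h : fund hjk ∘ₗ fund hik ∘ₗ fund hij ∘ₗ LinearMap.mulLeft Ch x₀ ∘ₗ (legIn k).toLinearMap
      = fund hij ∘ₗ fund hjk ∘ₗ LinearMap.mulLeft Ch x₀ ∘ₗ (legIn k).toLinearMap := by
    refine uh_hom_ext_right (κ := Unit) (f := fun _ => fund hjk ∘ₗ fund hik ∘ₗ fund hij ∘ₗ
      LinearMap.mulLeft Ch x₀ ∘ₗ (legIn k).toLinearMap) (g := fun _ => fund hij ∘ₗ fund hjk ∘ₗ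
      LinearMap.mulLeft Ch x₀ ∘ₗ (legIn k).toLinearMap) ?_ ?_ ?_ ()
    · simp [h₀]
    · intro b hb _
      have hb := hb ()
      simp only [LinearMap.comp_apply, AlgHom.toLinearMap_apply, LinearMap.mulLeft_apply] at hb ⊢
      rw [map_mul (legIn k), ← mul_assoc]
      generalize x₀ * legIn k b = y at hb ⊢
      rw [fund_mul_legIn_of_ne hij hik.symm hjk.symm, fund_mul_legIn, fund_mul_legIn, comulIn_hH,
        comulIn_hH, mul_add, mul_add, map_add, map_add, fund_mul_legIn_of_ne hjk hij hik,
        fund_mul_legIn, fund_mul_legIn, fund_mul_legIn_of_ne hij hik.symm hjk.symm, hb, comulIn_hH,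
        comulIn_hH]
      simp only [mul_add]
      abel
    · intro b hb _
      have hb := hb ()
      simp only [LinearMap.comp_apply, AlgHom.toLinearMap_apply, LinearMap.mulLeft_apply] at hb ⊢
      rw [map_mul (legIn k), ← mul_assoc]
      generalize x₀ * legIn k b = y at hb ⊢
      rw [fund_mul_legIn_of_ne hij hik.symm hjk.symm, fund_mul_legIn, fund_mul_legIn, comulIn_hD,
        comulIn_hD, mul_add, mul_add, map_add, map_add, ← mul_assoc, ← mul_assoc, fund_mul_legIn,
        fund_mul_legIn, fund_mul_legIn_of_ne hjk hij hik,
        fund_mul_legIn_of_ne hij hik.symm hjk.symm, fund_mul_legIn_of_ne hij hik.symm hjk.symm,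
        fund_mul_legIn, hb, comulIn_hD, comulIn_hD, comulIn_hE]
      simp only [mul_add, add_mul, mul_assoc]
      abel
  exact LinearMap.congr_fun h c

theorem fund_pentagon_three :
    fund (n := 3) (i := 1) (j := 2) (by decide) ∘ₗ fund (i := 0) (j := 2) (by decide) ∘ₗ
        fund (i := 0) (j := 1) (by decide)
      = fund (i := 0) (j := 1) (by decide) ∘ₗ fund (i := 1) (j := 2) (by decide) := by
  refine pow_hom_ext fun t => ?_
  have ht : pureTensor t
      = legIn 0 (const (t 0)) * legIn 1 (const (t 1)) * legIn 2 (const (t 2)) := by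
    rw [legIn_const, legIn_const, legIn_const, pureTensor_mul, pureTensor_mul]
    congr 1
    funext k
    fin_cases k <;> simp
  rw [ht]
  refine fund_pentagon (by decide) (by decide) (by decide) _ ?_ _
  have h1 : fund (n := 3) (i := 0) (j := 1) (by decide)
      (legIn 0 (const (t 0)) * legIn 1 (const (t 1)))
      = legIn 0 (const (t 0)) * comulIn (i := 0) (j := 1) (by decide) (const (t 1)) := by
    rw [fund_mul_legIn, ← mul_one (legIn 0 _), fund_legIn_mul _ (by decide), fund_one]
  have h2 : ∀ {i : Fin 3} (hi : i ≠ 2) (a : Uh) (w : HSer (UB ⊗[ℂ] UB)),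
      fund hi (legIn 0 a * pairIn (i := 0) (j := 1) (by decide) w)
        = legIn 0 a * pairIn (i := 0) (j := 1) (by decide) w := by
    intro i hi a w
    rw [fund_legIn_mul _ (by decide), ← mul_one (pairIn _ w),
      fund_mul_pairIn hi _ (by decide) (by decide), fund_one]
  have h3 : fund (n := 3) (i := 1) (j := 2) (by decide)
      (legIn 0 (const (t 0)) * legIn 1 (const (t 1)))
      = legIn 0 (const (t 0)) * legIn 1 (const (t 1)) := by
    rw [← pairIn_tmul (by decide : (0 : Fin 3) ≠ 1), ← mul_one (pairIn _ _),
      fund_mul_pairIn _ _ (by decide) (by decide), fund_one]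
  rw [h3, h1]
  rw [comulIn, AlgHom.comp_apply, h2, h2]

end Pentagon

/-! ### Locally finite sums of operators -/

section LocallyFinite

variable {M N : Type} [Ring M] [Algebra ℂ M] [Ring N] [Algebra ℂ N] {ι : Type}

/-- The sum of a family of operators of which only finitely many are nonzero on each constant. -/
def locSum (S : ι → HSer M →ₗ[Ch] HSer N)
    (H : ∀ m, ∃ A : Finset ι, ∀ c, c ∉ A → S c (const m) = 0) : HSer M →ₗ[Ch] HSer N :=
  seriesMap fun k =>
    { toFun := fun m => ∑ᶠ c, mapCoeff (S c) k m
      map_add' := fun u v => by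
        have hf : ∀ m, (Function.support fun c => mapCoeff (S c) k m).Finite := fun m => by
          obtain ⟨A, hA⟩ := H m
          refine A.finite_toSet.subset fun c hc => ?_
          by_contra h
          exact hc (by
            change mapCoeff (S c) k m = 0
            rw [coeff_mapCoeff, hA c h, map_zero])
        simp only [map_add]
        exact finsum_add_distrib (hf u) (hf v)
      map_smul' := fun r u => by
        simp only [map_smul, RingHom.id_apply]
        exact (smul_finsum r _).symm }

theorem locSum_const (S : ι → HSer M →ₗ[Ch] HSer N)
    (H : ∀ m, ∃ A : Finset ι, ∀ c, c ∉ A → S c (const m) = 0) {m : M} {A : Finset ι}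
    (hA : ∀ c, c ∉ A → S c (const m) = 0) :
    locSum S H (const m) = ∑ c ∈ A, S c (const m) := by
  rw [locSum, seriesMap_const]
  refine HSer.ext fun k => ?_
  rw [coeff_mk, map_sum]
  refine finsum_eq_sum_of_support_subset _ fun c hc => ?_
  by_contra h
  exact hc (by
    change mapCoeff (S c) k m = 0
    rw [coeff_mapCoeff, hA c h, map_zero])

theorem hasHSum_locSum (S : ι → HSer M →ₗ[Ch] HSer N)
    (H : ∀ m, ∃ A : Finset ι, ∀ c, c ∉ A → S c (const m) = 0) (x : HSer M) :
    HasHSum (fun c => S c x) (locSum S H x) := by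
  refine hasHSum_of_isHSum (isHSum_coeff x) fun k => ?_
  obtain ⟨A, hA⟩ := H (coeff k x)
  rw [locSum_const S H hA]
  exact hasHSum_of_finite _ A hA

/-- Two sums `∑ Sₗ` and `∑ Tₙ` with `Sₗ Tₙ` a multiple of `Uₗ₊ₙ` compose to the identity if the
diagonal sums of the coefficients are those of the identity. -/
theorem comp_eq_id_of_diagonal {S T U : ℕ → HSer M →ₗ[Ch] HSer M} {σ τ : HSer M →ₗ[Ch] HSer M}
    (hS : ∀ x, HasHSum (fun c => S c x) (σ x)) (hT : ∀ x, HasHSum (fun c => T c x) (τ x))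
    (d : ℕ → ℕ → Ch) (hd : ∀ l n, S l ∘ₗ T n = d l n • U (l + n))
    (hfin : ∀ m, ∃ K, ∀ k, K ≤ k → U k (const m) = 0 ∧ T k (const m) = 0)
    (hU : U 0 = LinearMap.id)
    (hdiag : ∀ k, ∑ l ∈ Finset.range (k + 1), d l (k - l) = if k = 0 then 1 else 0) :
    σ ∘ₗ τ = LinearMap.id := by
  refine hom_ext fun m => ?_
  obtain ⟨K, hK⟩ := hfin m
  replace hK : ∀ k, K + 1 ≤ k → U k (const m) = 0 ∧ T k (const m) = 0 := fun k hk =>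
    hK k (by omega)
  have hST : ∀ l n, S l (T n (const m)) = d l n • U (l + n) (const m) := fun l n =>
    LinearMap.congr_fun (hd l n) (const m)
  have h1 : τ (const m) = ∑ n ∈ Finset.range (K + 1), T n (const m) :=
    (hT (const m)).unique (hasHSum_of_finite _ _ fun n hn => (hK n (by simpa using hn)).2)
  have h2 : ∀ n, σ (T n (const m))
      = ∑ l ∈ Finset.range (K + 1), d l n • U (l + n) (const m) := fun n => by
    refine (hS (T n (const m))).unique ?_
    simp only [hST]
    refine hasHSum_of_finite _ _ fun l hl => ?_
    rw [(hK (l + n) (by simp at hl; omega)).1, smul_zero]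
  rw [LinearMap.comp_apply, h1, map_sum, LinearMap.id_apply]
  simp only [h2]
  rw [Finset.sum_comm]
  have h3 : ∀ l ∈ Finset.range (K + 1),
      ∑ n ∈ Finset.range (K + 1), d l n • U (l + n) (const m)
        = ∑ n ∈ Finset.range (K + 1 - l), d l n • U (l + n) (const m) := fun l _ => by
    refine (Finset.sum_subset (Finset.range_mono (by omega)) fun n _ hn => ?_).symm
    rw [(hK (l + n) (by simp at hn; omega)).1, smul_zero]
  rw [Finset.sum_congr rfl h3,
    ← Finset.sum_range_diag_flip (K + 1) fun l n => d l n • U (l + n) (const m)]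
  have h4 : ∀ k ∈ Finset.range (K + 1),
      ∑ l ∈ Finset.range (k + 1), d l (k - l) • U (l + (k - l)) (const m)
        = if k = 0 then const m else 0 := fun k _ => by
    have h5 : ∀ l ∈ Finset.range (k + 1), d l (k - l) • U (l + (k - l)) (const m)
        = d l (k - l) • U k (const m) := fun l hl => by
      rw [Nat.add_sub_cancel' (by simp at hl; omega)]
    rw [Finset.sum_congr rfl h5, ← Finset.sum_smul, hdiag]
    split_ifs with hk
    · rw [hk, hU, one_smul, LinearMap.id_apply]
    · rw [zero_smul]
  rw [Finset.sum_congr rfl h4]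
  simp

end LocallyFinite

/-! ### Operators on the dual of the tensor powers -/

section DualOp

variable {n : ℕ}

/-- The transpose of an operator on the tensor power. -/
def dualOp (T : UhPow n →ₗ[Ch] UhPow n) : Module.End ChField (DualPow n) :=
  T.dualMap.baseChange ChField

theorem dualOp_comp (S T : UhPow n →ₗ[Ch] UhPow n) : dualOp (S ∘ₗ T) = dualOp T * dualOp S := by
  rw [dualOp, ← LinearMap.dualMap_comp_dualMap, LinearMap.baseChange_comp]
  rfl

theorem dualOp_id : dualOp (LinearMap.id : UhPow n →ₗ[Ch] UhPow n) = 1 := by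
  rw [dualOp, LinearMap.dualMap_id, LinearMap.baseChange_id]
  rfl

theorem dualOp_smul (c : Ch) (T : UhPow n →ₗ[Ch] UhPow n) :
    dualOp (c • T) = algebraMap Ch ChField c • dualOp T := by
  have h : (c • T).dualMap = c • T.dualMap :=
    LinearMap.ext fun f => LinearMap.ext fun x => by simp
  rw [dualOp, h]
  refine LinearMap.ext fun f => ?_
  rw [LinearMap.smul_apply, algebraMap_smul]
  exact LinearMap.congr_fun (LinearMap.baseChange_smul c T.dualMap) f

theorem smul_dualOp_smul (b : ChField) (c : Ch) (T : UhPow n →ₗ[Ch] UhPow n) :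
    b • dualOp (c • T) = (b * algebraMap Ch ChField c) • dualOp T := by
  rw [dualOp_smul]
  exact smul_smul b _ (dualOp T)

theorem dualOp_pow (T : Module.End Ch (UhPow n)) (m : ℕ) : dualOp (T ^ m) = dualOp T ^ m := by
  induction m with
  | zero => exact dualOp_id
  | succ m ih => rw [pow_succ, pow_succ', ← ih]; exact dualOp_comp _ _

theorem actA_mul_actDual (i j : Fin n) (a : Uh) (x : UhDual) :
    actA i a * actDual j x = dualOp (pairOp i j a x) := (dualOp_comp _ _).symm

theorem evalAt_dualOp_tmul (t : UhPow n) (T : UhPow n →ₗ[Ch] UhPow n) (a : ChField)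
    (y : Module.Dual Ch (UhPow n)) : evalAt t (dualOp T (a ⊗ₜ y)) = algebraMap Ch ChField (y (T t)) * a :=
  (TensorProduct.AlgebraTensorModule.rid_tmul (R := Ch) (A := ChField) (y (T t)) a).trans
    (Algebra.smul_def (A := ChField) (y (T t)) a)

theorem coeff_X_pow_mul_mul (a : ChField) (N : ℕ) (c : Ch) {k : ℤ} (hk : k < N + a.order) :
    HahnSeries.coeff (algebraMap Ch ChField ((PowerSeries.X : Ch) ^ N * c) * a) k = 0 := by
  have h1 := LaurentSeries.single_order_mul_powerSeriesPart a
  rw [← h1, mul_left_comm, LaurentSeries.coe_algebraMap,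
    show ((a.powerSeriesPart : Ch) : ChField) = HahnSeries.ofPowerSeries ℤ ℂ _ from rfl, ← map_mul,
    HahnSeries.coeff_single_mul, one_mul, mul_assoc]
  rw [PowerSeries.coeff_coe]
  split_ifs with h
  · rfl
  · rw [PowerSeries.coeff_X_pow_mul', if_neg (by omega)]

theorem IsLaurentSum.zero {ι : Type} : IsLaurentSum (fun _ : ι => 0) 0 :=
  fun _ => ⟨∅, fun _ _ _ _ => by simp⟩

theorem IsLaurentSum.add {ι : Type} {c d : ι → ChField} {s t : ChField} (hs : IsLaurentSum c s)
    (ht : IsLaurentSum d t) : IsLaurentSum (fun i => c i + d i) (s + t) := by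
  classical
  intro N
  obtain ⟨A, hA⟩ := hs N
  obtain ⟨B, hB⟩ := ht N
  refine ⟨A ∪ B, fun F hF k hk => ?_⟩
  rw [Finset.sum_add_distrib, add_sub_add_comm, HahnSeries.coeff_add,
    hA F (Finset.union_subset_left hF) k hk, hB F (Finset.union_subset_right hF) k hk, add_zero]

theorem HasHSum.isLaurentSum {ι : Type} {c : ι → Ch} {s : Ch} (H : HasHSum c s) (a : ChField) :
    IsLaurentSum (fun i => algebraMap Ch ChField (c i) * a) (algebraMap Ch ChField s * a) := by
  intro N
  obtain ⟨A, hA⟩ := H (N - a.order).toNat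
  refine ⟨A, fun F hF k hk => ?_⟩
  obtain ⟨z, rfl⟩ := hA F hF
  beta_reduce
  rw [← Finset.sum_mul, ← sub_mul, ← map_sum, ← map_sub, add_sub_cancel_left, smul_eq_mul]
  exact coeff_X_pow_mul_mul a _ z (by omega)

theorem isOpSum_dualOp {ι : Type} {S : ι → UhPow n →ₗ[Ch] UhPow n} {T : UhPow n →ₗ[Ch] UhPow n}
    (H : ∀ x, HasHSum (fun c => S c x) (T x)) : IsOpSum (fun c => dualOp (S c)) (dualOp T) := by
  intro f t
  induction f using TensorProduct.induction_on with
  | zero => simpa using IsLaurentSum.zero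
  | tmul a y =>
    simp only [evalAt_dualOp_tmul]
    exact ((H t).map y).isLaurentSum a
  | add f g hf hg =>
    simp only [map_add]
    exact hf.add hg

end DualOp

/-! ### The exponential and the `q`-dilogarithm -/

theorem exists_contract_uhCoord_eq_zero (u : UB) :
    ∃ K, ∀ p : ℕ × ℕ, (K ≤ p.1 ∨ K ≤ p.2) → contract (uhCoord p) (const u) = 0 := by
  have hu : u ∈ Submodule.span ℂ (Set.range ubMonomial) := by
    rw [span_ubMonomial]
    trivial
  induction hu using Submodule.span_induction with
  | mem x hx =>
    obtain ⟨⟨a, b⟩, rfl⟩ := hx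
    refine ⟨a + b + 1, fun ⟨m, n⟩ h => contract_uhCoord_eq_zero ?_⟩
    simp only at h
    omega
  | zero => exact ⟨0, fun p _ => by rw [const_zero, map_zero]⟩
  | add x y _ _ hx hy =>
    obtain ⟨K, hK⟩ := hx
    obtain ⟨L, hL⟩ := hy
    refine ⟨max K L, fun p hp => ?_⟩
    rw [const_add, map_add, hK p (by omega), hL p (by omega), add_zero]
  | smul r x _ hx =>
    obtain ⟨K, hK⟩ := hx
    exact ⟨K, fun p hp => by rw [smul_const', map_smul, hK p hp, smul_zero]⟩

section Formula

variable {n : ℕ} {i j : Fin n}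

theorem exists_pairOp_eq_zero (hij : i ≠ j) (m : ⨂[ℂ] _ : Fin n, UB) :
    ∃ K, ∀ p : ℕ × ℕ, (K ≤ p.1 ∨ K ≤ p.2) → ∀ a, pairOp i j a (uhCoord p) (const m) = 0 := by
  induction m using PiTensorProduct.induction_on with
  | smul_tprod r t =>
    obtain ⟨K, hK⟩ := exists_contract_uhCoord_eq_zero (t j)
    refine ⟨K, fun p hp a => ?_⟩
    rw [smul_const', map_smul, pairOp_apply hij,
      show const (PiTensorProduct.tprod ℂ t) = pureTensor t from rfl, leg_pureTensor, hK p hp,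
      map_zero, mul_zero, zero_mul, smul_zero]
  | add x y hx hy =>
    obtain ⟨K, hK⟩ := hx
    obtain ⟨L, hL⟩ := hy
    refine ⟨max K L, fun p hp a => ?_⟩
    rw [const_add, map_add, hK p (by omega), hL p (by omega), add_zero]

theorem pairOp_comp (hij : i ≠ j) (a b : Uh) (x y : UhDual) :
    pairOp i j a x ∘ₗ pairOp i j b y = pairOp i j (b * a) (piDual y x) :=
  LinearMap.ext fun t => by
    rw [LinearMap.comp_apply, pairOp_apply hij, pairOp_apply hij, pairOp_apply hij,
      leg_mul_legIn_of_ne hij.symm, ← contract_comp_contract, leg_comp, map_mul, mul_assoc]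
    rfl

theorem pairOp_smul (a : Uh) (c : Ch) (x : UhDual) : pairOp i j a (c • x) = c • pairOp i j a x := by
  rw [pairOp, pairOp, contract_smul, leg_smul, LinearMap.smul_comp]

theorem pairOp_one_counit : pairOp i j 1 (uhCoord (0, 0)) = LinearMap.id := by
  have h1 : contract (uhCoord (0, 0)) = LinearMap.id := by
    rw [← counit_eq, contract_counit]
  have h2 : rmul 1 = LinearMap.id := LinearMap.mulRight_one Ch Uh
  rw [pairOp, h1, h2, leg_id, leg_id, LinearMap.comp_id]

theorem uhCoord_zero_hE_pow_mul (l k : ℕ) (c : Uh) :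
    uhCoord (0, l) (hE ^ k * c) = uhCoord (0, l) c := by
  induction k with
  | zero => rw [pow_zero, one_mul]
  | succ k ih => rw [pow_succ', mul_assoc, uhCoord_zero_hE_mul, ih]

theorem uhCoord_zero_hD_pow (l k : ℕ) : uhCoord (0, l) (hD ^ k) = if k = l then 1 else 0 := by
  have h := uhCoord_ubMonomial (0, l) (0, k)
  rw [const_ubMonomial, pow_zero, one_mul] at h
  rw [h]
  simp

theorem piDual_uhCoord_zero (m n : ℕ) : piDual (uhCoord (m, 0)) (uhCoord (0, n)) = uhCoord (m, n) :=
  uh_hom_ext fun ⟨a, b⟩ => by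
    rw [piDual_apply, contract_uhCoord, map_smul, pow_zero, mul_one, Nat.sub_zero, gauss_zero_right,
      mul_one, uhCoord_zero_hH_pow_mul, uhCoord_zero_hD_pow, uhCoord_ubMonomial, smul_eq_mul]
    rcases lt_trichotomy a m with h | h | h
    · simp [Nat.choose_eq_zero_of_lt h, h.ne]
    · simp [h]
    · simp [Nat.sub_ne_zero_of_lt h, h.ne']

theorem piDual_uhCoord_uhCoord (n l : ℕ) :
    piDual (uhCoord (0, n)) (uhCoord (0, l)) = gauss (l + n) n • uhCoord (0, l + n) :=
  uh_hom_ext fun ⟨a, b⟩ => by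
    rw [piDual_apply, contract_uhCoord, map_smul, Nat.sub_zero, Nat.choose_zero_right, Nat.cast_one,
      one_mul, mul_assoc, uhCoord_zero_hH_pow_mul, uhCoord_zero_hE_pow_mul, uhCoord_zero_hD_pow,
      LinearMap.smul_apply, uhCoord_ubMonomial, smul_eq_mul, smul_eq_mul]
    by_cases ha : a = 0
    · by_cases hb : b = l + n
      · simp [ha, hb]
      · by_cases hn : b < n
        · simp [gauss_eq_zero hn, hb]
        · simp [ha, hb, show ¬b - n = l by omega]
    · simp [ha]

theorem gauss_symm {b k : ℕ} (h : k ≤ b) : gauss b (b - k) = gauss b k := by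
  have h1 := qFact_mul_gauss b k h
  have h2 := qFact_mul_gauss b (b - k) (Nat.sub_le _ _)
  rw [Nat.sub_sub_self h, mul_comm (qFact (b - k)), ← h1] at h2
  exact mul_left_cancel₀ (mul_ne_zero (qFact_ne_zero _) (qFact_ne_zero _)) h2

/-- The coefficients `(-1)^l q^{l(l-1)/2}`. -/
def dilogSign (l : ℕ) : Ch := q ^ (l * (l - 1) / 2) * (-1) ^ l

theorem sum_dilogSign_mul_gauss (k : ℕ) :
    ∑ l ∈ Finset.range (k + 1), dilogSign l * gauss k l = if k = 0 then 1 else 0 := by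
  have h := sum_gauss 1 k
  simp only [dilogSign]
  rw [h]
  split_ifs with hk
  · simp [hk]
  · exact Finset.prod_eq_zero (Finset.mem_range.2 (Nat.pos_of_ne_zero hk)) (by simp)

/-- The terms of the exponential. -/
def expTerm (i j : Fin n) (m : ℕ) : UhPow n →ₗ[Ch] UhPow n := pairOp i j (hH ^ m) (uhCoord (m, 0))

/-- The terms of the inverse `q`-dilogarithm. -/
def dilogTerm (i j : Fin n) (m : ℕ) : UhPow n →ₗ[Ch] UhPow n := pairOp i j (hD ^ m) (uhCoord (0, m))

theorem pairOp_hH_pow (hij : i ≠ j) (m : ℕ) :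
    (pairOp i j hH Hbar : Module.End Ch (UhPow n)) ^ m = (m.factorial : Ch) • expTerm i j m := by
  induction m with
  | zero =>
    rw [pow_zero, Nat.factorial_zero, Nat.cast_one, one_smul, expTerm, pow_zero, pairOp_one_counit]
    rfl
  | succ m ih =>
    rw [pow_succ, ih, Module.End.mul_eq_comp, LinearMap.smul_comp, expTerm, pairOp_comp hij,
      piDual_Hbar_uhCoord, pairOp_smul, smul_smul, ← pow_succ', expTerm, Nat.factorial_succ,
      Nat.cast_mul, mul_comm]

theorem pairOp_hD_pow (hij : i ≠ j) (m : ℕ) :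
    (pairOp i j hD Dbar : Module.End Ch (UhPow n)) ^ m = qFact m • dilogTerm i j m := by
  induction m with
  | zero =>
    rw [pow_zero, qFact, Finset.prod_range_zero, one_smul, dilogTerm, pow_zero, pairOp_one_counit]
    rfl
  | succ m ih =>
    rw [pow_succ, ih, Module.End.mul_eq_comp, LinearMap.smul_comp, dilogTerm, pairOp_comp hij,
      piDual_Dbar_uhCoord, pairOp_smul, smul_smul, ← pow_succ', dilogTerm, qFact_succ]

theorem dilogTerm_comp_dilogTerm (hij : i ≠ j) (l m : ℕ) :
    dilogTerm i j l ∘ₗ dilogTerm i j m = gauss (l + m) m • dilogTerm i j (l + m) := by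
  rw [dilogTerm, dilogTerm, pairOp_comp hij, piDual_uhCoord_uhCoord, pairOp_smul, ← pow_add,
    add_comm m, dilogTerm]

theorem dilogTerm_comp_expTerm (hij : i ≠ j) (m l : ℕ) :
    dilogTerm i j l ∘ₗ expTerm i j m = pairOp i j (hH ^ m * hD ^ l) (uhCoord (m, l)) := by
  rw [dilogTerm, expTerm, pairOp_comp hij, piDual_uhCoord_zero]

theorem exists_expTerm_eq_zero (hij : i ≠ j) (m : ⨂[ℂ] _ : Fin n, UB) :
    ∃ A : Finset ℕ, ∀ k, k ∉ A → expTerm i j k (const m) = 0 := by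
  obtain ⟨K, hK⟩ := exists_pairOp_eq_zero hij m
  exact ⟨Finset.range K, fun k hk => hK (k, 0) (Or.inl (by simpa using hk)) _⟩

theorem exists_dilogTerm_eq_zero (hij : i ≠ j) (m : ⨂[ℂ] _ : Fin n, UB) :
    ∃ A : Finset ℕ, ∀ k, k ∉ A → dilogTerm i j k (const m) = 0 := by
  obtain ⟨K, hK⟩ := exists_pairOp_eq_zero hij m
  exact ⟨Finset.range K, fun k hk => hK (0, k) (Or.inr (by simpa using hk)) _⟩

/-- The predual of the exponential. -/
def expOp (hij : i ≠ j) : UhPow n →ₗ[Ch] UhPow n :=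
  locSum (expTerm i j) (exists_expTerm_eq_zero hij)

/-- The predual of the inverse `q`-dilogarithm. -/
def dilogInvOp (hij : i ≠ j) : UhPow n →ₗ[Ch] UhPow n :=
  locSum (dilogTerm i j) (exists_dilogTerm_eq_zero hij)

/-- The predual of the `q`-dilogarithm. -/
def dilogOp (hij : i ≠ j) : UhPow n →ₗ[Ch] UhPow n :=
  locSum (fun l => dilogSign l • dilogTerm i j l) fun m => by
    obtain ⟨A, hA⟩ := exists_dilogTerm_eq_zero hij m
    exact ⟨A, fun c hc => by rw [LinearMap.smul_apply, hA c hc, smul_zero]⟩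

theorem exists_dilogTerm_eq_zero_and (hij : i ≠ j) (m : ⨂[ℂ] _ : Fin n, UB) :
    ∃ K : ℕ, ∀ k, K ≤ k → dilogTerm i j k (const m) = 0 ∧
      ∀ c : Ch, (c • dilogTerm i j k) (const m) = 0 := by
  obtain ⟨K, hK⟩ := exists_pairOp_eq_zero hij m
  refine ⟨K, fun k hk => ?_⟩
  have h : dilogTerm i j k (const m) = 0 := hK (0, k) (Or.inr hk) _
  exact ⟨h, fun c => by rw [LinearMap.smul_apply, h, smul_zero]⟩

theorem dilogTerm_zero : dilogTerm i j 0 = LinearMap.id := by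
  rw [dilogTerm, pow_zero, pairOp_one_counit]

theorem dilogOp_comp_dilogInvOp (hij : i ≠ j) : dilogOp hij ∘ₗ dilogInvOp hij = LinearMap.id := by
  refine comp_eq_id_of_diagonal (U := dilogTerm i j) (hasHSum_locSum _ _) (hasHSum_locSum _ _)
    (fun l m => dilogSign l * gauss (l + m) m) (fun l m => ?_) (fun m => ?_) dilogTerm_zero
    fun k => ?_
  · rw [LinearMap.smul_comp, dilogTerm_comp_dilogTerm hij, smul_smul]
  · obtain ⟨K, hK⟩ := exists_dilogTerm_eq_zero_and hij m
    exact ⟨K, fun k hk => ⟨(hK k hk).1, (hK k hk).1⟩⟩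
  · rw [← sum_dilogSign_mul_gauss]
    refine Finset.sum_congr rfl fun l hl => ?_
    have hl' : l ≤ k := Nat.lt_succ_iff.1 (Finset.mem_range.1 hl)
    rw [Nat.add_sub_cancel' hl', gauss_symm hl']

theorem dilogInvOp_comp_dilogOp (hij : i ≠ j) : dilogInvOp hij ∘ₗ dilogOp hij = LinearMap.id := by
  refine comp_eq_id_of_diagonal (U := dilogTerm i j) (hasHSum_locSum _ _) (hasHSum_locSum _ _)
    (fun l m => dilogSign m * gauss (l + m) m) (fun l m => ?_) (fun m => ?_) dilogTerm_zero
    fun k => ?_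
  · rw [LinearMap.comp_smul, dilogTerm_comp_dilogTerm hij, smul_smul]
  · obtain ⟨K, hK⟩ := exists_dilogTerm_eq_zero_and hij m
    exact ⟨K, fun k hk => ⟨(hK k hk).1, (hK k hk).2 _⟩⟩
  · rw [← sum_dilogSign_mul_gauss, ← Finset.sum_range_reflect]
    refine Finset.sum_congr rfl fun l hl => ?_
    have hl' : l ≤ k := Nat.lt_succ_iff.1 (Finset.mem_range.1 hl)
    rw [show k + 1 - 1 - l = k - l by omega, Nat.sub_sub_self hl', Nat.sub_add_cancel hl']

theorem fund_eq (hij : i ≠ j) : fund hij = dilogInvOp hij ∘ₗ expOp hij := by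
  refine hom_ext fun m => ?_
  obtain ⟨K, hK⟩ := exists_pairOp_eq_zero hij m
  have h1 : expOp hij (const m) = ∑ k ∈ Finset.range K, expTerm i j k (const m) :=
    locSum_const _ _ fun k hk => hK (k, 0) (Or.inl (by simpa using hk)) _
  have h2 : ∀ k, dilogInvOp hij (expTerm i j k (const m))
      = ∑ l ∈ Finset.range K, pairOp i j (hH ^ k * hD ^ l) (uhCoord (k, l)) (const m) := fun k => by
    refine (hasHSum_locSum _ _ (expTerm i j k (const m))).unique ?_
    simp only [← LinearMap.comp_apply, dilogTerm_comp_expTerm hij]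
    exact hasHSum_of_finite _ _ fun l hl => hK (k, l) (Or.inr (by simpa using hl)) _
  rw [LinearMap.comp_apply, h1, map_sum]
  simp only [h2]
  rw [← Finset.sum_product']
  refine (hasHSum_fund hij isDualBasis_uhCoord (const m)).unique
    (hasHSum_of_finite _ _ fun p hp => hK p ?_ _)
  simp only [Finset.mem_product, Finset.mem_range] at hp
  omega

theorem algebraMap_ne_zero {c : Ch} (hc : c ≠ 0) : algebraMap Ch ChField c ≠ 0 := fun h =>
  hc ((injective_iff_map_eq_zero _).1 (IsFractionRing.injective Ch ChField) _ h)

theorem isExp_dualOp_expOp (hij : i ≠ j) :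
    IsExp (actA i hH * actDual j Hbar) (dualOp (expOp hij)) := by
  have h : IsOpSum (fun m => dualOp (expTerm i j m)) (dualOp (expOp hij)) :=
    isOpSum_dualOp (hasHSum_locSum _ _)
  rw [IsExp]
  convert h using 2 with m
  rw [actA_mul_actDual, ← dualOp_pow, pairOp_hH_pow hij, smul_dualOp_smul,
    ← map_natCast (algebraMap Ch ChField), inv_mul_cancel₀ (algebraMap_ne_zero
      (Nat.cast_ne_zero.2 (Nat.factorial_ne_zero m)))]
  exact one_smul ChField (dualOp (expTerm i j m))

theorem isQDilog_dualOp_dilogOp (hij : i ≠ j) :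
    IsQDilog (actA i hD * actDual j Dbar) (dualOp (dilogOp hij)) := by
  have h : IsOpSum (fun l => dualOp (dilogSign l • dilogTerm i j l)) (dualOp (dilogOp hij)) :=
    isOpSum_dualOp (hasHSum_locSum _ _)
  rw [IsQDilog]
  convert h using 2 with m
  rw [actA_mul_actDual, ← dualOp_pow, pairOp_hD_pow hij, smul_dualOp_smul, dualOp_smul, qDilogCoeff,
    div_mul_cancel₀ _ (algebraMap_ne_zero (qFact_ne_zero m))]
  rfl

theorem isCanonicalElement_dualOp_fund (hij : i ≠ j) :
    IsCanonicalElement i j (dualOp (fund hij)) := fun ι e e' H => by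
  simp only [actA_mul_actDual]
  exact isOpSum_dualOp (hasHSum_fund hij H)

end Formula

/-- The canonical element in the factors `i` and `j`. -/
def canonicalOp (n : ℕ) (i j : Fin n) : Module.End ChField (DualPow n) :=
  if hij : i ≠ j then dualOp (fund hij) else 0

theorem canonicalOp_eq {n : ℕ} {i j : Fin n} (hij : i ≠ j) :
    canonicalOp n i j = dualOp (fund hij) := dif_pos hij

theorem canonicalOp_pentagon :
    canonicalOp 3 0 1 * canonicalOp 3 0 2 * canonicalOp 3 1 2
      = canonicalOp 3 1 2 * canonicalOp 3 0 1 := by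
  rw [canonicalOp_eq (by decide), canonicalOp_eq (by decide), canonicalOp_eq (by decide),
    ← dualOp_comp, ← dualOp_comp, ← dualOp_comp]
  exact congrArg dualOp fund_pentagon_three

end HeisenbergDouble

end

open HeisenbergDouble in
theorem proposition4p5 :
    -- the Heisenberg double is the algebra presented by the listed generators and relations
    (∃ (Φ : Pres ≃ₐ[ChField] Double) (φ : PresInt ≃ₐ[Ch] doubleInt),
      (∀ p : PresInt, Φ ((1 : ChField) ⊗ₜ[Ch] p) = (1 : ChField) ⊗ₜ[Ch] φ p) ∧
      (φ (presGen HGen.H) : Module.End Ch UhDual) = piA hH ∧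
      (φ (presGen HGen.D) : Module.End Ch UhDual) = piA hD ∧
      (φ (presGen HGen.Hb) : Module.End Ch UhDual) = piDual Hbar ∧
      (φ (presGen HGen.Db) : Module.End Ch UhDual) = piDual Dbar) ∧
    -- the topological basis `H^m D^n / (m! (q)_n)` and its dual basis `H̄^m D̄^n`
    (∃ e' : ℕ × ℕ → UhDual, IsDualBasis (fun p => hH ^ p.1 * hD ^ p.2) e' ∧
      ∀ m n : ℕ, ((m.factorial : Ch) * qFact n) • e' (m, n) = dualMonomial m n) ∧
    -- the canonical element, its closed formula, and the pentagon equation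
    ∃ R : (n : ℕ) → Fin n → Fin n → Module.End ChField (DualPow n),
      (∀ (n : ℕ) (i j : Fin n), i ≠ j →
        IsCanonicalElement i j (R n i j) ∧
        ∃ E Q Qinv : Module.End ChField (DualPow n),
          IsExp (actA i hH * actDual j Hbar) E ∧
          IsQDilog (actA i hD * actDual j Dbar) Q ∧
          Q * Qinv = 1 ∧ Qinv * Q = 1 ∧ R n i j = E * Qinv) ∧
      R 3 0 1 * R 3 0 2 * R 3 1 2 = R 3 1 2 * R 3 0 1 := by

  refine ⟨exists_double_equiv, ⟨uhCoord, isDualBasis_uhCoord, fun m n => (dualMonomial_eq m n).symm⟩,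
    canonicalOp, fun n i j hij => ?_, canonicalOp_pentagon⟩
  rw [canonicalOp_eq hij]
  refine ⟨isCanonicalElement_dualOp_fund hij, dualOp (expOp hij), dualOp (dilogOp hij),
    dualOp (dilogInvOp hij), isExp_dualOp_expOp hij, isQDilog_dualOp_dilogOp hij, ?_, ?_, ?_⟩
  · rw [← dualOp_comp, dilogInvOp_comp_dilogOp, dualOp_id]
  · rw [← dualOp_comp, dilogOp_comp_dilogInvOp, dualOp_id]
  · rw [fund_eq hij, dualOp_comp]
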